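/- Let $\Sigma$ be an alphabet (a set). Let $\mathsf{Syn}$ be the strict symmetric monoidal category (monoidal product $\oplus$, unit $0$, composition $;$ in diagrammatic order, symmetry $\sigma$) freely generated by two objects $\blacktriangleright,\blacktriangleleft$ and the morphisms: black nodes $\Delta:\blacktriangleright\to\blacktriangleright\blacktriangleright$, $\delta:\blacktriangleright\to 0$, $\nabla:\blacktriangleright\blacktriangleright\to\blacktriangleright$, $\eta:0\to\blacktriangleright$; bent wires $\mathrm{cup}:0\to\blacktriangleleft\blacktriangleright$, $\mathrm{cap}:\blacktriangleleft\blacktriangleright\to 0$; letters $a:\blacktriangleright\to\blacktriangleright$ for $a\in\Sigma$; and white nodes $\Delta_w:\blacktriangleright\to\blacktriangleright\blacktriangleright$, $\delta_w:\blacktriangleright\to 0$, $\nabla_w:\blacktriangleright\blacktriangleright\to\blacktriangleright$, $\eta_w:0\to\blacktriangleright$. Its morphisms are called diagrams. Let $\le_{KDA}$ be the smallest family of preorders on the homsets of $\mathsf{Syn}$ that makes $;$ and $\oplus$ monotone and contains the following axioms (an equality stands for two inequalities), where $1=\mathrm{id}_{\blacktriangleright}$, $1'=\mathrm{id}_{\blacktriangleleft}$,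 $1_0=\mathrm{id}_0$, $\sigma=\sigma_{\blacktriangleright,\blacktriangleright}$, $\mu=1\oplus\sigma\oplus 1$ and $\mathrm{cap}'=\sigma_{\blacktriangleright,\blacktriangleleft};\mathrm{cap}$. * (A) $(1\oplus\mathrm{cup});(\mathrm{cap}'\oplus 1)=1$; $\ (\mathrm{cup}\oplus 1');(1'\oplus\mathrm{cap}')=1'$; $\ \mathrm{cup};\mathrm{cap}=1_0$. * (B) $(\Delta,\delta)$ is a cocommutative comonoid and $(\nabla,\eta)$ a commutative monoid; $\nabla;\Delta=(\Delta\oplus\Delta);\mu;(\nabla\oplus\nabla)$; $\eta;\Delta=\eta\oplus\eta$; $\nabla;\delta=\delta\oplus\delta$; $\Delta;\nabla=1$; $\eta;\delta=1_0$; $(\mathrm{cup}\oplus1);(1'\oplus(\nabla;\Delta));(\mathrm{cap}\oplus1)=1$. * (C) $(\Delta_w,\delta_w)$ is a cocommutative comonoid and $(\nabla_w,\eta_w)$ a commutative monoid. * (D) $\eta_w;\Delta=\eta_w\oplus\eta_w$; $\nabla_w;\Delta=(\Delta\oplus\Delta);\mu;(\nabla_w\oplus\nabla_w)$; $\nabla_w;\delta=\delta\oplus\delta$;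 $\eta;\Delta_w=\eta\oplus\eta$; $\nabla;\Delta_w=(\Delta_w\oplus\Delta_w);\mu;(\nabla\oplus\nabla)$; $\nabla;\delta_w=\delta_w\oplus\delta_w$. * (E) $(\nabla\oplus\nabla);\nabla_w\le\mu;(\nabla_w\oplus\nabla_w);\nabla$; $(\eta\oplus\eta);\nabla_w\le\eta$; $\Delta_w;(\Delta\oplus\Delta)\le\Delta;(\Delta_w\oplus\Delta_w);\mu$; $\Delta_w;(\delta\oplus\delta)\le\delta$; and for $a\in\Sigma$: $a;\Delta=\Delta;(a\oplus a)$, $a;\delta=\delta$, $(a\oplus a);\nabla_w=\nabla_w;a$, $\eta_w=\eta_w;a$, $\nabla;a=(a\oplus a);\nabla$, $\eta;a=\eta$, $\Delta_w;(a\oplus a)=a;\Delta_w$, $\delta_w=a;\delta_w$. * (F) $\nabla;\Delta\le1\oplus1$; $1\le\delta;\eta$; $1\le\Delta;\nabla$; $\eta;\delta\le1_0$; $1\oplus1\le\nabla_w;\Delta$; $\delta;\eta_w\le1$; $\Delta;\nabla_w\le1$; $1_0\le\eta_w;\delta$; $1\oplus1\le\nabla;\Delta_w$; $\delta_w;\eta\le1$;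 $\Delta_w;\nabla\le1$; $1_0\le\eta;\delta_w$. Write $c=_{KDA}c'$ if $c\le_{KDA}c'$ and $c'\le_{KDA}c$. A block of some generators is a diagram built from them by $;$ and $\oplus$, possibly with identities and permutations of wires. An automaton-diagram is a block of all the generators other than the white nodes. A matrix-diagram $\blacktriangleright^m\to\blacktriangleright^n$ is a diagram that factors as a block of $\Delta,\delta$, followed by a block of letters, followed by a block of $\nabla,\eta$, such that every path from a left port to a right port passes through at most one letter; it is $\epsilon$-free if every such path passes through a letter, and it is a relation-diagram if it contains no letter. For $d:\blacktriangleright^l\to\blacktriangleright^l$ let $d^*:\blacktriangleright^l\to\blacktriangleright^l$ be the feedback loop $$d^*=(\mathrm{cup}_l\oplus\mathrm{id});\bigl(\mathrm{id}\oplus(\nabla_l;\Delta_l;(d\oplus\mathrm{id}))\bigr);(\mathrm{cap}_l\oplus\mathrm{id}),$$ where $\mathrm{cup}_l:0\to\blacktriangleleft^l\blacktriangleright^l$, $\mathrm{cap}_l:\blacktriangleleft^l\blacktriangleright^l\to0$, $\nabla_l:\blacktriangleright^l\blacktriangleright^l\to\blacktriangleright^l$, $\Delta_l:\blacktriangleright^l\to\blacktriangleright^l\blacktriangleright^l$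 are the $l$-wire versions of the generators, connecting $i$-th wires with $i$-th wires. **Proposition.** Every automaton-diagram $c:\blacktriangleright\to\blacktriangleright$ has a representation: there are $l\in\mathbb N$, an $\epsilon$-free matrix-diagram $d:\blacktriangleright^l\to\blacktriangleright^l$ and relation-diagrams $e:\blacktriangleright\to\blacktriangleright^l$ and $f:\blacktriangleright^l\to\blacktriangleright$ such that $c=_{KDA}e\,;d^*;f$. -/

import Mathlib

universe u

namespace KleeneDiagram

/-! ### Syntax: the free strict symmetric monoidal category on the signature -/

/-- The two generating objects. -/
inductive Dir : Type
  | right : Dir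
  | left : Dir

/-- The generating morphisms, over the alphabet `A`.
`copy`, `del`, `merge`, `gen` are the black nodes, `cup` and `cap` the bent wires, `letter a` the
action of a letter; `wmult`, `wunit`, `wcomult`, `wcounit` are the white nodes. -/
inductive Gen (A : Type u) : List Dir → List Dir → Type u
  | copy : Gen A [.right] [.right, .right]
  | del : Gen A [.right] []
  | merge : Gen A [.right, .right] [.right]
  | gen : Gen A [] [.right]
  | cup : Gen A [] [.left, .right]
  | cap : Gen A [.left, .right] []
  | letter (a : A) : Gen A [.right] [.right]
  | wmult : Gen A [.right, .right] [.right]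
  | wunit : Gen A [] [.right]
  | wcomult : Gen A [.right] [.right, .right]
  | wcounit : Gen A [.right] []

/-- Terms for the morphisms of the free strict symmetric monoidal category. Objects are lists of
generating objects, the monoidal product of objects is concatenation. -/
inductive Diag (A : Type u) : List Dir → List Dir → Type u
  | of {X Y : List Dir} (g : Gen A X Y) : Diag A X Y
  | id (X : List Dir) : Diag A X X
  | swap (X Y : List Dir) : Diag A (X ++ Y) (Y ++ X)
  | comp {X Y Z : List Dir} (f : Diag A X Y) (g : Diag A Y Z) : Diag A X Z
  | tensor {X₁ Y₁ X₂ Y₂ : List Dir} (f : Diag A X₁ Y₁) (g : Diag A X₂ Y₂) :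
      Diag A (X₁ ++ X₂) (Y₁ ++ Y₂)

/-- Sequential composition, in diagrammatic order. -/
infixl:60 " ⨟ " => Diag.comp

/-- Monoidal product (vertical juxtaposition). -/
infixl:70 " ⊹ " => Diag.tensor

namespace Diag

variable {A : Type u}

/-- Transport along equalities of objects. -/
def cast {X X' Y Y' : List Dir} (hX : X = X') (hY : Y = Y') (f : Diag A X Y) : Diag A X' Y' :=
  hX ▸ hY ▸ f

/-- The congruence generated by the laws of strict symmetric monoidal categories. -/
inductive SMCEq : {X Y : List Dir} → Diag A X Y → Diag A X Y → Prop
  | refl {X Y : List Dir} (f : Diag A X Y) : SMCEq f f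
  | symm {X Y : List Dir} {f g : Diag A X Y} : SMCEq f g → SMCEq g f
  | trans {X Y : List Dir} {f g h : Diag A X Y} : SMCEq f g → SMCEq g h → SMCEq f h
  | comp_congr {X Y Z : List Dir} {f f' : Diag A X Y} {g g' : Diag A Y Z} :
      SMCEq f f' → SMCEq g g' → SMCEq (f ⨟ g) (f' ⨟ g')
  | tensor_congr {X₁ Y₁ X₂ Y₂ : List Dir} {f f' : Diag A X₁ Y₁} {g g' : Diag A X₂ Y₂} :
      SMCEq f f' → SMCEq g g' → SMCEq (f ⊹ g) (f' ⊹ g')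
  | id_comp {X Y : List Dir} (f : Diag A X Y) : SMCEq (id X ⨟ f) f
  | comp_id {X Y : List Dir} (f : Diag A X Y) : SMCEq (f ⨟ id Y) f
  | comp_assoc {W X Y Z : List Dir} (f : Diag A W X) (g : Diag A X Y) (h : Diag A Y Z) :
      SMCEq (f ⨟ g ⨟ h) (f ⨟ (g ⨟ h))
  | tensor_id (X Y : List Dir) : SMCEq (id X ⊹ id Y) (id (X ++ Y))
  | interchange {X₁ Y₁ Z₁ X₂ Y₂ Z₂ : List Dir} (f₁ : Diag A X₁ Y₁) (g₁ : Diag A Y₁ Z₁)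
      (f₂ : Diag A X₂ Y₂) (g₂ : Diag A Y₂ Z₂) :
      SMCEq ((f₁ ⊹ f₂) ⨟ (g₁ ⊹ g₂)) ((f₁ ⨟ g₁) ⊹ (f₂ ⨟ g₂))
  | nil_tensor {X Y : List Dir} (f : Diag A X Y) :
      SMCEq (cast (List.nil_append X) (List.nil_append Y) (id [] ⊹ f)) f
  | tensor_nil {X Y : List Dir} (f : Diag A X Y) :
      SMCEq (cast (List.append_nil X) (List.append_nil Y) (f ⊹ id [])) f
  | tensor_assoc {X₁ Y₁ X₂ Y₂ X₃ Y₃ : List Dir} (f : Diag A X₁ Y₁) (g : Diag A X₂ Y₂)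
      (h : Diag A X₃ Y₃) :
      SMCEq (cast (List.append_assoc X₁ X₂ X₃) (List.append_assoc Y₁ Y₂ Y₃) (f ⊹ g ⊹ h))
        (f ⊹ (g ⊹ h))
  | swap_natural {X₁ Y₁ X₂ Y₂ : List Dir} (f : Diag A X₁ Y₁) (g : Diag A X₂ Y₂) :
      SMCEq ((f ⊹ g) ⨟ swap Y₁ Y₂) (swap X₁ X₂ ⨟ (g ⊹ f))
  | swap_swap (X Y : List Dir) : SMCEq (swap X Y ⨟ swap Y X) (id (X ++ Y))
  | hexagon (X Y Z : List Dir) :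
      SMCEq (swap X (Y ++ Z))
        (cast (List.append_assoc X Y Z) (List.append_assoc Y X Z) (swap X Y ⊹ id Z) ⨟
          cast rfl (List.append_assoc Y Z X).symm (id Y ⊹ swap X Z))

/-- Paths from left ports to right ports through a generator. -/
def genPath : {X Y : List Dir} → Gen A X Y → ℕ → List A → ℕ → Prop
  | _, _, .copy, i, w, j => i = 0 ∧ w = [] ∧ (j = 0 ∨ j = 1)
  | _, _, .merge, i, w, j => (i = 0 ∨ i = 1) ∧ w = [] ∧ j = 0
  | _, _, .letter a, i, w, j => i = 0 ∧ w = [a] ∧ j = 0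
  | _, _, .wcomult, i, w, j => i = 0 ∧ w = [] ∧ (j = 0 ∨ j = 1)
  | _, _, .wmult, i, w, j => (i = 0 ∨ i = 1) ∧ w = [] ∧ j = 0
  | _, _, .del, _, _, _ => False
  | _, _, .gen, _, _, _ => False
  | _, _, .cup, _, _, _ => False
  | _, _, .cap, _, _, _ => False
  | _, _, .wunit, _, _, _ => False
  | _, _, .wcounit, _, _, _ => False

/-- `f.Path i w j`: there is a path going from the `i`-th left port of `f` to its `j`-th right port
(ports are numbered from `0`, from top to bottom) along which the letters met are those of the word
`w`, in this order. Only forward paths are considered, which are all the paths of a diagram without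
`cup` and `cap`. -/
def Path : {X Y : List Dir} → Diag A X Y → ℕ → List A → ℕ → Prop
  | _, _, of g, i, w, j => genPath g i w j
  | _, _, id X, i, w, j => i < X.length ∧ w = [] ∧ j = i
  | _, _, swap X Y, i, w, j =>
      w = [] ∧ ((i < X.length ∧ j = Y.length + i) ∨ (j < Y.length ∧ i = X.length + j))
  | _, _, comp f g, i, w, j => ∃ u k v, f.Path i u k ∧ g.Path k v j ∧ w = u ++ v
  | _, _, @tensor _ X₁ Y₁ _ _ f g, i, w, j =>
      f.Path i w j ∨ ∃ i' j', i = X₁.length + i' ∧ j = Y₁.length + j' ∧ g.Path i' w j'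

theorem genPath_bound {X Y : List Dir} (g : Gen A X Y) {i : ℕ} {w : List A} {j : ℕ}
    (h : genPath g i w j) : i < X.length ∧ j < Y.length := by
  cases g <;> simp [genPath] at h ⊢ <;> omega

theorem path_bound {X Y : List Dir} (f : Diag A X Y) {i : ℕ} {w : List A} {j : ℕ}
    (h : f.Path i w j) : i < X.length ∧ j < Y.length := by
  induction f generalizing i w j with
  | of g => exact genPath_bound g h
  | id X => simp only [Path] at h; omega
  | swap X Y => simp only [Path, List.length_append] at h ⊢; omega
  | comp f g ihf ihg =>
    obtain ⟨u, k, v, hf, hg, -⟩ := h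
    exact ⟨(ihf hf).1, (ihg hg).2⟩
  | tensor f g ihf ihg =>
    simp only [List.length_append]
    rcases h with h | ⟨i', j', rfl, rfl, h⟩
    · have := ihf h; omega
    · have := ihg h; omega

theorem path_cast {X X' Y Y' : List Dir} (hX : X = X') (hY : Y = Y') (f : Diag A X Y) (i : ℕ)
    (w : List A) (j : ℕ) : (cast hX hY f).Path i w j ↔ f.Path i w j := by
  subst hX hY; rfl

theorem SMCEq.path_iff {X Y : List Dir} {f g : Diag A X Y} (h : SMCEq f g) (i : ℕ) (w : List A)
    (j : ℕ) : f.Path i w j ↔ g.Path i w j := by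
  induction h generalizing i w j with
  | refl => rfl
  | symm _ ih => exact (ih i w j).symm
  | trans _ _ ih₁ ih₂ => exact (ih₁ i w j).trans (ih₂ i w j)
  | comp_congr _ _ ih₁ ih₂ => simp only [Path, ih₁, ih₂]
  | tensor_congr _ _ ih₁ ih₂ => simp only [Path, ih₁, ih₂]
  | id_comp f =>
    simp only [Path]
    constructor
    · rintro ⟨u, k, v, ⟨-, rfl, rfl⟩, h, rfl⟩; exact h
    · intro h; exact ⟨[], i, w, ⟨(path_bound f h).1, rfl, rfl⟩, h, rfl⟩
  | comp_id f =>
    simp only [Path]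
    constructor
    · rintro ⟨u, k, v, h, ⟨-, rfl, rfl⟩, rfl⟩; simpa using h
    · intro h; exact ⟨w, j, [], h, ⟨(path_bound f h).2, rfl, rfl⟩, by simp⟩
  | comp_assoc f g h =>
    simp only [Path]
    constructor
    · rintro ⟨_, k, v, ⟨u, k', v', h₁, h₂, rfl⟩, h₃, rfl⟩
      exact ⟨u, k', v' ++ v, h₁, ⟨v', k, v, h₂, h₃, rfl⟩, by simp⟩
    · rintro ⟨u, k, _, h₁, ⟨v, k', v', h₂, h₃, rfl⟩, rfl⟩
      exact ⟨u ++ v, k', v', ⟨u, k, v, h₁, h₂, rfl⟩, h₃, by simp⟩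
  | tensor_id X Y =>
    simp only [Path, List.length_append]
    constructor
    · rintro (⟨h, rfl, rfl⟩ | ⟨i', j', rfl, rfl, h, rfl, rfl⟩)
      · exact ⟨by omega, rfl, rfl⟩
      · exact ⟨by omega, rfl, rfl⟩
    · rintro ⟨h, rfl, rfl⟩
      by_cases hj : j < X.length
      · exact Or.inl ⟨hj, rfl, rfl⟩
      · exact Or.inr ⟨j - X.length, j - X.length, by omega, by omega, by omega, rfl, rfl⟩
  | interchange f₁ g₁ f₂ g₂ =>
    simp only [Path]
    constructor
    · rintro ⟨u, k, v, h₁ | ⟨i', k', rfl, rfl, h₁⟩, h₂ | ⟨k'', j', hk, rfl, h₂⟩, rfl⟩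
      · exact Or.inl ⟨u, k, v, h₁, h₂, rfl⟩
      · have := path_bound _ h₁; omega
      · have := path_bound _ h₂; omega
      · obtain rfl : k' = k'' := by omega
        exact Or.inr ⟨i', j', rfl, rfl, u, k', v, h₁, h₂, rfl⟩
    · rintro (⟨u, k, v, h₁, h₂, rfl⟩ | ⟨i', j', rfl, rfl, u, k, v, h₁, h₂, rfl⟩)
      · exact ⟨u, k, v, Or.inl h₁, Or.inl h₂, rfl⟩
      · exact ⟨u, _, v, Or.inr ⟨i', k, rfl, rfl, h₁⟩, Or.inr ⟨k, j', rfl, rfl, h₂⟩, rfl⟩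
  | nil_tensor f =>
    rw [path_cast]
    simp [Path]
  | tensor_nil f =>
    rw [path_cast]
    simp [Path]
  | tensor_assoc f g h =>
    rw [path_cast]
    simp only [Path, List.length_append]
    constructor
    · rintro ((h | ⟨i', j', rfl, rfl, h⟩) | ⟨i', j', rfl, rfl, h⟩)
      · exact Or.inl h
      · exact Or.inr ⟨i', j', rfl, rfl, Or.inl h⟩
      · exact Or.inr ⟨_, _, Nat.add_assoc _ _ _, Nat.add_assoc _ _ _, Or.inr ⟨i', j', rfl, rfl, h⟩⟩
    · rintro (h | ⟨i', j', rfl, rfl, h | ⟨i'', j'', rfl, rfl, h⟩⟩)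
      · exact Or.inl (Or.inl h)
      · exact Or.inl (Or.inr ⟨i', j', rfl, rfl, h⟩)
      · exact Or.inr ⟨i'', j'', (Nat.add_assoc _ _ _).symm, (Nat.add_assoc _ _ _).symm, h⟩
  | @swap_natural X₁ Y₁ X₂ Y₂ f g =>
    simp only [Path]
    constructor
    · rintro ⟨u, k, v, h₁ | ⟨i', k', rfl, rfl, h₁⟩, ⟨rfl, h₂⟩, rfl⟩
      · have hb := path_bound _ h₁
        refine ⟨[], X₂.length + i, u, ⟨rfl, Or.inl ⟨hb.1, rfl⟩⟩,
          Or.inr ⟨i, k, rfl, by omega, h₁⟩, by simp⟩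
      · have hb := path_bound _ h₁
        obtain rfl : j = k' := by omega
        exact ⟨[], i', u, ⟨rfl, Or.inr ⟨hb.1, rfl⟩⟩, Or.inl h₁, by simp⟩
    · rintro ⟨u, k, v, ⟨rfl, h₂⟩, h₁ | ⟨i', k', rfl, rfl, h₁⟩, rfl⟩
      · have hb := path_bound _ h₁
        refine ⟨w, Y₁.length + j, [], Or.inr ⟨k, j, by omega, rfl, h₁⟩,
          ⟨rfl, Or.inr ⟨hb.2, rfl⟩⟩, by simp⟩
      · have hb := path_bound _ h₁
        obtain rfl : i = i' := by omega
        exact ⟨w, k', [], Or.inl h₁, ⟨rfl, Or.inl ⟨hb.2, rfl⟩⟩, by simp⟩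
  | swap_swap X Y =>
    simp only [Path, List.length_append]
    constructor
    · rintro ⟨u, k, v, ⟨rfl, h₁⟩, ⟨rfl, h₂⟩, rfl⟩
      exact ⟨by omega, rfl, by omega⟩
    · rintro ⟨h, rfl, rfl⟩
      by_cases hj : j < X.length
      · exact ⟨[], Y.length + j, [], ⟨rfl, by omega⟩, ⟨rfl, by omega⟩, rfl⟩
      · exact ⟨[], j - X.length, [], ⟨rfl, by omega⟩, ⟨rfl, by omega⟩, rfl⟩
  | hexagon X Y Z =>
    simp only [Path, path_cast, List.length_append]
    constructor
    · rintro ⟨rfl, h⟩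
      by_cases h₁ : i < X.length
      · exact ⟨[], Y.length + i, [], Or.inl ⟨rfl, by omega⟩,
          Or.inr ⟨i, Z.length + i, rfl, by omega, rfl, by omega⟩, rfl⟩
      · by_cases h₂ : j < Y.length
        · exact ⟨[], j, [], Or.inl ⟨rfl, by omega⟩, Or.inl ⟨h₂, rfl, rfl⟩, rfl⟩
        · exact ⟨[], i, [], Or.inr ⟨j - Y.length, j - Y.length, by omega, by omega, by omega, rfl, rfl⟩,
            Or.inr ⟨i - Y.length, j - Y.length, by omega, by omega, rfl, by omega⟩, rfl⟩
    · rintro ⟨u, k, v, ⟨rfl, h₁⟩ | ⟨i', j', rfl, rfl, h₁, rfl, rfl⟩,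
        ⟨h₂, rfl, rfl⟩ | ⟨i'', j'', h₃, rfl, rfl, h₂⟩, rfl⟩
      · exact ⟨rfl, by omega⟩
      · exact ⟨rfl, by omega⟩
      · exact ⟨rfl, by omega⟩
      · exact ⟨rfl, by omega⟩

/-- Equality of terms up to the laws of strict symmetric monoidal categories. -/
instance setoid (A : Type u) (X Y : List Dir) : Setoid (Diag A X Y) where
  r := SMCEq
  iseqv := ⟨SMCEq.refl, SMCEq.symm, SMCEq.trans⟩

end Diag

/-- The morphisms `X → Y` of the free strict symmetric monoidal category: (string) diagrams. -/
def Syn (A : Type u) (X Y : List Dir) : Type u := Quotient (Diag.setoid A X Y)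

namespace Syn

variable {A : Type u}

/-- The diagram denoted by a term. -/
def mk {X Y : List Dir} (f : Diag A X Y) : Syn A X Y := Quotient.mk (Diag.setoid A X Y) f

/-- Identity diagram. -/
def id (X : List Dir) : Syn A X X := mk (Diag.id X)

/-- Sequential composition of diagrams. -/
def comp {X Y Z : List Dir} (f : Syn A X Y) (g : Syn A Y Z) : Syn A X Z :=
  Quotient.map₂ Diag.comp (fun _ _ h _ _ h' => Diag.SMCEq.comp_congr h h') f g

/-- Monoidal product of diagrams. -/
def tensor {X₁ Y₁ X₂ Y₂ : List Dir} (f : Syn A X₁ Y₁) (g : Syn A X₂ Y₂) :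
    Syn A (X₁ ++ X₂) (Y₁ ++ Y₂) :=
  Quotient.map₂ Diag.tensor (fun _ _ h _ _ h' => Diag.SMCEq.tensor_congr h h') f g

/-- Transport of diagrams along equalities of objects. -/
def cast {X X' Y Y' : List Dir} (hX : X = X') (hY : Y = Y') (f : Syn A X Y) : Syn A X' Y' :=
  hX ▸ hY ▸ f

/-- Paths in a diagram; see `Diag.Path`. -/
def Path {X Y : List Dir} (f : Syn A X Y) (i : ℕ) (w : List A) (j : ℕ) : Prop :=
  Quotient.lift (fun f : Diag A X Y => f.Path i w j)
    (fun _ _ h => propext (Diag.SMCEq.path_iff h i w j)) f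

end Syn

/-! ### The inequational theory -/

namespace Diag

variable {A : Type u}

/-- One wire `▶`. -/
abbrev wire : Diag A [.right] [.right] := id [.right]

/-- One wire `◀`. -/
abbrev wireL : Diag A [.left] [.left] := id [.left]

/-- Crossing of two wires `▶`. -/
abbrev cross : Diag A [.right, .right] [.right, .right] := swap [.right] [.right]

/-- Four wires `▶`, the two middle ones being exchanged. -/
abbrev crossMid : Diag A [.right, .right, .right, .right] [.right, .right, .right, .right] :=
  wire ⊹ cross ⊹ wire

/-- The cap precomposed with a crossing. -/
abbrev capSwap : Diag A [.right, .left] [] := swap [.right] [.left] ⨟ of .cap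

/-- `merge` followed by `copy`, below a wire `◀`. -/
abbrev mergeCopy : Diag A [.left, .right, .right] [.left, .right, .right] :=
  wireL ⊹ (of .merge ⨟ of .copy)

end Diag

open Diag in
/-- The axioms of Kleene Diagram Algebra that are equalities. -/
inductive AxEq {A : Type u} : {X Y : List Dir} → Diag A X Y → Diag A X Y → Prop
  | a1 : AxEq (X := [.right]) (Y := [.right]) ((wire ⊹ of .cup) ⨟ (capSwap ⊹ wire)) wire
  | a2 : AxEq (X := [.left]) (Y := [.left]) ((of .cup ⊹ wireL) ⨟ (wireL ⊹ capSwap)) wireL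
  | a3 : AxEq (of .cup ⨟ of .cap) (id [])
  | b1 : AxEq (X := [.right]) (Y := [.right, .right, .right])
      (of .copy ⨟ (of .copy ⊹ wire)) (of .copy ⨟ (wire ⊹ of .copy))
  | b2 : AxEq (X := [.right]) (Y := [.right]) (of .copy ⨟ (wire ⊹ of .del)) wire
  | b3 : AxEq (of .copy ⨟ cross) (of .copy)
  | b4 : AxEq (X := [.right, .right, .right]) (Y := [.right])
      ((of .merge ⊹ wire) ⨟ of .merge) ((wire ⊹ of .merge) ⨟ of .merge)
  | b5 : AxEq (X := [.right]) (Y := [.right]) ((wire ⊹ of .gen) ⨟ of .merge) wire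
  | b6 : AxEq (cross ⨟ of .merge) (of .merge)
  | b7 : AxEq (X := [.right, .right]) (Y := [.right, .right])
      (of .merge ⨟ of .copy) ((of .copy ⊹ of .copy) ⨟ crossMid ⨟ (of .merge ⊹ of .merge))
  | b8 : AxEq (X := []) (Y := [.right, .right]) (of .gen ⨟ of .copy) (of .gen ⊹ of .gen)
  | b9 : AxEq (X := [.right, .right]) (Y := []) (of .merge ⨟ of .del) (of .del ⊹ of .del)
  | b10 : AxEq (of .copy ⨟ of .merge) wire
  | b11 : AxEq (of .gen ⨟ of .del) (id [])
  | b12 : AxEq (X := [.right]) (Y := [.right])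
      ((of .cup ⊹ wire) ⨟ mergeCopy ⨟ (of .cap ⊹ wire)) wire
  | c1 : AxEq (X := [.right]) (Y := [.right, .right, .right])
      (of .wcomult ⨟ (of .wcomult ⊹ wire)) (of .wcomult ⨟ (wire ⊹ of .wcomult))
  | c2 : AxEq (X := [.right]) (Y := [.right]) (of .wcomult ⨟ (wire ⊹ of .wcounit)) wire
  | c3 : AxEq (of .wcomult ⨟ cross) (of .wcomult)
  | c4 : AxEq (X := [.right, .right, .right]) (Y := [.right])
      ((of .wmult ⊹ wire) ⨟ of .wmult) ((wire ⊹ of .wmult) ⨟ of .wmult)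
  | c5 : AxEq (X := [.right]) (Y := [.right]) ((wire ⊹ of .wunit) ⨟ of .wmult) wire
  | c6 : AxEq (cross ⨟ of .wmult) (of .wmult)
  | d1 : AxEq (X := []) (Y := [.right, .right]) (of .wunit ⨟ of .copy) (of .wunit ⊹ of .wunit)
  | d2 : AxEq (X := [.right, .right]) (Y := [.right, .right])
      (of .wmult ⨟ of .copy) ((of .copy ⊹ of .copy) ⨟ crossMid ⨟ (of .wmult ⊹ of .wmult))
  | d3 : AxEq (X := [.right, .right]) (Y := []) (of .wmult ⨟ of .del) (of .del ⊹ of .del)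
  | d4 : AxEq (X := []) (Y := [.right, .right]) (of .gen ⨟ of .wcomult) (of .gen ⊹ of .gen)
  | d5 : AxEq (X := [.right, .right]) (Y := [.right, .right])
      (of .merge ⨟ of .wcomult)
      ((of .wcomult ⊹ of .wcomult) ⨟ crossMid ⨟ (of .merge ⊹ of .merge))
  | d6 : AxEq (X := [.right, .right]) (Y := [])
      (of .merge ⨟ of .wcounit) (of .wcounit ⊹ of .wcounit)
  | e6 (a : A) : AxEq (X := [.right]) (Y := [.right, .right])
      (of (.letter a) ⨟ of .copy) (of .copy ⨟ (of (.letter a) ⊹ of (.letter a)))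
  | e7 (a : A) : AxEq (of (.letter a) ⨟ of .del) (of .del)
  | e8 (a : A) : AxEq (X := [.right, .right]) (Y := [.right])
      ((of (.letter a) ⊹ of (.letter a)) ⨟ of .wmult) (of .wmult ⨟ of (.letter a))
  | e9 (a : A) : AxEq (of .wunit) (of .wunit ⨟ of (.letter a))
  | e10 (a : A) : AxEq (X := [.right, .right]) (Y := [.right])
      (of .merge ⨟ of (.letter a)) ((of (.letter a) ⊹ of (.letter a)) ⨟ of .merge)
  | e11 (a : A) : AxEq (of .gen ⨟ of (.letter a)) (of .gen)
  | e12 (a : A) : AxEq (X := [.right]) (Y := [.right, .right])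
      (of .wcomult ⨟ (of (.letter a) ⊹ of (.letter a))) (of (.letter a) ⨟ of .wcomult)
  | e13 (a : A) : AxEq (of .wcounit) (of (.letter a) ⨟ of .wcounit)

open Diag in
/-- The axioms of Kleene Diagram Algebra that are inequalities. -/
inductive AxLe {A : Type u} : {X Y : List Dir} → Diag A X Y → Diag A X Y → Prop
  | e1 : AxLe (X := [.right, .right, .right, .right]) (Y := [.right])
      ((of .merge ⊹ of .merge) ⨟ of .wmult)
      (crossMid ⨟ (of .wmult ⊹ of .wmult) ⨟ of .merge)
  | e2 : AxLe (X := []) (Y := [.right]) ((of .gen ⊹ of .gen) ⨟ of .wmult) (of .gen)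
  | e4 : AxLe (X := [.right]) (Y := [.right, .right, .right, .right])
      (of .wcomult ⨟ (of .copy ⊹ of .copy))
      (of .copy ⨟ (of .wcomult ⊹ of .wcomult) ⨟ crossMid)
  | e5 : AxLe (X := [.right]) (Y := []) (of .wcomult ⨟ (of .del ⊹ of .del)) (of .del)
  | f1 : AxLe (of .merge ⨟ of .copy) (id [.right, .right])
  | f2 : AxLe wire (of .del ⨟ of .gen)
  | f3 : AxLe wire (of .copy ⨟ of .merge)
  | f4 : AxLe (of .gen ⨟ of .del) (id [])
  | f5 : AxLe (id [.right, .right]) (of .wmult ⨟ of .copy)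
  | f6 : AxLe (of .del ⨟ of .wunit) wire
  | f7 : AxLe (of .copy ⨟ of .wmult) wire
  | f8 : AxLe (id []) (of .wunit ⨟ of .del)
  | f9 : AxLe (id [.right, .right]) (of .merge ⨟ of .wcomult)
  | f10 : AxLe (of .wcounit ⨟ of .gen) wire
  | f11 : AxLe (of .wcomult ⨟ of .merge) wire
  | f12 : AxLe (id []) (of .gen ⨟ of .wcounit)

/-- The order of Kleene Diagram Algebra on diagrams: the smallest preorder on every homset which
contains the axioms (an equality standing for two inequalities) and for which both compositions are
monotone. -/
inductive KDALe {A : Type u} : {X Y : List Dir} → Syn A X Y → Syn A X Y → Prop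
  | ax_le {X Y : List Dir} {f g : Diag A X Y} : AxLe f g → KDALe (Syn.mk f) (Syn.mk g)
  | ax_eq {X Y : List Dir} {f g : Diag A X Y} : AxEq f g → KDALe (Syn.mk f) (Syn.mk g)
  | ax_eq_symm {X Y : List Dir} {f g : Diag A X Y} : AxEq f g → KDALe (Syn.mk g) (Syn.mk f)
  | refl {X Y : List Dir} (f : Syn A X Y) : KDALe f f
  | trans {X Y : List Dir} {f g h : Syn A X Y} : KDALe f g → KDALe g h → KDALe f h
  | comp {X Y Z : List Dir} {f f' : Syn A X Y} {g g' : Syn A Y Z} :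
      KDALe f f' → KDALe g g' → KDALe (f.comp g) (f'.comp g')
  | tensor {X₁ Y₁ X₂ Y₂ : List Dir} {f f' : Syn A X₁ Y₁} {g g' : Syn A X₂ Y₂} :
      KDALe f f' → KDALe g g' → KDALe (f.tensor g) (f'.tensor g')

/-- Equality of diagrams in Kleene Diagram Algebra. -/
def KDAEq {A : Type u} {X Y : List Dir} (f g : Syn A X Y) : Prop := KDALe f g ∧ KDALe g f

/-! ### Blocks, automaton-diagrams, matrix-diagrams, relation-diagrams -/

/-- `IsBlock S f`: the diagram `f` is composed only of generators in `S`, using both compositions,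
possibly with identities and permutations of the wires. -/
inductive IsBlock {A : Type u} (S : ∀ X Y : List Dir, Gen A X Y → Prop) :
    {X Y : List Dir} → Syn A X Y → Prop
  | of {X Y : List Dir} (g : Gen A X Y) : S X Y g → IsBlock S (Syn.mk (Diag.of g))
  | id (X : List Dir) : IsBlock S (Syn.mk (Diag.id X))
  | swap (X Y : List Dir) : IsBlock S (Syn.mk (Diag.swap X Y))
  | comp {X Y Z : List Dir} {f : Syn A X Y} {g : Syn A Y Z} :
      IsBlock S f → IsBlock S g → IsBlock S (f.comp g)
  | tensor {X₁ Y₁ X₂ Y₂ : List Dir} {f : Syn A X₁ Y₁} {g : Syn A X₂ Y₂} :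
      IsBlock S f → IsBlock S g → IsBlock S (f.tensor g)

namespace Gen

variable {A : Type u}

/-- `copy` and `del`. -/
inductive IsComonoid : ∀ X Y : List Dir, Gen A X Y → Prop
  | copy : IsComonoid _ _ .copy
  | del : IsComonoid _ _ .del

/-- `merge` and `gen`. -/
inductive IsMonoid : ∀ X Y : List Dir, Gen A X Y → Prop
  | merge : IsMonoid _ _ .merge
  | gen : IsMonoid _ _ .gen

/-- The letters. -/
inductive IsLetter : ∀ X Y : List Dir, Gen A X Y → Prop
  | letter (a : A) : IsLetter _ _ (.letter a)

/-- The black generators other than the letters, `cup` and `cap`. -/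
inductive IsRel : ∀ X Y : List Dir, Gen A X Y → Prop
  | copy : IsRel _ _ .copy
  | del : IsRel _ _ .del
  | merge : IsRel _ _ .merge
  | gen : IsRel _ _ .gen

/-- The generators of automaton-diagrams: all of them but the white nodes. -/
inductive IsAut : ∀ X Y : List Dir, Gen A X Y → Prop
  | copy : IsAut _ _ .copy
  | del : IsAut _ _ .del
  | merge : IsAut _ _ .merge
  | gen : IsAut _ _ .gen
  | cup : IsAut _ _ .cup
  | cap : IsAut _ _ .cap
  | letter (a : A) : IsAut _ _ (.letter a)

end Gen

/-- `n` wires `▶`. -/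
abbrev rs (n : ℕ) : List Dir := List.replicate n .right

/-- `n` wires `◀`. -/
abbrev ls (n : ℕ) : List Dir := List.replicate n .left

section

variable {A : Type u}

/-- A diagram built from the black generators. -/
def IsAutomatonDiagram {X Y : List Dir} (c : Syn A X Y) : Prop := IsBlock Gen.IsAut c

/-- A left-to-right diagram that factors as a block of `copy`, `del`, then a block of letters, then
a block of `merge`, `gen`, in which every path from a left port to a right port passes through at
most one letter. -/
def IsMatrixDiagram {m n : ℕ} (d : Syn A (rs m) (rs n)) : Prop :=
  (∃ (p q : ℕ) (b : Syn A (rs m) (rs p)) (s : Syn A (rs p) (rs q)) (c : Syn A (rs q) (rs n)),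
    IsBlock Gen.IsComonoid b ∧ IsBlock Gen.IsLetter s ∧ IsBlock Gen.IsMonoid c ∧
      d = (b.comp s).comp c) ∧
  ∀ (i j : ℕ) (w : List A), d.Path i w j → w.length ≤ 1

/-- No path from a left port to a right port is labelled by the empty word. -/
def IsEpsilonFree {m n : ℕ} (d : Syn A (rs m) (rs n)) : Prop :=
  ∀ i j : ℕ, ¬ d.Path i [] j

/-- A matrix-diagram that contains no letter. -/
def IsRelationDiagram {m n : ℕ} (d : Syn A (rs m) (rs n)) : Prop :=
  IsMatrixDiagram d ∧ IsBlock Gen.IsRel d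

/-! ### Feedback and representations -/

namespace Diag

/-- `copy` on `n` parallel wires: the `i`-th input is connected to the `i`-th and the `(n + i)`-th
outputs. -/
def copyN : (n : ℕ) → Diag A (rs n) (rs n ++ rs n)
  | 0 => id []
  | n + 1 => (of .copy ⊹ copyN n) ⨟
      cast (by simp) (by simp [List.replicate_succ])
        (wire ⊹ swap [.right] (rs n) ⊹ id (rs n))

/-- `merge` on `n` parallel wires: the `i`-th and the `(n + i)`-th inputs are connected to the
`i`-th output. -/
def mergeN : (n : ℕ) → Diag A (rs n ++ rs n) (rs n)
  | 0 => id []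
  | n + 1 => cast (by simp [List.replicate_succ]) (by simp)
        (wire ⊹ swap (rs n) [.right] ⊹ id (rs n)) ⨟ (of .merge ⊹ mergeN n)

/-- `n` parallel cups: the `i`-th wire `◀` is connected to the `i`-th wire `▶`. -/
def cupN : (n : ℕ) → Diag A [] (ls n ++ rs n)
  | 0 => id []
  | n + 1 => (of .cup ⊹ cupN n) ⨟
      cast (by simp) (by simp [List.replicate_succ])
        (wireL ⊹ swap [.right] (ls n) ⊹ id (rs n))

/-- `n` parallel caps: the `i`-th wire `◀` is connected to the `i`-th wire `▶`. -/
def capN : (n : ℕ) → Diag A (ls n ++ rs n) []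
  | 0 => id []
  | n + 1 => cast (by simp [List.replicate_succ]) (by simp)
        (wireL ⊹ swap (ls n) [.right] ⊹ id (rs n)) ⨟ (of .cap ⊹ capN n)

end Diag

/-- The feedback loop `d*` on `d : ▶ˡ → ▶ˡ`: the `l` inputs are merged with the `l` looping wires,
the result is copied, the first copy passes through `d` and is fed back, the second is the output. -/
def Syn.star {l : ℕ} (d : Syn A (rs l) (rs l)) : Syn A (rs l) (rs l) :=
  ((Syn.cast (List.nil_append _) (List.append_assoc _ _ _)
      ((Syn.mk (Diag.cupN l)).tensor (Syn.id (rs l)))).comp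
    ((Syn.id (ls l)).tensor
      (((Syn.mk (Diag.mergeN l)).comp (Syn.mk (Diag.copyN l))).comp
        (d.tensor (Syn.id (rs l)))))).comp
    (Syn.cast (List.append_assoc _ _ _) (List.nil_append _)
      ((Syn.mk (Diag.capN l)).tensor (Syn.id (rs l))))

/-- `(e, d, f)` is a representation of `c : ▶ → ▶` with `l` states. -/
structure IsRepresentation (c : Syn A (rs 1) (rs 1)) {l : ℕ} (e : Syn A (rs 1) (rs l))
    (d : Syn A (rs l) (rs l)) (f : Syn A (rs l) (rs 1)) : Prop where
  isRelationDiagram_initial : IsRelationDiagram e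
  isMatrixDiagram : IsMatrixDiagram d
  isEpsilonFree : IsEpsilonFree d
  isRelationDiagram_final : IsRelationDiagram f
  eq : KDAEq c ((e.comp d.star).comp f)

end

end KleeneDiagram

namespace KleeneDiagram

open CategoryTheory MonoidalCategory

/-! ### The ordered symmetric monoidal category of diagrams modulo the equational theory -/

/-! Diagrams modulo `KDAEq` form an ordered symmetric monoidal category, here with objects `Word A`,
and the whole argument is carried out there.

Black-node diagrams between words of `▶` (`IsBool`) commute with copying, discarding, merging and
generating. They therefore behave like Boolean matrices: such a morphism is recovered from its
blocks (`IsHom.eq_cop`, `IsHom.eq_mer`), with sum `cop₁ ≫ (- ⊗ -) ≫ mer₁` and zero `del₁ ≫ gen₁`.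
The key fact is that a feedback loop around a relation is again a relation (`IsBool.tr`). For blocks
`x : R ⟶ R`, `z : R ⟶ N`, `u : M ⟶ R`, `v : M ⟶ N` the loop should be `v + u x* z`, and `x* = 1` for
every relation `x`. This last equation (`tr_twist`) is a squeeze. Relations have a greatest element,
zero, and a least one, the matrix of ones, by the axioms `1 ≤ δ;η` and `∇;Δ ≤ 1⊕1`. Looping the zero
is yanking, and looping the one is the axiom on `mer₁ ≫ cop₁`, so the two bounds on `x*` coincide.

Next, every letter can be moved onto a feedback wire by yanking, and nested loops commute. Hence the
diagrams `Rep`, obtained from relations by loops through letters, are closed under relations,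
letters and plain loops. Cups and caps are treated by the normal forms `NF`, which also allow bent
wires and permutations: a cup creates a bent wire, a cap either closes one into a loop or is
postponed. When all ports are `▶` no bent wire is left, so an automaton-diagram between such ports
is a `Rep` (`IsAutomatonDiagram.rep`).

Collecting the loops gives a single feedback of `b` followed by parallel letters, with `b` a
relation (`Rep.exists_trs`). One more state, which holds the input, turns this into `e ; d* ; f`
(`tr_trs_eq`). Finally the relations, and the relation followed by letters that makes up `d`, are
rewritten as matrix-diagrams: a row of zeros and ones is copied, each entry is multiplied by its
letter, and the rows are merged (`IsDiagonal.bool_comp`). This uses only that letters commute with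
`mer₁` and `gen₁`. -/

/-- The objects of the category of diagrams: words over the generating objects. -/
structure Word (A : Type u) : Type where
  /-- The object denoted by a word. -/
  ofList ::
  /-- The underlying word. -/
  toList : List Dir

/-- Equality in Kleene Diagram Algebra, as a setoid. -/
def kdaSetoid (A : Type u) (X Y : List Dir) : Setoid (Syn A X Y) where
  r := KDAEq
  iseqv :=
    ⟨fun f => ⟨.refl f, .refl f⟩, fun h => ⟨h.2, h.1⟩,
      fun h h' => ⟨.trans h.1 h'.1, .trans h'.2 h.2⟩⟩

variable {A : Type u}

/-- Morphisms: diagrams modulo equality in Kleene Diagram Algebra. -/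
def WordHom (X Y : Word A) : Type u := Quotient (kdaSetoid A X.toList Y.toList)

instance : CategoryStruct (Word A) where
  Hom := WordHom
  id X := Quotient.mk (kdaSetoid A X.toList X.toList) (Syn.id X.toList)
  comp := Quotient.map₂ Syn.comp fun _ _ h _ _ h' => ⟨.comp h.1 h'.1, .comp h.2 h'.2⟩

/-- The morphism denoted by a diagram. -/
def den {X Y : List Dir} (f : Syn A X Y) : (⟨X⟩ : Word A) ⟶ ⟨Y⟩ :=
  Quotient.mk (kdaSetoid A X Y) f

theorem den_surjective {X Y : Word A} (f : X ⟶ Y) :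
    ∃ t : Diag A X.toList Y.toList, den (Syn.mk t) = f := by
  induction f using Quotient.ind with
  | _ s =>
    induction s using Quotient.ind with
    | _ t => exact ⟨t, rfl⟩

theorem den_eq {X Y : List Dir} {f g : Syn A X Y} : den f = den g ↔ KDAEq f g :=
  ⟨fun h => Quotient.exact h, fun h => Quotient.sound h⟩

theorem den_sound {X Y : List Dir} {f g : Diag A X Y} (h : Diag.SMCEq f g) :
    den (Syn.mk f) = den (Syn.mk g) :=
  congrArg den (Quotient.sound h)

theorem den_comp {X Y Z : List Dir} (f : Syn A X Y) (g : Syn A Y Z) :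
    den (f.comp g) = den f ≫ den g := rfl

instance : Category (Word A) where
  id_comp f := by
    obtain ⟨f, rfl⟩ := den_surjective f
    exact den_sound (.id_comp f)
  comp_id f := by
    obtain ⟨f, rfl⟩ := den_surjective f
    exact den_sound (.comp_id f)
  assoc f g h := by
    obtain ⟨f, rfl⟩ := den_surjective f
    obtain ⟨g, rfl⟩ := den_surjective g
    obtain ⟨h, rfl⟩ := den_surjective h
    exact den_sound (.comp_assoc f g h)

theorem den_cast {X X' Y Y' : List Dir} (hX : X = X') (hY : Y = Y') (f : Syn A X Y) :
    den (Syn.cast hX hY f) =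
      eqToHom (congrArg Word.ofList hX.symm) ≫ den f ≫ eqToHom (congrArg Word.ofList hY) := by
  subst hX hY
  exact ((Category.id_comp _).trans (Category.comp_id _)).symm

theorem mk_cast {X X' Y Y' : List Dir} (hX : X = X') (hY : Y = Y') (f : Diag A X Y) :
    Syn.mk (Diag.cast hX hY f) = Syn.cast hX hY (Syn.mk f) := by
  subst hX hY
  rfl

/-- On the quotient the preorder becomes antisymmetric, so a squeeze between two inequalities yields
an equality of morphisms. -/
instance (X Y : Word A) : PartialOrder (X ⟶ Y) where
  le := Quotient.lift₂ KDALe fun _ _ _ _ h h' =>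
    propext ⟨fun k => .trans (.trans h.2 k) h'.1, fun k => .trans (.trans h.1 k) h'.2⟩
  le_refl f := by
    obtain ⟨f, rfl⟩ := den_surjective f
    exact KDALe.refl (Syn.mk f)
  le_trans f g h := by
    obtain ⟨f, rfl⟩ := den_surjective f
    obtain ⟨g, rfl⟩ := den_surjective g
    obtain ⟨h, rfl⟩ := den_surjective h
    exact KDALe.trans
  le_antisymm f g := by
    obtain ⟨f, rfl⟩ := den_surjective f
    obtain ⟨g, rfl⟩ := den_surjective g
    exact fun h h' => Quotient.sound ⟨h, h'⟩

theorem den_le {X Y : List Dir} {f g : Syn A X Y} : den f ≤ den g ↔ KDALe f g := Iff.rfl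

/-- The monoidal product of two morphisms. -/
def tensorWord {X₁ Y₁ X₂ Y₂ : Word A} (f : X₁ ⟶ Y₁) (g : X₂ ⟶ Y₂) :
    (⟨X₁.toList ++ X₂.toList⟩ : Word A) ⟶ ⟨Y₁.toList ++ Y₂.toList⟩ :=
  Quotient.map₂ (sa := kdaSetoid A _ _) (sb := kdaSetoid A _ _) (sc := kdaSetoid A _ _)
    Syn.tensor (fun _ _ h _ _ h' => ⟨.tensor h.1 h'.1, .tensor h.2 h'.2⟩) f g

/-- The structure is strict, but concatenation of lists is associative only up to a propositional
equality, so the coherence isomorphisms are transports. When both sides agree by computation they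
reduce to identities, which explains the many later steps by `Category.id_comp` and
`Category.comp_id` on morphisms that do not look like identities. -/
instance : MonoidalCategoryStruct (Word A) where
  tensorObj X Y := ⟨X.toList ++ Y.toList⟩
  tensorUnit := ⟨[]⟩
  tensorHom := tensorWord
  whiskerLeft X _ _ f := tensorWord (𝟙 X) f
  whiskerRight f Y := tensorWord f (𝟙 Y)
  associator _ _ _ := eqToIso (congrArg Word.ofList (List.append_assoc _ _ _))
  leftUnitor _ := eqToIso (congrArg Word.ofList (List.nil_append _))
  rightUnitor _ := eqToIso (congrArg Word.ofList (List.append_nil _))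

theorem den_tensor {X₁ Y₁ X₂ Y₂ : List Dir} (f : Syn A X₁ Y₁) (g : Syn A X₂ Y₂) :
    den (f.tensor g) = den f ⊗ₘ den g := rfl

theorem tensor_id_id (X Y : Word A) : 𝟙 X ⊗ₘ 𝟙 Y = 𝟙 (X ⊗ Y) :=
  den_sound (.tensor_id X.toList Y.toList)

theorem eqToHom_tensor_eqToHom {X X' Y Y' : Word A} (hX : X = X') (hY : Y = Y') :
    eqToHom hX ⊗ₘ eqToHom hY = eqToHom (congrArg₂ tensorObj hX hY) := by
  subst hX hY
  exact tensor_id_id X Y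

instance : MonoidalCategory (Word A) :=
  .ofTensorHom (id_tensorHom_id := tensor_id_id)
    (id_tensorHom := fun _ _ _ _ => rfl)
    (tensorHom_id := fun _ _ => rfl)
    (tensorHom_comp_tensorHom := fun f₁ f₂ g₁ g₂ => by
      obtain ⟨f₁, rfl⟩ := den_surjective f₁
      obtain ⟨f₂, rfl⟩ := den_surjective f₂
      obtain ⟨g₁, rfl⟩ := den_surjective g₁
      obtain ⟨g₂, rfl⟩ := den_surjective g₂
      exact den_sound (.interchange f₁ g₁ f₂ g₂))
    (associator_naturality := fun f g h => by
      obtain ⟨f, rfl⟩ := den_surjective f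
      obtain ⟨g, rfl⟩ := den_surjective g
      obtain ⟨h, rfl⟩ := den_surjective h
      have := den_sound (.tensor_assoc f g h)
      rw [mk_cast, den_cast] at this
      rw [← cancel_epi (eqToHom (congrArg Word.ofList (List.append_assoc _ _ _).symm))]
      refine this.trans ?_
      simp only [MonoidalCategoryStruct.associator, eqToIso.hom]
      rw [eqToHom_trans_assoc, eqToHom_refl, Category.id_comp]
      rfl)
    (leftUnitor_naturality := fun f => by
      obtain ⟨f, rfl⟩ := den_surjective f
      have := den_sound (.nil_tensor f)
      rw [mk_cast, den_cast] at this
      rw [← cancel_epi (eqToHom (congrArg Word.ofList (List.nil_append _).symm))]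
      refine this.trans ?_
      simp only [MonoidalCategoryStruct.leftUnitor, eqToIso.hom]
      rw [eqToHom_trans_assoc, eqToHom_refl, Category.id_comp])
    (rightUnitor_naturality := fun f => by
      obtain ⟨f, rfl⟩ := den_surjective f
      have := den_sound (.tensor_nil f)
      rw [mk_cast, den_cast] at this
      rw [← cancel_epi (eqToHom (congrArg Word.ofList (List.append_nil _).symm))]
      refine this.trans ?_
      simp only [MonoidalCategoryStruct.rightUnitor, eqToIso.hom]
      rw [eqToHom_trans_assoc, eqToHom_refl, Category.id_comp])
    (pentagon := fun W X Y Z => by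
      simp only [MonoidalCategoryStruct.associator, eqToIso.hom]
      rw [← eqToHom_refl Z rfl, ← eqToHom_refl W rfl, eqToHom_tensor_eqToHom,
        eqToHom_tensor_eqToHom]
      exact (congrArg _ (eqToHom_trans _ _)).trans ((eqToHom_trans _ _).trans
        (eqToHom_trans _ _).symm))
    (triangle := fun X Y => by
      simp only [MonoidalCategoryStruct.associator, MonoidalCategoryStruct.leftUnitor,
        MonoidalCategoryStruct.rightUnitor, eqToIso.hom]
      rw [← eqToHom_refl Y rfl, ← eqToHom_refl X rfl, eqToHom_tensor_eqToHom,
        eqToHom_tensor_eqToHom]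
      exact eqToHom_trans _ _)

theorem associator_eq (X Y Z : Word A) :
    (α_ X Y Z).hom = eqToHom (congrArg Word.ofList (List.append_assoc _ _ _)) := rfl

theorem associator_inv_eq (X Y Z : Word A) :
    (α_ X Y Z).inv = eqToHom (congrArg Word.ofList (List.append_assoc _ _ _).symm) := rfl

/-- The crossing of two words, as an isomorphism. -/
def braidWord (X Y : Word A) : X ⊗ Y ≅ Y ⊗ X where
  hom := den (Syn.mk (Diag.swap X.toList Y.toList))
  inv := den (Syn.mk (Diag.swap Y.toList X.toList))
  hom_inv_id := den_sound (.swap_swap X.toList Y.toList)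
  inv_hom_id := den_sound (.swap_swap Y.toList X.toList)

theorem braidWord_natural {X X' Y Y' : Word A} (f : X ⟶ X') (g : Y ⟶ Y') :
    (f ⊗ₘ g) ≫ (braidWord X' Y').hom = (braidWord X Y).hom ≫ (g ⊗ₘ f) := by
  obtain ⟨f, rfl⟩ := den_surjective f
  obtain ⟨g, rfl⟩ := den_surjective g
  exact den_sound (.swap_natural f g)

theorem braidWord_hexagon (X Y Z : Word A) :
    (α_ X Y Z).hom ≫ (braidWord X (Y ⊗ Z)).hom ≫ (α_ Y Z X).hom =
      (braidWord X Y).hom ▷ Z ≫ (α_ Y X Z).hom ≫ Y ◁ (braidWord X Z).hom := by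
  obtain ⟨X⟩ := X
  obtain ⟨Y⟩ := Y
  obtain ⟨Z⟩ := Z
  have h := den_sound (A := A) (.hexagon X Y Z)
  have e : den (Syn.mk (Diag.cast (List.append_assoc X Y Z) (List.append_assoc Y X Z)
        (Diag.swap X Y ⊹ Diag.id Z) ⨟
          Diag.cast rfl (List.append_assoc Y Z X).symm (Diag.id Y ⊹ Diag.swap X Z))) =
      den (Syn.mk (Diag.cast (List.append_assoc X Y Z) (List.append_assoc Y X Z)
        (Diag.swap X Y ⊹ Diag.id Z) : Diag A _ _)) ≫
      den (Syn.mk (Diag.cast rfl (List.append_assoc Y Z X).symm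
        (Diag.id Y ⊹ Diag.swap X Z) : Diag A _ _)) := rfl
  rw [e, mk_cast, mk_cast, den_cast, den_cast] at h
  have h' : (braidWord ⟨X⟩ (⟨Y⟩ ⊗ ⟨Z⟩)).hom = (α_ (⟨X⟩ : Word A) ⟨Y⟩ ⟨Z⟩).inv ≫
      ((braidWord (⟨X⟩ : Word A) ⟨Y⟩).hom ▷ ⟨Z⟩ ≫ (α_ (⟨Y⟩ : Word A) ⟨X⟩ ⟨Z⟩).hom ≫ (⟨Y⟩ : Word A) ◁ (braidWord ⟨X⟩ ⟨Z⟩).hom) ≫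
        (α_ (⟨Y⟩ : Word A) ⟨Z⟩ ⟨X⟩).inv := by
    refine h.trans ?_
    rw [eqToHom_refl, Category.id_comp, Category.assoc, Category.assoc, Category.assoc,
      Category.assoc]
    rfl
  rw [h']
  simp only [Category.assoc, Iso.inv_hom_id, Category.comp_id, Iso.hom_inv_id_assoc]

instance : SymmetricCategory (Word A) where
  braiding := braidWord
  braiding_naturality_right X _ _ f := by
    rw [← id_tensorHom, ← tensorHom_id]
    exact braidWord_natural _ _
  braiding_naturality_left f Z := by
    rw [← id_tensorHom, ← tensorHom_id]
    exact braidWord_natural _ _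
  hexagon_forward := braidWord_hexagon
  hexagon_reverse X Y Z := by
    -- A crossing is inverse to the opposite crossing, so the reverse hexagon is the inverse of the
    -- forward one at `Z`, `X`, `Y`.
    have h := congrArg Iso.inv (Iso.ext (α := α_ Z X Y ≪≫ braidWord Z (X ⊗ Y) ≪≫ α_ X Y Z)
      (β := whiskerRightIso (braidWord Z X) Y ≪≫ α_ X Z Y ≪≫ whiskerLeftIso X (braidWord Z Y))
      (braidWord_hexagon Z X Y))
    simp only [Iso.trans_inv, Category.assoc, whiskerRightIso_inv, whiskerLeftIso_inv] at h
    exact h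
  symmetry X Y := (braidWord X Y).hom_inv_id

theorem comp_mono {X Y Z : Word A} {f f' : X ⟶ Y} {g g' : Y ⟶ Z} (hf : f ≤ f') (hg : g ≤ g') :
    f ≫ g ≤ f' ≫ g' := by
  obtain ⟨f, rfl⟩ := den_surjective f
  obtain ⟨f', rfl⟩ := den_surjective f'
  obtain ⟨g, rfl⟩ := den_surjective g
  obtain ⟨g', rfl⟩ := den_surjective g'
  exact KDALe.comp hf hg

theorem tensor_mono {X Y X' Y' : Word A} {f f' : X ⟶ Y} {g g' : X' ⟶ Y'} (hf : f ≤ f')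
    (hg : g ≤ g') : f ⊗ₘ g ≤ f' ⊗ₘ g' := by
  obtain ⟨f, rfl⟩ := den_surjective f
  obtain ⟨f', rfl⟩ := den_surjective f'
  obtain ⟨g, rfl⟩ := den_surjective g
  obtain ⟨g', rfl⟩ := den_surjective g'
  exact KDALe.tensor hf hg

theorem whiskerLeft_mono (X : Word A) {Y Y' : Word A} {f f' : Y ⟶ Y'} (hf : f ≤ f') :
    X ◁ f ≤ X ◁ f' :=
  tensor_mono le_rfl hf

end KleeneDiagram

namespace KleeneDiagram

open CategoryTheory MonoidalCategory

/-! ### Bending wires and tracing in a symmetric monoidal category -/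

section Trace

variable {C : Type*} [Category* C] [MonoidalCategory C] [SymmetricCategory C]

/-- Exchange of the first two factors of a product of three objects. -/
def sw (X Y Z : C) : X ⊗ Y ⊗ Z ⟶ Y ⊗ X ⊗ Z :=
  (α_ X Y Z).inv ≫ (β_ X Y).hom ▷ Z ≫ (α_ Y X Z).hom

theorem sw_sw (X Y Z : C) : sw X Y Z ≫ sw Y X Z = 𝟙 _ := by
  simp only [sw, Category.assoc, Iso.hom_inv_id_assoc]
  rw [← comp_whiskerRight_assoc, SymmetricCategory.symmetry]
  simp

theorem sw_sw_assoc (X Y Z : C) {W : C} (h : X ⊗ Y ⊗ Z ⟶ W) : sw X Y Z ≫ sw Y X Z ≫ h = h := by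
  rw [← Category.assoc, sw_sw, Category.id_comp]

theorem whiskerLeft_sw_sw (W X Y Z : C) : W ◁ sw X Y Z ≫ W ◁ sw Y X Z = 𝟙 _ := by
  rw [← MonoidalCategory.whiskerLeft_comp, sw_sw, MonoidalCategory.whiskerLeft_id]

theorem sw_natural_left {X X' : C} (f : X ⟶ X') (Y Z : C) :
    f ▷ (Y ⊗ Z) ≫ sw X' Y Z = sw X Y Z ≫ Y ◁ f ▷ Z := by
  simp only [sw, Category.assoc, associator_inv_naturality_left_assoc]
  rw [← comp_whiskerRight_assoc, BraidedCategory.braiding_naturality_left]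
  simp

theorem sw_natural_mid (X : C) {Y Y' : C} (f : Y ⟶ Y') (Z : C) :
    X ◁ f ▷ Z ≫ sw X Y' Z = sw X Y Z ≫ f ▷ (X ⊗ Z) := by
  rw [sw, associator_inv_naturality_middle_assoc, sw, Category.assoc, Category.assoc]
  rw [← comp_whiskerRight_assoc, BraidedCategory.braiding_naturality_right,
    comp_whiskerRight_assoc, associator_naturality_left]

theorem sw_natural_right (X Y : C) {Z Z' : C} (f : Z ⟶ Z') :
    X ◁ Y ◁ f ≫ sw X Y Z' = sw X Y Z ≫ Y ◁ X ◁ f := by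
  simp only [sw, Category.assoc, associator_inv_naturality_right_assoc,
    associator_naturality_right, whisker_exchange_assoc]

theorem sw_natural_right_assoc (X Y : C) {Z Z' : C} (f : Z ⟶ Z') {W : C} (h : Y ⊗ X ⊗ Z' ⟶ W) :
    X ◁ Y ◁ f ≫ sw X Y Z' ≫ h = sw X Y Z ≫ Y ◁ X ◁ f ≫ h := by
  rw [← Category.assoc, sw_natural_right, Category.assoc]

theorem sw_tensor_left (L R X Y : C) :
    sw (L ⊗ R) X Y = (α_ L R (X ⊗ Y)).hom ≫ L ◁ sw R X Y ≫ sw L X (R ⊗ Y) ≫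
      X ◁ (α_ L R Y).inv := by
  simp only [sw, BraidedCategory.braiding_tensor_left_hom]
  monoidal

theorem sw_tensor_mid (X L R Y : C) :
    sw X (L ⊗ R) Y = X ◁ (α_ L R Y).hom ≫ sw X L (R ⊗ Y) ≫ L ◁ sw X R Y ≫
      (α_ L R (X ⊗ Y)).inv := by
  simp only [sw, BraidedCategory.braiding_tensor_right_hom]
  monoidal

theorem sw_tensor_right (X Y Z W : C) :
    sw X Y (Z ⊗ W) = X ◁ (α_ Y Z W).inv ≫ (α_ X (Y ⊗ Z) W).inv ≫ sw X Y Z ▷ W ≫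
      (α_ Y (X ⊗ Z) W).hom ≫ Y ◁ (α_ X Z W).hom := by
  simp only [sw]
  monoidal

theorem sw_unit_left (X Y : C) : sw (𝟙_ C) X Y = (λ_ (X ⊗ Y)).hom ≫ X ◁ (λ_ Y).inv := by
  simp [sw]

theorem sw_unit_mid (X Y : C) : sw X (𝟙_ C) Y = X ◁ (λ_ Y).hom ≫ (λ_ (X ⊗ Y)).inv := by
  simp [sw]

set_option linter.unusedSectionVars false

variable {L R : C}

/-- Insertion of a cup above an object. -/
def cupR (cup : 𝟙_ C ⟶ L ⊗ R) (M : C) : M ⟶ L ⊗ R ⊗ M :=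
  (λ_ M).inv ≫ cup ▷ M ≫ (α_ L R M).hom

/-- Insertion of a cap above an object. -/
def capR (cap : L ⊗ R ⟶ 𝟙_ C) (M : C) : L ⊗ R ⊗ M ⟶ M :=
  (α_ L R M).inv ≫ cap ▷ M ≫ (λ_ M).hom

/-- Bending of the first input wire. -/
def bend (cup : 𝟙_ C ⟶ L ⊗ R) {M X : C} (h : R ⊗ M ⟶ X) : M ⟶ L ⊗ X :=
  cupR cup M ≫ L ◁ h

/-- Feedback of the first output wire to the first input wire. -/
def tr (cup : 𝟙_ C ⟶ L ⊗ R) (cap : L ⊗ R ⟶ 𝟙_ C) {M N : C} (f : R ⊗ M ⟶ R ⊗ N) : M ⟶ N :=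
  cupR cup M ≫ L ◁ f ≫ capR cap N

variable (cup : 𝟙_ C ⟶ L ⊗ R) (cap : L ⊗ R ⟶ 𝟙_ C)

theorem cupR_natural {M N : C} (f : M ⟶ N) : f ≫ cupR cup N = cupR cup M ≫ L ◁ R ◁ f := by
  simp only [cupR, Category.assoc, leftUnitor_inv_naturality_assoc, whisker_exchange_assoc]
  simp

theorem cupR_natural_assoc {M N : C} (f : M ⟶ N) {W : C} (h : L ⊗ R ⊗ N ⟶ W) :
    f ≫ cupR cup N ≫ h = cupR cup M ≫ L ◁ R ◁ f ≫ h := by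
  rw [← Category.assoc, cupR_natural, Category.assoc]

theorem capR_natural {M N : C} (f : M ⟶ N) : capR cap M ≫ f = L ◁ R ◁ f ≫ capR cap N := by
  simp only [capR, Category.assoc, ← leftUnitor_naturality, ← whisker_exchange_assoc]
  simp

/-- A cup starts at the unit object, so naturality of the crossing slides it past `X`. No zigzag
equation is involved. -/
theorem whiskerLeft_cupR (X Y : C) :
    X ◁ cupR cup Y = cupR cup (X ⊗ Y) ≫ L ◁ sw R X Y ≫ sw L X (R ⊗ Y) := by
  have h : L ◁ sw R X Y ≫ sw L X (R ⊗ Y) =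
      (α_ L R (X ⊗ Y)).inv ≫ sw (L ⊗ R) X Y ≫ X ◁ (α_ L R Y).hom := by
    simp [sw_tensor_left]
  rw [h, cupR, cupR]
  simp only [Category.assoc, Iso.hom_inv_id_assoc]
  rw [← Category.assoc (cup ▷ _), sw_natural_left, sw_unit_left]
  simp

theorem whiskerLeft_capR (X Y : C) :
    X ◁ capR cap Y = sw X L (R ⊗ Y) ≫ L ◁ sw X R Y ≫ capR cap (X ⊗ Y) := by
  have h : sw X L (R ⊗ Y) ≫ L ◁ sw X R Y =
      X ◁ (α_ L R Y).inv ≫ sw X (L ⊗ R) Y ≫ (α_ L R (X ⊗ Y)).hom := by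
    simp [sw_tensor_mid]
  rw [← Category.assoc, h, capR, capR]
  simp only [Category.assoc, Iso.hom_inv_id_assoc]
  rw [← Category.assoc (sw X (L ⊗ R) Y), ← sw_natural_mid, Category.assoc, sw_unit_mid]
  simp

theorem whiskerLeft_cupR_sw (X Y : C) :
    X ◁ cupR cup Y ≫ sw X L (R ⊗ Y) = cupR cup (X ⊗ Y) ≫ L ◁ sw R X Y := by
  simp only [whiskerLeft_cupR, Category.assoc, sw_sw, Category.comp_id]

theorem sw_whiskerLeft_capR (X Y : C) :
    sw L X (R ⊗ Y) ≫ X ◁ capR cap Y = L ◁ sw X R Y ≫ capR cap (X ⊗ Y) := by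
  simp only [whiskerLeft_capR, sw_sw_assoc]

theorem cupR_tensor (M N : C) :
    cupR cup (M ⊗ N) = cupR cup M ▷ N ≫ (α_ L (R ⊗ M) N).hom ≫ L ◁ (α_ R M N).hom := by
  simp only [cupR]
  monoidal

theorem capR_tensor (M N : C) :
    capR cap (M ⊗ N) = L ◁ (α_ R M N).inv ≫ (α_ L (R ⊗ M) N).inv ≫ capR cap M ▷ N := by
  simp only [capR]
  monoidal

theorem comp_bend {M' M X : C} (g : M' ⟶ M) (h : R ⊗ M ⟶ X) :
    g ≫ bend cup h = bend cup (R ◁ g ≫ h) := by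
  simp [bend, cupR_natural_assoc]

theorem bend_comp {M X X' : C} (h : R ⊗ M ⟶ X) (g : X ⟶ X') :
    bend cup h ≫ L ◁ g = bend cup (h ≫ g) := by
  simp [bend]

theorem tr_eq_bend {M N : C} (f : R ⊗ M ⟶ R ⊗ N) : tr cup cap f = bend cup f ≫ capR cap N := by
  simp [tr, bend]

theorem comp_tr {M' M N : C} (g : M' ⟶ M) (f : R ⊗ M ⟶ R ⊗ N) :
    g ≫ tr cup cap f = tr cup cap (R ◁ g ≫ f) := by
  simp [tr, cupR_natural_assoc]

theorem tr_comp {M N N' : C} (f : R ⊗ M ⟶ R ⊗ N) (g : N ⟶ N') :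
    tr cup cap f ≫ g = tr cup cap (f ≫ R ◁ g) := by
  simp [tr, capR_natural]

theorem whiskerLeft_bend (X : C) {M Y : C} (h : R ⊗ M ⟶ Y) :
    X ◁ bend cup h = bend cup (sw R X M ≫ X ◁ h) ≫ sw L X Y := by
  simp only [bend, MonoidalCategory.whiskerLeft_comp, whiskerLeft_cupR, Category.assoc,
    sw_natural_right]

theorem whiskerLeft_tr (X : C) {M N : C} (f : R ⊗ M ⟶ R ⊗ N) :
    X ◁ tr cup cap f = tr cup cap (sw R X M ≫ X ◁ f ≫ sw X R N) := by
  simp only [tr, MonoidalCategory.whiskerLeft_comp, whiskerLeft_cupR, whiskerLeft_capR,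
    Category.assoc, ← sw_natural_right_assoc, sw_sw_assoc]

theorem tr_whiskerRight {M N : C} (f : R ⊗ M ⟶ R ⊗ N) (X : C) :
    tr cup cap f ▷ X = tr cup cap ((α_ R M X).inv ≫ f ▷ X ≫ (α_ R N X).hom) := by
  simp only [tr, cupR_tensor, capR_tensor]
  monoidal

/-- Two nested cups may be created in either order. Exchanging them crosses both the pair of `L`
wires and the pair of `R` wires, so one crossing can be traded for the other. -/
theorem cupR_cupR (M : C) :
    cupR cup M ≫ L ◁ cupR cup (R ⊗ M) ≫ sw L L (R ⊗ R ⊗ M) =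
      cupR cup M ≫ L ◁ cupR cup (R ⊗ M) ≫ L ◁ L ◁ sw R R M := by
  have h : cupR cup M ≫ L ◁ cupR cup (R ⊗ M) = cupR cup M ≫ L ◁ (cupR cup (R ⊗ M) ≫
      L ◁ sw R R M ≫ sw L R (R ⊗ M)) ≫ L ◁ sw R L (R ⊗ M) ≫ sw L L (R ⊗ R ⊗ M) := by
    rw [← whiskerLeft_cupR, ← cupR_natural_assoc, ← whiskerLeft_cupR]
  conv_rhs => rw [← Category.assoc, h]
  simp only [MonoidalCategory.whiskerLeft_comp, Category.assoc]
  rw [← MonoidalCategory.whiskerLeft_comp_assoc L (sw L R _), sw_sw,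
    MonoidalCategory.whiskerLeft_id, Category.id_comp, sw_natural_right_assoc,
    ← MonoidalCategory.whiskerLeft_comp L, ← MonoidalCategory.whiskerLeft_comp L, sw_sw]
  simp

theorem capR_capR (M : C) :
    sw L L (R ⊗ R ⊗ M) ≫ L ◁ capR cap (R ⊗ M) ≫ capR cap M =
      L ◁ L ◁ sw R R M ≫ L ◁ capR cap (R ⊗ M) ≫ capR cap M := by
  have h : L ◁ capR cap (R ⊗ M) ≫ capR cap M = sw L L (R ⊗ R ⊗ M) ≫ L ◁ sw L R (R ⊗ M) ≫
      L ◁ (sw R L (R ⊗ M) ≫ L ◁ sw R R M ≫ capR cap (R ⊗ M)) ≫ capR cap M := by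
    rw [← whiskerLeft_capR, ← capR_natural, whiskerLeft_capR, Category.assoc, Category.assoc]
  conv_lhs => rw [h]
  simp only [MonoidalCategory.whiskerLeft_comp, Category.assoc, sw_sw_assoc]
  rw [← MonoidalCategory.whiskerLeft_comp_assoc L (sw L R _), sw_sw,
    MonoidalCategory.whiskerLeft_id, Category.id_comp]

/-- A loop passes inside a bend: the two cups are exchanged by `cupR_cupR`, and the cap slides past
the bent wire. -/
theorem tr_bend {M X : C} (j : R ⊗ R ⊗ M ⟶ R ⊗ X) :
    tr cup cap (bend cup j ≫ sw L R X) = bend cup (tr cup cap (sw R R M ≫ j)) := by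
  simp only [tr, bend, MonoidalCategory.whiskerLeft_comp, Category.assoc, whiskerLeft_capR]
  rw [sw_natural_right_assoc, sw_natural_right_assoc, reassoc_of% cupR_cupR cup M]
  rw [← MonoidalCategory.whiskerLeft_comp_assoc L (L ◁ sw R R M), whiskerLeft_sw_sw]
  simp

/-- Nested loops commute. Exchanging cups and exchanging caps each produce one crossing, on the
inputs and on the outputs of `f`. -/
theorem tr_tr {M N : C} (f : R ⊗ R ⊗ M ⟶ R ⊗ R ⊗ N) :
    tr cup cap (tr cup cap f) = tr cup cap (tr cup cap (sw R R M ≫ f ≫ sw R R N)) := by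
  simp only [tr, MonoidalCategory.whiskerLeft_comp, Category.assoc]
  rw [← capR_capR, sw_natural_right_assoc, sw_natural_right_assoc, reassoc_of% cupR_cupR cup M,
    ← MonoidalCategory.whiskerLeft_comp_assoc L (L ◁ sw R R M), whiskerLeft_sw_sw]
  simp

/-- The zigzag equation for a cup and a cap. -/
def Zigzag : Prop :=
  (ρ_ R).inv ≫ R ◁ cup ≫ (α_ R L R).inv ≫ ((β_ R L).hom ≫ cap) ▷ R ≫ (λ_ R).hom = 𝟙 R

variable {cup cap}

/-- Yanking: the zigzag equation in the language of traces. It is what allows a letter to be moved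
onto a loop. -/
theorem Zigzag.tr_braiding (h : Zigzag cup cap) : tr cup cap (β_ R R).hom = 𝟙 R := by
  have e : cupR cup R ≫ L ◁ (β_ R R).hom = (ρ_ R).inv ≫ R ◁ cup ≫ sw R L R := by
    have h' := (ρ_ R).inv ≫= whiskerLeft_cupR_sw cup R (𝟙_ C) =≫ L ◁ R ◁ (ρ_ R).hom
    rw [Category.assoc, Category.assoc, ← sw_natural_right, cupR_natural_assoc] at h'
    have h₁ : cupR cup (𝟙_ C) ≫ L ◁ (ρ_ R).hom = cup := by
      simp only [cupR]
      monoidal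
    have h₂ : L ◁ R ◁ (ρ_ R).inv ≫ L ◁ sw R R (𝟙_ C) ≫ L ◁ R ◁ (ρ_ R).hom =
        L ◁ (β_ R R).hom := by
      simp only [sw]
      monoidal
    rw [h₂, ← MonoidalCategory.whiskerLeft_comp_assoc, h₁] at h'
    exact h'.symm
  rw [tr, reassoc_of% e, ← h]
  simp [sw, capR]

theorem Zigzag.cup_comp (h : Zigzag cup cap) (g : 𝟙_ C ⟶ R) :
    cup ≫ ((ρ_ L).inv ≫ L ◁ g ≫ cap) ▷ R ≫ (λ_ R).hom = g := by
  conv_rhs => rw [← Category.comp_id g, ← h]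
  rw [rightUnitor_inv_naturality_assoc, ← whisker_exchange_assoc,
    associator_inv_naturality_left_assoc, ← comp_whiskerRight_assoc,
    BraidedCategory.braiding_naturality_left_assoc, braiding_tensorUnit_left]
  monoidal

/-- A loop that is fed a constant `g` can be cut: the cap turns `g` into a point of the cup, which
delivers `g` at the input of `k`. -/
theorem Zigzag.tr_comp_point (h : Zigzag cup cap) (g : 𝟙_ C ⟶ R) {M N : C} (k : R ⊗ M ⟶ N) :
    tr cup cap (k ≫ (λ_ N).inv ≫ g ▷ N) = (λ_ M).inv ≫ g ▷ M ≫ k := by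
  have e : L ◁ ((λ_ N).inv ≫ g ▷ N) ≫ capR cap N =
      ((ρ_ L).inv ≫ L ◁ g ≫ cap) ▷ N ≫ (λ_ N).hom := by
    simp only [capR]
    monoidal
  conv_rhs => rw [← h.cup_comp g]
  rw [tr, MonoidalCategory.whiskerLeft_comp, Category.assoc, e, whisker_exchange_assoc,
    leftUnitor_naturality]
  simp only [cupR]
  monoidal

variable (cup cap)

variable {L' R' : C} (cup' : 𝟙_ C ⟶ L' ⊗ R') (cap' : L' ⊗ R' ⟶ 𝟙_ C)

/-- The cup and cap on the left have the shape produced by the recursions of `Diag.cupN` and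
`Diag.capN`, so a loop on several wires unfolds into loops on one wire. -/
theorem tr_prod {M N : C} (f : (R ⊗ R') ⊗ M ⟶ (R ⊗ R') ⊗ N) :
    tr ((λ_ (𝟙_ C)).inv ≫ (cup ⊗ₘ cup') ≫ tensorμ L R L' R')
      (tensorμ L L' R R' ≫ (cap ⊗ₘ cap') ≫ (λ_ (𝟙_ C)).hom) f =
    tr cup cap (tr cup' cap' (sw R' R M ≫ (α_ R R' M).inv ≫ f ≫ (α_ R R' N).hom ≫ sw R R' N)) := by
  have e₁ : cupR ((λ_ (𝟙_ C)).inv ≫ (cup ⊗ₘ cup') ≫ tensorμ L R L' R') M =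
      cupR cup M ≫ L ◁ (cupR cup' (R ⊗ M) ≫ L' ◁ (sw R' R M ≫ (α_ R R' M).inv)) ≫
        (α_ L L' _).inv := by
    have h := whiskerLeft_cupR_sw cup' R M
    rw [MonoidalCategory.whiskerLeft_comp L', ← Category.assoc (cupR cup' (R ⊗ M)), ← h]
    simp only [cupR, sw, tensorμ, MonoidalCategory.tensorHom_def]
    monoidal
  have e₂ : capR (tensorμ L L' R R' ≫ (cap ⊗ₘ cap') ≫ (λ_ (𝟙_ C)).hom) N =
      (α_ L L' _).hom ≫ L ◁ (L' ◁ ((α_ R R' N).hom ≫ sw R R' N) ≫ capR cap' (R ⊗ N)) ≫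
        capR cap N := by
    have h := sw_whiskerLeft_capR cap' R N
    rw [MonoidalCategory.whiskerLeft_comp L', Category.assoc, ← h]
    simp only [capR, sw, tensorμ, MonoidalCategory.tensorHom_def']
    monoidal
  simp only [tr, e₁, e₂]
  simp only [Category.assoc, MonoidalCategory.whiskerLeft_comp]
  simp only [tensor_whiskerLeft, Category.assoc, Iso.inv_hom_id_assoc]

end Trace

end KleeneDiagram

namespace KleeneDiagram

open CategoryTheory MonoidalCategory

/-! ### Commutative (co)monoids in a symmetric monoidal category -/

section

variable {C : Type*} [Category* C] [MonoidalCategory C] [SymmetricCategory C]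

/-- Coassociativity and cocommutativity make a comultiplication commute with itself; this is the
instance of `IsHom` that is not a bialgebra law. -/
theorem comul_tensorμ {X : C} {d : X ⟶ X ⊗ X} (assoc : d ≫ d ▷ X ≫ (α_ X X X).hom = d ≫ X ◁ d)
    (comm : d ≫ (β_ X X).hom = d) : d ≫ (d ⊗ₘ d) ≫ tensorμ X X X X = d ≫ (d ⊗ₘ d) := by
  have h : d ≫ (d ⊗ₘ d) ≫ (α_ X X (X ⊗ X)).hom ≫ X ◁ (α_ X X X).inv =
      d ≫ X ◁ (d ≫ d ▷ X) := by
    have assoc' : d ≫ X ◁ d ≫ (α_ X X X).inv = d ≫ d ▷ X := by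
      rw [← reassoc_of% assoc]
      simp
    rw [← assoc', MonoidalCategory.tensorHom_def]
    simp only [Category.assoc, associator_naturality_right_assoc, reassoc_of% assoc,
      MonoidalCategory.whiskerLeft_comp]
  have h' : d ≫ (d ⊗ₘ d) = (d ≫ X ◁ (d ≫ d ▷ X)) ≫ X ◁ (α_ X X X).hom ≫
      (α_ X X (X ⊗ X)).inv := by
    rw [← h]
    simp
  rw [h', reassoc_of% h', tensorμ]
  simp only [Category.assoc, Iso.inv_hom_id_assoc, whiskerLeft_hom_inv_assoc]
  rw [← MonoidalCategory.whiskerLeft_comp_assoc X (d ≫ d ▷ X), Category.assoc,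
    ← comp_whiskerRight, comm]

theorem tensorμ_mul {X : C} {m : X ⊗ X ⟶ X} (assoc : (α_ X X X).inv ≫ m ▷ X ≫ m = X ◁ m ≫ m)
    (comm : (β_ X X).hom ≫ m = m) : tensorμ X X X X ≫ (m ⊗ₘ m) ≫ m = (m ⊗ₘ m) ≫ m := by
  have h : X ◁ (α_ X X X).hom ≫ (α_ X X (X ⊗ X)).inv ≫ (m ⊗ₘ m) ≫ m = X ◁ (m ▷ X ≫ m) ≫ m := by
    have assoc' : (α_ X X X).hom ≫ X ◁ m ≫ m = m ▷ X ≫ m := by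
      rw [← assoc]
      simp
    rw [← assoc', MonoidalCategory.tensorHom_def']
    simp only [← associator_inv_naturality_right_assoc, assoc, MonoidalCategory.whiskerLeft_comp,
      Category.assoc]
  have h' : (m ⊗ₘ m) ≫ m = (α_ X X (X ⊗ X)).hom ≫ X ◁ (α_ X X X).inv ≫
      X ◁ (m ▷ X ≫ m) ≫ m := by
    rw [← h]
    simp
  rw [h', tensorμ]
  simp only [Category.assoc, Iso.inv_hom_id_assoc, whiskerLeft_hom_inv_assoc]
  rw [← MonoidalCategory.whiskerLeft_comp_assoc X ((β_ X X).hom ▷ X), ← comp_whiskerRight_assoc,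
    comm]

/-- Inductive step of `cop_tensor`; the dual version that follows serves `mer_tensor`. -/
theorem tensorμ_assoc {X Y Z X₁ X₂ Y₁ Y₂ Z₁ Z₂ : C} (f : X ⟶ X₁ ⊗ X₂) (g : Y ⟶ Y₁ ⊗ Y₂)
    (h : Z ⟶ Z₁ ⊗ Z₂) :
    (((f ⊗ₘ g) ≫ tensorμ X₁ X₂ Y₁ Y₂) ⊗ₘ h) ≫ tensorμ (X₁ ⊗ Y₁) (X₂ ⊗ Y₂) Z₁ Z₂ ≫
        ((α_ X₁ Y₁ Z₁).hom ⊗ₘ (α_ X₂ Y₂ Z₂).hom) =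
      (α_ X Y Z).hom ≫ (f ⊗ₘ ((g ⊗ₘ h) ≫ tensorμ Y₁ Y₂ Z₁ Z₂)) ≫
        tensorμ X₁ X₂ (Y₁ ⊗ Z₁) (Y₂ ⊗ Z₂) := by
  have e₁ : ((f ⊗ₘ g) ≫ tensorμ X₁ X₂ Y₁ Y₂) ⊗ₘ h =
      ((f ⊗ₘ g) ⊗ₘ h) ≫ tensorμ X₁ X₂ Y₁ Y₂ ▷ (Z₁ ⊗ Z₂) := by
    rw [← tensorHom_id, tensorHom_comp_tensorHom, Category.comp_id]
  have e₂ : f ⊗ₘ ((g ⊗ₘ h) ≫ tensorμ Y₁ Y₂ Z₁ Z₂) =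
      (f ⊗ₘ (g ⊗ₘ h)) ≫ (X₁ ⊗ X₂) ◁ tensorμ Y₁ Y₂ Z₁ Z₂ := by
    rw [← id_tensorHom, tensorHom_comp_tensorHom, Category.comp_id]
  rw [e₁, e₂, Category.assoc, tensor_associativity]
  simp

theorem tensorμ_assoc' {X Y Z X₁ X₂ Y₁ Y₂ Z₁ Z₂ : C} (f : X₁ ⊗ X₂ ⟶ X) (g : Y₁ ⊗ Y₂ ⟶ Y)
    (h : Z₁ ⊗ Z₂ ⟶ Z) :
    ((α_ X₁ Y₁ Z₁).hom ⊗ₘ (α_ X₂ Y₂ Z₂).hom) ≫ tensorμ X₁ (Y₁ ⊗ Z₁) X₂ (Y₂ ⊗ Z₂) ≫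
        (f ⊗ₘ (tensorμ Y₁ Z₁ Y₂ Z₂ ≫ (g ⊗ₘ h))) =
      tensorμ (X₁ ⊗ Y₁) Z₁ (X₂ ⊗ Y₂) Z₂ ≫ ((tensorμ X₁ Y₁ X₂ Y₂ ≫ (f ⊗ₘ g)) ⊗ₘ h) ≫
        (α_ X Y Z).hom := by
  have e₁ : (tensorμ X₁ Y₁ X₂ Y₂ ≫ (f ⊗ₘ g)) ⊗ₘ h =
      tensorμ X₁ Y₁ X₂ Y₂ ▷ (Z₁ ⊗ Z₂) ≫ ((f ⊗ₘ g) ⊗ₘ h) := by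
    rw [← tensorHom_id, tensorHom_comp_tensorHom, Category.id_comp]
  have e₂ : f ⊗ₘ (tensorμ Y₁ Z₁ Y₂ Z₂ ≫ (g ⊗ₘ h)) =
      (X₁ ⊗ X₂) ◁ tensorμ Y₁ Z₁ Y₂ Z₂ ≫ (f ⊗ₘ (g ⊗ₘ h)) := by
    rw [← id_tensorHom, tensorHom_comp_tensorHom, Category.id_comp]
  rw [e₁, e₂, ← associator_monoidal_assoc]
  simp

theorem braiding_tensorμ (X X' Y Y' : C) :
    (β_ (X ⊗ X') (Y ⊗ Y')).hom ≫ tensorμ Y Y' X X' =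
      tensorμ X X' Y Y' ≫ ((β_ X Y).hom ⊗ₘ (β_ X' Y').hom) := by
  have h : (β_ (X ⊗ X') (Y ⊗ Y')).hom = tensorμ X X' Y Y' ≫ ((β_ X Y).hom ⊗ₘ (β_ X' Y').hom) ≫
      tensorδ Y Y' X X' := by
    simp only [tensorμ, tensorδ, BraidedCategory.braiding_tensor_left_hom,
      BraidedCategory.braiding_tensor_right_hom, MonoidalCategory.tensorHom_def,
      ← SymmetricCategory.braiding_swap_eq_inv_braiding]
    monoidal
  rw [h]
  simp

theorem tensorμ_unit_unit (X Y : C) :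
    tensorμ X (𝟙_ C) (𝟙_ C) Y ≫ ((ρ_ X).hom ⊗ₘ (λ_ Y).hom) = (ρ_ X).hom ⊗ₘ (λ_ Y).hom := by
  simp only [tensorμ, braiding_tensorUnit_left]
  monoidal

theorem unit_unit_tensorμ (X Y : C) :
    ((ρ_ X).inv ⊗ₘ (λ_ Y).inv) ≫ tensorμ X (𝟙_ C) (𝟙_ C) Y = (ρ_ X).inv ⊗ₘ (λ_ Y).inv := by
  simp only [tensorμ, braiding_tensorUnit_left]
  monoidal

end

/-! ### The black nodes -/

variable {A : Type u}

/-- The object `▶`. -/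
abbrev R : Word A := ⟨[.right]⟩

/-- The object `◀`. -/
abbrev L : Word A := ⟨[.left]⟩

/-- The morphism denoted by a generator. -/
def gn {X Y : List Dir} (g : Gen A X Y) : (⟨X⟩ : Word A) ⟶ ⟨Y⟩ := den (Syn.mk (.of g))

/-- The cup. -/
def cup : 𝟙_ (Word A) ⟶ L ⊗ R := gn .cup

/-- The cap. -/
def cap : L ⊗ R ⟶ 𝟙_ (Word A) := gn .cap

/-- The action of a letter. -/
def ltr (a : A) : (R : Word A) ⟶ R := gn (.letter a)

/-- The node `copy`. -/
def cop₁ : (R : Word A) ⟶ R ⊗ R := gn .copy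

/-- The node `del`. -/
def del₁ : R ⟶ 𝟙_ (Word A) := gn .del

/-- The node `merge`. -/
def mer₁ : R ⊗ R ⟶ (R : Word A) := gn .merge

/-- The node `gen`. -/
def gen₁ : 𝟙_ (Word A) ⟶ R := gn .gen

theorem den_ax {X Y : List Dir} {f g : Diag A X Y} (h : AxEq f g) :
    den (Syn.mk f) = den (Syn.mk g) :=
  den_eq.2 ⟨.ax_eq h, .ax_eq_symm h⟩

theorem den_ax_le {X Y : List Dir} {f g : Diag A X Y} (h : AxLe f g) :
    den (Syn.mk f) ≤ den (Syn.mk g) :=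
  den_le.2 (.ax_le h)

theorem zigzag : Zigzag (cup (A := A)) cap := by
  have h : R ◁ cup ≫ ((β_ R L).hom ≫ cap) ▷ R = 𝟙 (R : Word A) := den_ax .a1
  refine Eq.trans ?_ h
  refine (Category.id_comp _).trans (congrArg (R ◁ cup ≫ ·) ((Category.id_comp _).trans ?_))
  exact Category.comp_id _

theorem cop₁_assoc : cop₁ ≫ cop₁ ▷ R ≫ (α_ R R R).hom = cop₁ ≫ (R : Word A) ◁ cop₁ := by
  have h : cop₁ ≫ cop₁ ▷ R = cop₁ ≫ (R : Word A) ◁ cop₁ := den_ax .b1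
  exact (congrArg (cop₁ ≫ ·) (Category.comp_id _)).trans h

theorem cop₁_comm : cop₁ ≫ (β_ R (R : Word A)).hom = cop₁ := den_ax .b3

theorem cop₁_del : cop₁ ≫ (R : Word A) ◁ del₁ ≫ (ρ_ R).hom = 𝟙 R := by
  have h : cop₁ ≫ (R : Word A) ◁ del₁ = 𝟙 R := den_ax .b2
  exact (congrArg (cop₁ ≫ ·) (Category.comp_id _)).trans h

theorem del_cop₁ : cop₁ ≫ del₁ ▷ (R : Word A) ≫ (λ_ R).hom = 𝟙 R := by
  rw [← cop₁_comm, Category.assoc, ← BraidedCategory.braiding_naturality_right_assoc,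
    braiding_leftUnitor, cop₁_del]

theorem mer₁_assoc : (α_ R R R).inv ≫ mer₁ ▷ R ≫ mer₁ = (R : Word A) ◁ mer₁ ≫ mer₁ := by
  have h : mer₁ ▷ R ≫ mer₁ = (R : Word A) ◁ mer₁ ≫ mer₁ := den_ax .b4
  exact (Category.id_comp _).trans h

theorem mer₁_comm : (β_ R (R : Word A)).hom ≫ mer₁ = mer₁ := den_ax .b6

theorem gen_mer₁ : (ρ_ R).inv ≫ (R : Word A) ◁ gen₁ ≫ mer₁ = 𝟙 R := by
  have h : (R : Word A) ◁ gen₁ ≫ mer₁ = 𝟙 R := den_ax .b5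
  exact (Category.id_comp _).trans h

theorem gen_mer₁' : (λ_ R).inv ≫ gen₁ ▷ (R : Word A) ≫ mer₁ = 𝟙 R := by
  rw [← mer₁_comm, BraidedCategory.braiding_naturality_left_assoc, leftUnitor_inv_braiding_assoc,
    gen_mer₁]

/-- On single letters the associators reduce to identities, which identifies `tensorμ` with the
middle crossing of the bialgebra axiom. -/
theorem tensorμ_R : tensorμ R R R R =
    (show (R ⊗ R) ⊗ R ⊗ R ⟶ (R ⊗ R) ⊗ R ⊗ (R : Word A) from
      (R ◁ (β_ R R).hom) ▷ R) := by
  have h : (R ◁ (β_ R (R : Word A)).hom) ▷ R =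
      (α_ R (R ⊗ R) R).hom ≫ R ◁ (β_ R R).hom ▷ R ≫ (α_ R (R ⊗ R) R).inv := by
    simp
  have h' : (show (R ⊗ R) ⊗ R ⊗ R ⟶ (R ⊗ R) ⊗ R ⊗ (R : Word A) from
      R ◁ (β_ R R).hom ▷ R) = (R ◁ (β_ R R).hom) ▷ R :=
    ((h.trans (Category.id_comp _)).trans (Category.comp_id _)).symm
  refine Eq.trans ?_ h'
  have e : (R : Word A) ◁ (α_ R R R).inv = 𝟙 _ := whiskerLeft_id _ _
  have e' : (R : Word A) ◁ (α_ R R R).hom = 𝟙 _ := whiskerLeft_id _ _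
  rw [tensorμ, e, e']
  exact (Category.id_comp _).trans ((Category.id_comp _).trans
    ((congrArg (_ ≫ ·) (Category.comp_id _)).trans (Category.comp_id _)))

theorem mer₁_cop₁ : mer₁ ≫ cop₁ (A := A) = (cop₁ ⊗ₘ cop₁) ≫ tensorμ R R R R ≫ (mer₁ ⊗ₘ mer₁) := by
  rw [tensorμ_R, ← Category.assoc]
  exact den_ax .b7

theorem gen₁_cop₁ : gen₁ ≫ cop₁ (A := A) = (λ_ _).inv ≫ (gen₁ ⊗ₘ gen₁) := by
  have h : gen₁ ≫ cop₁ (A := A) = gen₁ ⊗ₘ gen₁ := den_ax .b8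
  exact h.trans (Category.id_comp _).symm

theorem mer₁_del₁ : mer₁ ≫ del₁ (A := A) = (del₁ ⊗ₘ del₁) ≫ (λ_ _).hom := by
  have h : mer₁ ≫ del₁ (A := A) = del₁ ⊗ₘ del₁ := den_ax .b9
  exact h.trans (Category.comp_id _).symm

theorem cop₁_mer₁ : cop₁ ≫ mer₁ = 𝟙 (R : Word A) := den_ax .b10

theorem gen₁_del₁ : gen₁ ≫ del₁ = 𝟙 (𝟙_ (Word A)) := den_ax .b11

/-- This axiom says that the star of the identity is the identity. It supplies the lower bound in
`tr_twist`. -/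
theorem tr_mer₁_cop₁ : tr cup cap (mer₁ ≫ cop₁) = 𝟙 (R : Word A) := by
  have h : (cup ▷ R ≫ L ◁ (mer₁ ≫ cop₁)) ≫ cap ▷ R = 𝟙 (R : Word A) := den_ax .b12
  refine Eq.trans ?_ h
  rw [Category.assoc]
  refine (congrArg (· ≫ _) ((Category.id_comp _).trans (Category.comp_id _))).trans ?_
  refine congrArg (cup ▷ R ≫ L ◁ (mer₁ ≫ cop₁) ≫ ·) ?_
  exact (Category.id_comp _).trans (Category.comp_id _)

theorem id_le_del₁_gen₁ : 𝟙 (R : Word A) ≤ del₁ ≫ gen₁ := den_ax_le .f2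

theorem mer₁_ltr (a : A) : mer₁ ≫ ltr a = (ltr a ⊗ₘ ltr a) ≫ mer₁ := den_ax (.e10 a)

theorem gen₁_ltr (a : A) : gen₁ ≫ ltr a = gen₁ := den_ax (.e11 a)

end KleeneDiagram

namespace KleeneDiagram

open CategoryTheory MonoidalCategory

variable {A : Type u}

/-! ### Copying, discarding, merging and generating words -/

/-- A word all of whose letters are `▶`. -/
def Rightward (X : Word A) : Prop := ∀ d ∈ X.toList, d = Dir.right

theorem Rightward.tensor {X Y : Word A} (hX : Rightward X) (hY : Rightward Y) :
    Rightward (X ⊗ Y) := fun d hd =>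
  (List.mem_append.1 hd).elim (hX d) (hY d)

theorem Rightward.left {X Y : Word A} (h : Rightward (X ⊗ Y)) : Rightward X :=
  fun d hd => h d (List.mem_append_left _ hd)

theorem Rightward.right {X Y : Word A} (h : Rightward (X ⊗ Y)) : Rightward Y :=
  fun d hd => h d (List.mem_append_right _ hd)

theorem rightward_R : Rightward (R : Word A) := by simp [Rightward]

theorem rightward_unit : Rightward (𝟙_ (Word A)) := fun _ h => absurd h List.not_mem_nil

theorem rightward_rs (n : ℕ) : Rightward (⟨rs n⟩ : Word A) := fun _ h => List.eq_of_mem_replicate h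

/-- Discarding of a letter. The value on `◀` plays no role. -/
def delD : (d : Dir) → ((⟨[d]⟩ : Word A) ⟶ 𝟙_ (Word A))
  | .right => del₁
  | .left => (ρ_ L).inv ≫ L ◁ gen₁ ≫ cap

/-- Generation of a letter. The value on `◀` plays no role. -/
def genD : (d : Dir) → (𝟙_ (Word A) ⟶ (⟨[d]⟩ : Word A))
  | .right => gen₁
  | .left => cup ≫ L ◁ del₁ ≫ (ρ_ L).hom

/-- Duplication of a letter. The value on `◀` plays no role. -/
def copD : (d : Dir) → ((⟨[d]⟩ : Word A) ⟶ ⟨[d]⟩ ⊗ ⟨[d]⟩)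
  | .right => cop₁
  | .left => delD .left ≫ (λ_ _).inv ≫ (genD .left ⊗ₘ genD .left)

/-- Merging of a letter. The value on `◀` plays no role. -/
def merD : (d : Dir) → (⟨[d]⟩ ⊗ ⟨[d]⟩ ⟶ (⟨[d]⟩ : Word A))
  | .right => mer₁
  | .left => (delD .left ⊗ₘ delD .left) ≫ (λ_ _).hom ≫ genD .left

/-- Discarding of a word. -/
def delL : (X : List Dir) → ((⟨X⟩ : Word A) ⟶ 𝟙_ (Word A))
  | [] => 𝟙 _
  | d :: X => (delD d ⊗ₘ delL X) ≫ (λ_ _).hom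

/-- Generation of a word. -/
def genL : (X : List Dir) → (𝟙_ (Word A) ⟶ (⟨X⟩ : Word A))
  | [] => 𝟙 _
  | d :: X => (λ_ _).inv ≫ (genD d ⊗ₘ genL X)

/-- Duplication of a word. -/
def copL : (X : List Dir) → ((⟨X⟩ : Word A) ⟶ ⟨X⟩ ⊗ ⟨X⟩)
  | [] => (λ_ _).inv
  | d :: X => (copD d ⊗ₘ copL X) ≫ tensorμ (⟨[d]⟩ : Word A) ⟨[d]⟩ ⟨X⟩ ⟨X⟩

/-- Merging of a word. -/
def merL : (X : List Dir) → (⟨X⟩ ⊗ ⟨X⟩ ⟶ (⟨X⟩ : Word A))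
  | [] => (λ_ _).hom
  | d :: X => tensorμ (⟨[d]⟩ : Word A) ⟨X⟩ ⟨[d]⟩ ⟨X⟩ ≫ (merD d ⊗ₘ merL X)

/-- Discarding of an object. -/
def del (X : Word A) : X ⟶ 𝟙_ (Word A) := delL X.toList

/-- Generation of an object. -/
def gen (X : Word A) : 𝟙_ (Word A) ⟶ X := genL X.toList

/-- Duplication of an object. -/
def cop (X : Word A) : X ⟶ X ⊗ X := copL X.toList

/-- Merging of an object. -/
def mer (X : Word A) : X ⊗ X ⟶ X := merL X.toList

theorem del_unit : del (𝟙_ (Word A)) = 𝟙 _ := rfl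

theorem gen_unit : gen (𝟙_ (Word A)) = 𝟙 _ := rfl

theorem cop_unit : cop (𝟙_ (Word A)) = (λ_ _).inv := rfl

theorem mer_unit : mer (𝟙_ (Word A)) = (λ_ _).hom := rfl

theorem del_R : del (R : Word A) = del₁ := by
  refine (Category.comp_id _).trans ?_
  exact (MonoidalCategory.tensorHom_id del₁ (𝟙_ (Word A))).trans
    ((Category.comp_id _).symm.trans ((rightUnitor_naturality del₁).trans (Category.id_comp _)))

theorem gen_R : gen (R : Word A) = gen₁ := by
  refine (Category.id_comp _).trans ?_
  exact (MonoidalCategory.tensorHom_id gen₁ (𝟙_ (Word A))).trans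
    ((Category.comp_id _).symm.trans ((rightUnitor_naturality gen₁).trans (Category.id_comp _)))

theorem cop_R : cop (R : Word A) = cop₁ := by
  have h : cop (R : Word A) = (cop₁ ⊗ₘ (λ_ _).inv) ≫ tensorμ R R (𝟙_ _) (𝟙_ _) := rfl
  have h' := (ρ_ (R : Word A)).inv ≫= (cop₁ ▷ 𝟙_ _ ≫= tensor_right_unitality (R : Word A) R)
  rw [rightUnitor_naturality, Iso.inv_hom_id_assoc] at h'
  rw [h', h, MonoidalCategory.tensorHom_def, Category.assoc]
  refine Eq.trans ?_ (Category.id_comp _).symm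
  refine congrArg (_ ≫ _ ≫ ·) ?_
  refine (Category.comp_id _).symm.trans (congrArg (tensorμ R R (𝟙_ (Word A)) (𝟙_ _) ≫ ·) ?_)
  exact (tensor_id_id _ _).symm

theorem mer_R : mer (R : Word A) = mer₁ := by
  have h : mer (R : Word A) = tensorμ R (𝟙_ _) R (𝟙_ _) ≫ (mer₁ ⊗ₘ (λ_ _).hom) := rfl
  have h' := rightUnitor_monoidal (R : Word A) R =≫ mer₁
  rw [Category.assoc, Category.assoc, ← rightUnitor_naturality] at h'
  rw [h, MonoidalCategory.tensorHom_def']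
  have h₂ : ((ρ_ (R : Word A)).hom ⊗ₘ (ρ_ R).hom) = 𝟙 _ := tensor_id_id _ _
  have h₃ : mer₁ = ((ρ_ (R : Word A)).hom ⊗ₘ (ρ_ R).hom) ≫ mer₁ := by
    rw [h₂]
    exact (Category.id_comp _).symm
  refine Eq.trans ?_ h₃.symm
  refine Eq.trans ?_ h'.symm
  refine congrArg (_ ≫ _ ≫ ·) ?_
  exact (Category.comp_id _).symm

theorem del_cons (d : Dir) (X : Word A) :
    del (⟨[d]⟩ ⊗ X) = (delD d ⊗ₘ del X) ≫ (λ_ _).hom := rfl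

theorem gen_cons (d : Dir) (X : Word A) :
    gen (⟨[d]⟩ ⊗ X) = (λ_ _).inv ≫ (genD d ⊗ₘ gen X) := rfl

theorem del_tensor (X Y : Word A) : del (X ⊗ Y) = (del X ⊗ₘ del Y) ≫ (λ_ _).hom := by
  obtain ⟨X⟩ := X
  induction X with
  | nil =>
    have h : del ((𝟙_ (Word A)) ⊗ Y) = (λ_ Y).hom ≫ del Y := (Category.id_comp _).symm
    refine h.trans ?_
    rw [← leftUnitor_naturality, ← id_tensorHom]
    rfl
  | cons d X ih =>
    have h : del (((⟨[d]⟩ : Word A) ⊗ ⟨X⟩) ⊗ Y) = (α_ _ _ _).hom ≫ del ((⟨[d]⟩ : Word A) ⊗ ⟨X⟩ ⊗ Y) :=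
      (Category.id_comp _).symm
    refine h.trans ?_
    change _ = (del ((⟨[d]⟩ : Word A) ⊗ ⟨X⟩) ⊗ₘ _) ≫ _
    rw [del_cons, del_cons, ih]
    simp only [MonoidalCategory.tensorHom_def]
    monoidal

theorem gen_tensor (X Y : Word A) : gen (X ⊗ Y) = (λ_ _).inv ≫ (gen X ⊗ₘ gen Y) := by
  obtain ⟨X⟩ := X
  induction X with
  | nil =>
    have h : gen ((𝟙_ (Word A)) ⊗ Y) = gen Y ≫ (λ_ Y).inv := (Category.comp_id _).symm
    refine h.trans ?_
    rw [leftUnitor_inv_naturality, ← id_tensorHom]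
    rfl
  | cons d X ih =>
    have h : gen (((⟨[d]⟩ : Word A) ⊗ ⟨X⟩) ⊗ Y) = gen ((⟨[d]⟩ : Word A) ⊗ ⟨X⟩ ⊗ Y) ≫ (α_ _ _ _).inv :=
      (Category.comp_id _).symm
    refine h.trans ?_
    change _ = _ ≫ (gen ((⟨[d]⟩ : Word A) ⊗ ⟨X⟩) ⊗ₘ _)
    rw [gen_cons, gen_cons, ih]
    simp only [MonoidalCategory.tensorHom_def]
    monoidal

theorem cop_tensor (X Y : Word A) : cop (X ⊗ Y) = (cop X ⊗ₘ cop Y) ≫ tensorμ X X Y Y := by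
  obtain ⟨X⟩ := X
  induction X with
  | nil =>
    have h : cop ((𝟙_ (Word A)) ⊗ Y) = (λ_ Y).hom ≫ cop Y ≫ ((λ_ Y).inv ⊗ₘ (λ_ Y).inv) := by
      refine (Category.id_comp _).symm.trans (congrArg (_ ≫ ·) ?_)
      refine (Category.comp_id _).symm.trans (congrArg (_ ≫ ·) (tensor_id_id _ _).symm)
    refine h.trans ?_
    change _ = (cop (𝟙_ (Word A)) ⊗ₘ _) ≫ _
    change _ = _ ≫ tensorμ (𝟙_ (Word A)) (𝟙_ (Word A)) Y Y
    rw [cop_unit, MonoidalCategory.tensorHom_def' _ (cop Y), Category.assoc,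
      ← cancel_mono ((λ_ Y).hom ⊗ₘ (λ_ Y).hom)]
    simp only [Category.assoc, ← tensor_left_unitality, leftUnitor_naturality,
      tensorHom_comp_tensorHom, Iso.inv_hom_id, tensor_id_id, Category.comp_id]
  | cons d X ih =>
    have h := tensorμ_assoc (copD (A := A) d) (cop ⟨X⟩) (cop Y)
    rw [← ih] at h
    refine Eq.trans ?_ (h.symm.trans ?_)
    · exact (Category.id_comp _).symm
    · exact congrArg (_ ≫ ·) ((congrArg (_ ≫ ·) (tensor_id_id _ _)).trans (Category.comp_id _))

theorem mer_tensor (X Y : Word A) : mer (X ⊗ Y) = tensorμ X Y X Y ≫ (mer X ⊗ₘ mer Y) := by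
  obtain ⟨X⟩ := X
  induction X with
  | nil =>
    have h : mer ((𝟙_ (Word A)) ⊗ Y) = ((λ_ Y).hom ⊗ₘ (λ_ Y).hom) ≫ mer Y ≫ (λ_ Y).inv := by
      refine (Category.id_comp _).symm.trans (congrArg₂ (· ≫ ·) (tensor_id_id _ _).symm ?_)
      exact (Category.comp_id _).symm
    refine h.trans ?_
    change _ = _ ≫ (mer (𝟙_ (Word A)) ⊗ₘ _)
    change _ = tensorμ (𝟙_ (Word A)) Y (𝟙_ (Word A)) Y ≫ _
    rw [mer_unit, MonoidalCategory.tensorHom_def _ (mer Y), leftUnitor_monoidal]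
    simp only [Category.assoc, ← leftUnitor_naturality_assoc, Iso.hom_inv_id, Category.comp_id]
  | cons d X ih =>
    have h := tensorμ_assoc' (merD (A := A) d) (mer ⟨X⟩) (mer Y)
    rw [← ih] at h
    refine Eq.trans ?_ (h.trans ?_)
    · refine ((congrArg (· ≫ _) (tensor_id_id _ _)).trans (Category.id_comp _)).symm
    · exact congrArg (_ ≫ ·) (Category.comp_id _)

end KleeneDiagram

namespace KleeneDiagram

open CategoryTheory MonoidalCategory

/-! ### Coherence of `tensorμ` with units and crossings. -/

section

variable {C : Type*} [Category* C] [MonoidalCategory C] [SymmetricCategory C]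

theorem tensorμ_whiskerLeft_counit (X Y : C) {X' Y' : C} (d : X' ⟶ 𝟙_ C) (d' : Y' ⟶ 𝟙_ C) :
    tensorμ X X' Y Y' ≫ (X ⊗ Y) ◁ ((d ⊗ₘ d') ≫ (λ_ _).hom) ≫ (ρ_ _).hom =
      (X ◁ d ≫ (ρ_ X).hom) ⊗ₘ (Y ◁ d' ≫ (ρ_ Y).hom) := by
  rw [← tensorHom_comp_tensorHom, rightUnitor_monoidal, ← id_tensorHom X, ← id_tensorHom Y,
    tensorμ_natural_assoc, MonoidalCategory.whiskerLeft_comp, ← id_tensorHom, ← id_tensorHom,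
    Category.assoc, id_tensorHom_id]

theorem tensorμ_whiskerRight_counit (X Y : C) {X' Y' : C} (d : X' ⟶ 𝟙_ C) (d' : Y' ⟶ 𝟙_ C) :
    tensorμ X' X Y' Y ≫ ((d ⊗ₘ d') ≫ (λ_ _).hom) ▷ (X ⊗ Y) ≫ (λ_ _).hom =
      (d ▷ X ≫ (λ_ X).hom) ⊗ₘ (d' ▷ Y ≫ (λ_ Y).hom) := by
  rw [← tensorHom_comp_tensorHom, leftUnitor_monoidal, ← tensorHom_id _ X, ← tensorHom_id _ Y,
    tensorμ_natural_assoc, comp_whiskerRight, ← tensorHom_id, ← tensorHom_id,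
    Category.assoc, id_tensorHom_id]

theorem whiskerLeft_unit_tensorμ (X Y : C) {X' Y' : C} (d : 𝟙_ C ⟶ X') (d' : 𝟙_ C ⟶ Y') :
    (ρ_ _).inv ≫ (X ⊗ Y) ◁ ((λ_ _).inv ≫ (d ⊗ₘ d')) ≫ tensorμ X Y X' Y' =
      ((ρ_ X).inv ≫ X ◁ d) ⊗ₘ ((ρ_ Y).inv ≫ Y ◁ d') := by
  have h : (ρ_ (X ⊗ Y)).inv ≫ (X ⊗ Y) ◁ (λ_ (𝟙_ C)).inv ≫ tensorμ X Y (𝟙_ C) (𝟙_ C) =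
      (ρ_ X).inv ⊗ₘ (ρ_ Y).inv := by
    rw [← cancel_mono ((ρ_ X).hom ⊗ₘ (ρ_ Y).hom), Category.assoc, Category.assoc,
      ← tensor_right_unitality]
    simp
  rw [← tensorHom_comp_tensorHom, ← h, ← id_tensorHom X, ← id_tensorHom Y,
    Category.assoc, Category.assoc, ← tensorμ_natural, MonoidalCategory.whiskerLeft_comp,
    ← id_tensorHom, ← id_tensorHom, Category.assoc, id_tensorHom_id]

theorem whiskerRight_unit_tensorμ (X Y : C) {X' Y' : C} (d : 𝟙_ C ⟶ X') (d' : 𝟙_ C ⟶ Y') :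
    (λ_ _).inv ≫ ((λ_ _).inv ≫ (d ⊗ₘ d')) ▷ (X ⊗ Y) ≫ tensorμ X' Y' X Y =
      ((λ_ X).inv ≫ d ▷ X) ⊗ₘ ((λ_ Y).inv ≫ d' ▷ Y) := by
  have h : (λ_ (X ⊗ Y)).inv ≫ (λ_ (𝟙_ C)).inv ▷ (X ⊗ Y) ≫ tensorμ (𝟙_ C) (𝟙_ C) X Y =
      (λ_ X).inv ⊗ₘ (λ_ Y).inv := by
    rw [← cancel_mono ((λ_ X).hom ⊗ₘ (λ_ Y).hom), Category.assoc, Category.assoc,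
      ← tensor_left_unitality]
    simp
  rw [← tensorHom_comp_tensorHom, ← h, ← tensorHom_id _ X, ← tensorHom_id _ Y,
    Category.assoc, Category.assoc, ← tensorμ_natural, comp_whiskerRight,
    ← tensorHom_id, ← tensorHom_id, Category.assoc, id_tensorHom_id]

theorem tensorμ_tensorμ (X X' Y Y' : C) : tensorμ X X' Y Y' ≫ tensorμ X Y X' Y' = 𝟙 _ := by
  simp only [tensorμ, Category.assoc, Iso.inv_hom_id_assoc, whiskerLeft_hom_inv_assoc]
  rw [← MonoidalCategory.whiskerLeft_comp_assoc X (_ ▷ _), ← comp_whiskerRight,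
    SymmetricCategory.symmetry]
  simp

theorem tensorμ_braiding (X Y X' Y' : C) : tensorμ X Y X' Y' ≫ (β_ (X ⊗ X') (Y ⊗ Y')).hom =
    ((β_ X Y).hom ⊗ₘ (β_ X' Y').hom) ≫ tensorμ Y X Y' X' := by
  have h := tensorμ X Y X' Y' ≫= braiding_tensorμ X X' Y Y' =≫ tensorμ Y X Y' X'
  rw [Category.assoc, Category.assoc, tensorμ_tensorμ, Category.comp_id,
    reassoc_of% tensorμ_tensorμ X Y X' Y'] at h
  exact h

end

variable {A : Type u}

/-! ### Relations: the diagrams of black nodes on rightward words -/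

/-- The nodes on `◀` are placeholders satisfying no law, so the laws for words are proved by this
induction, which meets `▶` only. -/
theorem Rightward.induction {P : Word A → Prop} (unit : P (𝟙_ (Word A)))
    (tensor : ∀ X, Rightward X → P X → P (R ⊗ X)) {X : Word A} (hX : Rightward X) : P X := by
  obtain ⟨X⟩ := X
  induction X with
  | nil => exact unit
  | cons d X ih =>
    obtain rfl : d = Dir.right := hX d List.mem_cons_self
    have hX' : Rightward (⟨X⟩ : Word A) := fun d hd => hX d (List.mem_cons_of_mem _ hd)
    exact tensor ⟨X⟩ hX' (ih hX')

theorem Rightward.cop_del {X : Word A} (hX : Rightward X) :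
    cop X ≫ X ◁ del X ≫ (ρ_ X).hom = 𝟙 X := by
  refine Rightward.induction (P := fun X => cop X ≫ X ◁ del X ≫ (ρ_ X).hom = 𝟙 X) ?_ ?_ hX
  · rw [cop_unit, del_unit, ← unitors_equal]; simp
  · intro X _ ih
    rw [cop_tensor, del_tensor, Category.assoc, tensorμ_whiskerLeft_counit,
      tensorHom_comp_tensorHom, ih, cop_R, del_R, cop₁_del, tensor_id_id]

theorem Rightward.del_cop {X : Word A} (hX : Rightward X) :
    cop X ≫ del X ▷ X ≫ (λ_ X).hom = 𝟙 X := by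
  refine Rightward.induction (P := fun X => cop X ≫ del X ▷ X ≫ (λ_ X).hom = 𝟙 X) ?_ ?_ hX
  · rw [cop_unit, del_unit]; simp
  · intro X _ ih
    rw [cop_tensor, del_tensor, Category.assoc, tensorμ_whiskerRight_counit,
      tensorHom_comp_tensorHom, ih, cop_R, del_R, del_cop₁, tensor_id_id]

theorem Rightward.mer_gen {X : Word A} (hX : Rightward X) :
    (ρ_ X).inv ≫ X ◁ gen X ≫ mer X = 𝟙 X := by
  refine Rightward.induction (P := fun X => (ρ_ X).inv ≫ X ◁ gen X ≫ mer X = 𝟙 X) ?_ ?_ hX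
  · rw [mer_unit, gen_unit]; simp [unitors_equal]
  · intro X _ ih
    rw [mer_tensor, gen_tensor, reassoc_of% whiskerLeft_unit_tensorμ,
      tensorHom_comp_tensorHom, Category.assoc, Category.assoc, ih, mer_R, gen_R, gen_mer₁,
      tensor_id_id]

theorem Rightward.gen_mer {X : Word A} (hX : Rightward X) :
    (λ_ X).inv ≫ gen X ▷ X ≫ mer X = 𝟙 X := by
  refine Rightward.induction (P := fun X => (λ_ X).inv ≫ gen X ▷ X ≫ mer X = 𝟙 X) ?_ ?_ hX
  · rw [mer_unit, gen_unit]; simp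
  · intro X _ ih
    rw [mer_tensor, gen_tensor, reassoc_of% whiskerRight_unit_tensorμ,
      tensorHom_comp_tensorHom, Category.assoc, Category.assoc, ih, mer_R, gen_R, gen_mer₁',
      tensor_id_id]

/-- The first projection. -/
def fst (X Y : Word A) : X ⊗ Y ⟶ X := X ◁ del Y ≫ (ρ_ X).hom

/-- The second projection. -/
def snd (X Y : Word A) : X ⊗ Y ⟶ Y := del X ▷ Y ≫ (λ_ Y).hom

/-- The first injection. -/
def inl (X Y : Word A) : X ⟶ X ⊗ Y := (ρ_ X).inv ≫ X ◁ gen Y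

/-- The second injection. -/
def inr (X Y : Word A) : Y ⟶ X ⊗ Y := (λ_ Y).inv ≫ gen X ▷ Y

/-- With `inl_inr_mer`, this makes `X ⊗ Y` a biproduct as far as morphisms satisfying `IsHom` are
concerned. -/
theorem cop_fst_snd {X Y : Word A} (hX : Rightward X) (hY : Rightward Y) :
    cop (X ⊗ Y) ≫ (fst X Y ⊗ₘ snd X Y) = 𝟙 (X ⊗ Y) := by
  rw [cop_tensor, fst, snd, ← tensorHom_comp_tensorHom, ← id_tensorHom, ← tensorHom_id,
    Category.assoc, ← tensorμ_natural_assoc, tensorμ_unit_unit, tensorHom_comp_tensorHom,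
    tensorHom_comp_tensorHom, id_tensorHom, tensorHom_id, hX.cop_del, hY.del_cop, tensor_id_id]

theorem inl_inr_mer {X Y : Word A} (hX : Rightward X) (hY : Rightward Y) :
    (inl X Y ⊗ₘ inr X Y) ≫ mer (X ⊗ Y) = 𝟙 (X ⊗ Y) := by
  rw [mer_tensor, inl, inr, ← tensorHom_comp_tensorHom, ← id_tensorHom, ← tensorHom_id,
    Category.assoc, tensorμ_natural_assoc, reassoc_of% unit_unit_tensorμ X Y,
    tensorHom_comp_tensorHom, tensorHom_comp_tensorHom, id_tensorHom, tensorHom_id]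
  rw [hX.mer_gen, hY.gen_mer, tensor_id_id]

/-- Morphisms commuting with the black nodes. -/
structure IsHom {X Y : Word A} (f : X ⟶ Y) : Prop where
  cop : f ≫ cop Y = cop X ≫ (f ⊗ₘ f)
  del : f ≫ del Y = del X
  mer : mer X ≫ f = (f ⊗ₘ f) ≫ mer Y
  gen : gen X ≫ f = gen Y

theorem IsHom.id (X : Word A) : IsHom (𝟙 X) where
  cop := by rw [tensor_id_id, Category.id_comp, Category.comp_id]
  del := Category.id_comp _
  mer := by rw [tensor_id_id, Category.id_comp, Category.comp_id]
  gen := Category.comp_id _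

theorem IsHom.comp {X Y Z : Word A} {f : X ⟶ Y} {g : Y ⟶ Z} (hf : IsHom f) (hg : IsHom g) :
    IsHom (f ≫ g) where
  cop := by rw [Category.assoc, hg.cop, reassoc_of% hf.cop, tensorHom_comp_tensorHom]
  del := by rw [Category.assoc, hg.del, hf.del]
  mer := by rw [reassoc_of% hf.mer, hg.mer, tensorHom_comp_tensorHom_assoc]
  gen := by rw [reassoc_of% hf.gen, hg.gen]

theorem IsHom.tensor {X Y X' Y' : Word A} {f : X ⟶ Y} {g : X' ⟶ Y'} (hf : IsHom f)
    (hg : IsHom g) : IsHom (f ⊗ₘ g) where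
  cop := by
    rw [cop_tensor, cop_tensor, Category.assoc, ← tensorμ_natural, tensorHom_comp_tensorHom_assoc,
      tensorHom_comp_tensorHom_assoc, hf.cop, hg.cop]
  del := by rw [del_tensor, del_tensor, tensorHom_comp_tensorHom_assoc, hf.del, hg.del]
  mer := by
    rw [mer_tensor, mer_tensor, Category.assoc, tensorμ_natural_assoc, tensorHom_comp_tensorHom,
      tensorHom_comp_tensorHom, hf.mer, hg.mer]
  gen := by rw [gen_tensor, gen_tensor, Category.assoc, tensorHom_comp_tensorHom, hf.gen, hg.gen]

theorem IsHom.braiding (X Y : Word A) : IsHom (β_ X Y).hom where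
  cop := by
    rw [cop_tensor, cop_tensor, Category.assoc, ← braiding_tensorμ,
      BraidedCategory.braiding_naturality_assoc]
  del := by
    rw [del_tensor, del_tensor, ← BraidedCategory.braiding_naturality_assoc, braiding_leftUnitor,
      unitors_equal]
  mer := by
    rw [mer_tensor, mer_tensor, Category.assoc, BraidedCategory.braiding_naturality,
      reassoc_of% tensorμ_braiding X Y X Y]
  gen := by
    rw [gen_tensor, gen_tensor, Category.assoc, BraidedCategory.braiding_naturality,
      leftUnitor_inv_braiding_assoc, unitors_inv_equal]

theorem IsHom.cop₁ : IsHom (cop₁ (A := A)) where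
  cop := by
    rw [cop_tensor, cop_R, comul_tensorμ cop₁_assoc cop₁_comm]
  del := by
    rw [del_tensor, del_R, MonoidalCategory.tensorHom_def, Category.assoc, leftUnitor_naturality,
      reassoc_of% del_cop₁ (A := A)]
  mer := by rw [mer_tensor, mer_R, mer₁_cop₁]
  gen := by rw [gen_tensor, gen_R, gen₁_cop₁]

theorem IsHom.del₁ : IsHom (del₁ (A := A)) where
  cop := by
    have h := reassoc_of% cop₁_del (A := A)
    rw [cop_unit, cop_R, MonoidalCategory.tensorHom_def', ← cancel_mono (λ_ _).hom, Category.assoc,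
      Category.assoc, Category.assoc, Iso.inv_hom_id, unitors_equal, rightUnitor_naturality, h,
      Category.comp_id]
  del := by rw [del_unit, del_R, Category.comp_id]
  mer := by rw [mer_R, mer_unit, mer₁_del₁]
  gen := by rw [gen_unit, gen_R, gen₁_del₁]

theorem IsHom.mer₁ : IsHom (mer₁ (A := A)) where
  cop := by rw [cop_tensor, cop_R, mer₁_cop₁, Category.assoc]
  del := by rw [del_tensor, del_R, mer₁_del₁]
  mer := by rw [mer_tensor, mer_R, Category.assoc, tensorμ_mul mer₁_assoc mer₁_comm]
  gen := by
    rw [gen_tensor, gen_R, MonoidalCategory.tensorHom_def', Category.assoc, Category.assoc,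
      ← leftUnitor_inv_naturality_assoc, gen_mer₁', Category.comp_id]

theorem IsHom.gen₁ : IsHom (gen₁ (A := A)) where
  cop := by rw [cop_R, cop_unit, gen₁_cop₁]
  del := by rw [del_unit, del_R, gen₁_del₁]
  mer := by
    rw [mer_R, mer_unit, MonoidalCategory.tensorHom_def, ← cancel_epi (λ_ _).inv,
      Iso.inv_hom_id_assoc, Category.assoc]
    have h := gen_mer₁ (A := A)
    conv_rhs => rw [unitors_inv_equal, ← rightUnitor_inv_naturality_assoc, h, Category.comp_id]
  gen := by rw [gen_unit, gen_R, Category.id_comp]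

/-- The diagrams of black nodes between rightward words. -/
inductive IsBool : {X Y : Word A} → (X ⟶ Y) → Prop
  | cop₁ : IsBool cop₁
  | del₁ : IsBool del₁
  | mer₁ : IsBool mer₁
  | gen₁ : IsBool gen₁
  | id {X : Word A} : Rightward X → IsBool (𝟙 X)
  | braiding {X Y : Word A} : Rightward X → Rightward Y → IsBool (β_ X Y).hom
  | comp {X Y Z : Word A} {f : X ⟶ Y} {g : Y ⟶ Z} : IsBool f → IsBool g → IsBool (f ≫ g)
  | tensor {X Y X' Y' : Word A} {f : X ⟶ Y} {g : X' ⟶ Y'} :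
      IsBool f → IsBool g → IsBool (f ⊗ₘ g)

namespace IsBool

theorem rightward {X Y : Word A} {f : X ⟶ Y} (hf : IsBool f) : Rightward X ∧ Rightward Y := by
  induction hf with
  | cop₁ => exact ⟨rightward_R, rightward_R.tensor rightward_R⟩
  | del₁ => exact ⟨rightward_R, rightward_unit⟩
  | mer₁ => exact ⟨rightward_R.tensor rightward_R, rightward_R⟩
  | gen₁ => exact ⟨rightward_unit, rightward_R⟩
  | id h => exact ⟨h, h⟩
  | braiding h h' => exact ⟨h.tensor h', h'.tensor h⟩
  | comp _ _ ih ih' => exact ⟨ih.1, ih'.2⟩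
  | tensor _ _ ih ih' => exact ⟨ih.1.tensor ih'.1, ih.2.tensor ih'.2⟩

theorem isHom {X Y : Word A} {f : X ⟶ Y} (hf : IsBool f) : IsHom f := by
  induction hf with
  | cop₁ => exact IsHom.cop₁
  | del₁ => exact IsHom.del₁
  | mer₁ => exact IsHom.mer₁
  | gen₁ => exact IsHom.gen₁
  | id => exact IsHom.id _
  | braiding => exact IsHom.braiding _ _
  | comp _ _ ih ih' => exact ih.comp ih'
  | tensor _ _ ih ih' => exact ih.tensor ih'

theorem eqToHom {X Y : Word A} (h : X = Y) (hX : Rightward X) : IsBool (eqToHom h) := by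
  subst h
  exact .id hX

theorem associator {X Y Z : Word A} (hX : Rightward X) (hY : Rightward Y) (hZ : Rightward Z) :
    IsBool (α_ X Y Z).hom :=
  eqToHom (congrArg Word.ofList (List.append_assoc _ _ _)) ((hX.tensor hY).tensor hZ)

theorem associator_inv {X Y Z : Word A} (hX : Rightward X) (hY : Rightward Y)
    (hZ : Rightward Z) : IsBool (α_ X Y Z).inv :=
  eqToHom (congrArg Word.ofList (List.append_assoc _ _ _).symm) (hX.tensor (hY.tensor hZ))

theorem leftUnitor {X : Word A} (hX : Rightward X) : IsBool (λ_ X).hom := .id hX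

theorem leftUnitor_inv {X : Word A} (hX : Rightward X) : IsBool (λ_ X).inv := .id hX

theorem rightUnitor {X : Word A} (hX : Rightward X) : IsBool (ρ_ X).hom :=
  eqToHom (congrArg Word.ofList (List.append_nil _)) (hX.tensor rightward_unit)

theorem rightUnitor_inv {X : Word A} (hX : Rightward X) : IsBool (ρ_ X).inv :=
  eqToHom (congrArg Word.ofList (List.append_nil _).symm) hX

theorem whiskerLeft {X Y Z : Word A} {f : Y ⟶ Z} (hX : Rightward X) (hf : IsBool f) :
    IsBool (X ◁ f) :=
  .tensor (.id hX) hf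

theorem whiskerRight {X Y Z : Word A} {f : Y ⟶ Z} (hf : IsBool f) (hX : Rightward X) :
    IsBool (f ▷ X) :=
  .tensor hf (.id hX)

theorem sw {X Y Z : Word A} (hX : Rightward X) (hY : Rightward Y) (hZ : Rightward Z) :
    IsBool (sw X Y Z) :=
  (associator_inv hX hY hZ).comp (((braiding hX hY).whiskerRight hZ).comp (associator hY hX hZ))

theorem tensorμ {X Y Z W : Word A} (hX : Rightward X) (hY : Rightward Y) (hZ : Rightward Z)
    (hW : Rightward W) : IsBool (tensorμ X Y Z W) :=
  (associator hX hY (hZ.tensor hW)).comp ((whiskerLeft hX (associator_inv hY hZ hW)).comp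
    ((whiskerLeft hX ((braiding hY hZ).whiskerRight hW)).comp
      ((whiskerLeft hX (associator hZ hY hW)).comp (associator_inv hX hZ (hY.tensor hW)))))

theorem del {X : Word A} (hX : Rightward X) : IsBool (del X) := by
  refine hX.induction (P := fun X => IsBool (KleeneDiagram.del X)) (.id rightward_unit) ?_
  intro X _ ih
  rw [del_tensor, del_R]
  exact (del₁.tensor ih).comp (leftUnitor rightward_unit)

theorem gen {X : Word A} (hX : Rightward X) : IsBool (gen X) := by
  refine hX.induction (P := fun X => IsBool (KleeneDiagram.gen X)) (.id rightward_unit) ?_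
  intro X _ ih
  rw [gen_tensor, gen_R]
  exact (leftUnitor_inv rightward_unit).comp (gen₁.tensor ih)

theorem mer {X : Word A} (hX : Rightward X) : IsBool (mer X) := by
  refine hX.induction (P := fun X => IsBool (KleeneDiagram.mer X)) (leftUnitor rightward_unit) ?_
  intro X hX ih
  rw [mer_tensor, mer_R]
  exact (tensorμ rightward_R hX rightward_R hX).comp (mer₁.tensor ih)

theorem fst {X Y : Word A} (hX : Rightward X) (hY : Rightward Y) : IsBool (fst X Y) :=
  (whiskerLeft hX (del hY)).comp (rightUnitor hX)

theorem snd {X Y : Word A} (hX : Rightward X) (hY : Rightward Y) : IsBool (snd X Y) :=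
  ((del hX).whiskerRight hY).comp (leftUnitor hY)

theorem inl {X Y : Word A} (hX : Rightward X) (hY : Rightward Y) : IsBool (inl X Y) :=
  (rightUnitor_inv hX).comp (whiskerLeft hX (gen hY))

theorem inr {X Y : Word A} (hX : Rightward X) (hY : Rightward Y) : IsBool (inr X Y) :=
  (leftUnitor_inv hY).comp ((gen hX).whiskerRight hY)

end IsBool

/-- Since `f` commutes with copying, the projections can be applied after two copies of `f`: the
target splits into columns, and dually the source splits into rows in `IsHom.eq_mer`. -/
theorem IsHom.eq_cop {M X Y : Word A} {f : M ⟶ X ⊗ Y} (hf : IsHom f) (hX : Rightward X)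
    (hY : Rightward Y) : f = KleeneDiagram.cop M ≫ ((f ≫ fst X Y) ⊗ₘ (f ≫ snd X Y)) := by
  rw [← tensorHom_comp_tensorHom, ← reassoc_of% hf.cop, cop_fst_snd hX hY, Category.comp_id]

theorem IsHom.eq_mer {X Y Z : Word A} {f : X ⊗ Y ⟶ Z} (hf : IsHom f) (hX : Rightward X)
    (hY : Rightward Y) : f = ((inl X Y ≫ f) ⊗ₘ (inr X Y ≫ f)) ≫ KleeneDiagram.mer Z := by
  rw [← tensorHom_comp_tensorHom, Category.assoc, ← hf.mer, reassoc_of% inl_inr_mer hX hY]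

/-! ### Bounds on relations -/

theorem mer₁_cop₁_le : mer₁ ≫ cop₁ ≤ 𝟙 ((R : Word A) ⊗ R) := den_ax_le .f1

theorem Rightward.id_le_del_gen {X : Word A} (hX : Rightward X) : 𝟙 X ≤ del X ≫ gen X := by
  refine Rightward.induction (P := fun X => 𝟙 X ≤ del X ≫ gen X) ?_ ?_ hX
  · rw [del_unit, gen_unit, Category.comp_id]
  · intro X _ ih
    rw [del_tensor, gen_tensor, Category.assoc, Iso.hom_inv_id_assoc, tensorHom_comp_tensorHom,
      del_R, gen_R, ← tensor_id_id]
    exact tensor_mono id_le_del₁_gen₁ ih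

/-- The zero matrix is the greatest relation: bound the identity on the target by `del Y ≫ gen Y`,
and discarding absorbs `f`. -/
theorem IsBool.le_del_gen {X Y : Word A} {f : X ⟶ Y} (hf : IsBool f) :
    f ≤ KleeneDiagram.del X ≫ KleeneDiagram.gen Y := by
  rw [← hf.isHom.del, Category.assoc]
  exact (Category.comp_id f).symm.le.trans (comp_mono le_rfl hf.rightward.2.id_le_del_gen)

/-- The merging of all the wires of a word. The value on `◀` plays no role. -/
def merAllL : (X : List Dir) → ((⟨X⟩ : Word A) ⟶ R)
  | [] => gen₁
  | .right :: X => (R : Word A) ◁ merAllL X ≫ mer₁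
  | .left :: X => delD .left ▷ ⟨X⟩ ≫ (λ_ _).hom ≫ merAllL X

/-- The duplication of a wire to all the wires of a word. The value on `◀` plays no role. -/
def copAllL : (X : List Dir) → (R ⟶ (⟨X⟩ : Word A))
  | [] => del₁
  | .right :: X => cop₁ ≫ (R : Word A) ◁ copAllL X
  | .left :: X => copAllL X ≫ (λ_ _).inv ≫ genD .left ▷ ⟨X⟩

/-- The merging of all the wires of an object. -/
def merAll (X : Word A) : X ⟶ R := merAllL X.toList

/-- The duplication of a wire to all the wires of an object. -/
def copAll (X : Word A) : R ⟶ X := copAllL X.toList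

theorem merAll_unit : merAll (𝟙_ (Word A)) = gen₁ := rfl

theorem copAll_unit : copAll (𝟙_ (Word A)) = del₁ := rfl

theorem merAll_R_tensor (X : Word A) : merAll (R ⊗ X) = R ◁ merAll X ≫ mer₁ := rfl

theorem copAll_R_tensor (X : Word A) : copAll (R ⊗ X) = cop₁ ≫ R ◁ copAll X := rfl

theorem merAll_R : merAll (R : Word A) = 𝟙 R :=
  (Category.id_comp _).symm.trans gen_mer₁

theorem copAll_R : copAll (R : Word A) = 𝟙 R := by
  refine Eq.trans ?_ cop₁_del
  exact congrArg (cop₁ ≫ ·) (Category.comp_id _).symm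

theorem merAll_tensor {X : Word A} (hX : Rightward X) (Y : Word A) :
    merAll (X ⊗ Y) = (merAll X ⊗ₘ merAll Y) ≫ mer₁ := by
  refine Rightward.induction (P := fun X => merAll (X ⊗ Y) = (merAll X ⊗ₘ merAll Y) ≫ mer₁)
    ?_ ?_ hX
  · have h : merAll (𝟙_ (Word A) ⊗ Y) = (λ_ Y).hom ≫ merAll Y := (Category.id_comp _).symm
    rw [h, merAll_unit, MonoidalCategory.tensorHom_def', Category.assoc,
      ← cancel_epi (λ_ _).inv]
    have h' := (gen_mer₁' (A := A))
    rw [Iso.inv_hom_id_assoc, ← leftUnitor_inv_naturality_assoc, h', Category.comp_id]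
  · intro X _ ih
    have h : merAll ((R ⊗ X) ⊗ Y) = (α_ _ _ _).hom ≫ merAll (R ⊗ X ⊗ Y) :=
      (Category.id_comp _).symm
    have h' : (α_ (R : Word A) R R).hom ≫ R ◁ mer₁ ≫ mer₁ = mer₁ ▷ R ≫ mer₁ := by
      rw [← mer₁_assoc, Iso.hom_inv_id_assoc]
    rw [h, merAll_R_tensor, merAll_R_tensor, ih, MonoidalCategory.whiskerLeft_comp, Category.assoc,
      ← id_tensorHom R (_ ⊗ₘ _), ← associator_naturality_assoc, h', ← tensorHom_id,
      tensorHom_comp_tensorHom_assoc, id_tensorHom, Category.comp_id]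

theorem copAll_tensor {X : Word A} (hX : Rightward X) (Y : Word A) :
    copAll (X ⊗ Y) = cop₁ ≫ (copAll X ⊗ₘ copAll Y) := by
  refine Rightward.induction (P := fun X => copAll (X ⊗ Y) = cop₁ ≫ (copAll X ⊗ₘ copAll Y))
    ?_ ?_ hX
  · have h : copAll (𝟙_ (Word A) ⊗ Y) = copAll Y ≫ (λ_ Y).inv := (Category.comp_id _).symm
    rw [h, copAll_unit, MonoidalCategory.tensorHom_def, ← cancel_mono (λ_ _).hom]
    simp only [Category.assoc, Iso.inv_hom_id, leftUnitor_naturality]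
    rw [reassoc_of% del_cop₁ (A := A), Category.comp_id]
  · intro X _ ih
    have h : copAll ((R ⊗ X) ⊗ Y) = copAll (R ⊗ X ⊗ Y) ≫ (α_ _ _ _).inv :=
      (Category.comp_id _).symm
    have h' : cop₁ ≫ (R : Word A) ◁ cop₁ ≫ (α_ R R R).inv = cop₁ ≫ cop₁ ▷ R := by
      rw [← reassoc_of% cop₁_assoc (A := A), Iso.hom_inv_id, Category.comp_id]
    rw [h, copAll_R_tensor, copAll_R_tensor, ih, MonoidalCategory.whiskerLeft_comp,
      Category.assoc, Category.assoc, ← id_tensorHom R (_ ⊗ₘ _), associator_inv_naturality,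
      reassoc_of% h', ← tensorHom_id, tensorHom_comp_tensorHom, id_tensorHom, Category.id_comp]

/-- The empty word is the axiom `1 ≤ δ;η`; each further wire only adds a use of `cop₁ ≫ mer₁ = 𝟙`.
-/
theorem Rightward.id_le_copAll_merAll {X : Word A} (hX : Rightward X) :
    𝟙 R ≤ copAll X ≫ merAll X := by
  refine Rightward.induction (P := fun X => 𝟙 R ≤ copAll X ≫ merAll X) id_le_del₁_gen₁ ?_ hX
  intro X _ ih
  rw [merAll_R_tensor, copAll_R_tensor, Category.assoc, ← whiskerLeft_comp_assoc, ← cop₁_mer₁]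
  refine comp_mono le_rfl ?_
  conv_lhs => rw [← Category.id_comp mer₁, ← MonoidalCategory.whiskerLeft_id]
  exact comp_mono (whiskerLeft_mono _ ih) le_rfl

theorem Rightward.merAll_copAll_le {X : Word A} (hX : Rightward X) :
    merAll X ≫ copAll X ≤ 𝟙 X := by
  refine Rightward.induction (P := fun X => merAll X ≫ copAll X ≤ 𝟙 X) gen₁_del₁.le ?_ hX
  intro X _ ih
  rw [merAll_R_tensor, copAll_R_tensor, Category.assoc]
  calc R ◁ merAll X ≫ mer₁ ≫ cop₁ ≫ R ◁ copAll X
      ≤ R ◁ merAll X ≫ 𝟙 _ ≫ R ◁ copAll X := by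
        rw [← Category.assoc mer₁]
        exact comp_mono le_rfl (comp_mono mer₁_cop₁_le le_rfl)
    _ = R ◁ (merAll X ≫ copAll X) := by rw [Category.id_comp, MonoidalCategory.whiskerLeft_comp]
    _ ≤ 𝟙 _ := by
        rw [← MonoidalCategory.whiskerLeft_id]
        exact whiskerLeft_mono _ ih

/-- The matrix of ones is the least relation. For a composite, a passage through the intermediate
word is inserted by `id_le_copAll_merAll`; for a product, the wire joining the two factors is cut by
`∇;Δ ≤ 1⊕1`. -/
theorem merAll_comp_copAll_le {X Y : Word A} {f : X ⟶ Y} (hf : IsBool f) :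
    merAll X ≫ copAll Y ≤ f := by
  induction hf with
  | cop₁ =>
    rw [merAll_R, Category.id_comp, copAll_tensor rightward_R, copAll_R, tensor_id_id,
      Category.comp_id]
  | del₁ => rw [merAll_R, Category.id_comp, copAll_unit]
  | mer₁ =>
    rw [copAll_R, Category.comp_id, merAll_tensor rightward_R, merAll_R, tensor_id_id,
      Category.id_comp]
  | gen₁ => rw [copAll_R, Category.comp_id, merAll_unit]
  | id h => exact h.merAll_copAll_le
  | @braiding X Y hX hY =>
    calc merAll (X ⊗ Y) ≫ copAll (Y ⊗ X)
        = (β_ X Y).hom ≫ merAll (Y ⊗ X) ≫ copAll (Y ⊗ X) := by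
          rw [merAll_tensor hX, merAll_tensor hY, Category.assoc, Category.assoc,
            ← BraidedCategory.braiding_naturality_assoc, reassoc_of% mer₁_comm (A := A)]
      _ ≤ (β_ X Y).hom ≫ 𝟙 _ := comp_mono le_rfl (hY.tensor hX).merAll_copAll_le
      _ = _ := Category.comp_id _
  | @comp X Y Z f g hf hg ihf ihg =>
    calc merAll X ≫ copAll Z = merAll X ≫ 𝟙 R ≫ copAll Z := by rw [Category.id_comp]
      _ ≤ merAll X ≫ (copAll Y ≫ merAll Y) ≫ copAll Z :=
          comp_mono le_rfl (comp_mono hf.rightward.2.id_le_copAll_merAll le_rfl)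
      _ = (merAll X ≫ copAll Y) ≫ merAll Y ≫ copAll Z := by simp only [Category.assoc]
      _ ≤ f ≫ g := comp_mono ihf ihg
  | @tensor X Y X' Y' f g hf hg ihf ihg =>
    calc merAll (X ⊗ X') ≫ copAll (Y ⊗ Y')
        = (merAll X ⊗ₘ merAll X') ≫ (mer₁ ≫ cop₁) ≫ (copAll Y ⊗ₘ copAll Y') := by
          rw [merAll_tensor hf.rightward.1, copAll_tensor hf.rightward.2]
          simp only [Category.assoc]
      _ ≤ (merAll X ⊗ₘ merAll X') ≫ 𝟙 _ ≫ (copAll Y ⊗ₘ copAll Y') :=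
          comp_mono le_rfl (comp_mono mer₁_cop₁_le le_rfl)
      _ = (merAll X ≫ copAll Y) ⊗ₘ (merAll X' ≫ copAll Y') := by
          rw [Category.id_comp, tensorHom_comp_tensorHom]
      _ ≤ f ⊗ₘ g := tensor_mono ihf ihg

end KleeneDiagram

namespace KleeneDiagram

open CategoryTheory MonoidalCategory

/-! ### Traces of relations -/

section

variable {C : Type*} [Category* C] [MonoidalCategory C] [SymmetricCategory C]

/-- The matrix with rows `(x, 1)` and `(1, 0)`. -/
def twist {X : C} (c : X ⟶ X ⊗ X) (m : X ⊗ X ⟶ X) (x : X ⟶ X) : X ⊗ X ⟶ X ⊗ X :=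
  c ▷ X ≫ (α_ X X X).hom ≫ (x ⊗ₘ (β_ X X).hom) ≫ (α_ X X X).inv ≫ m ▷ X

/-- The second output of `twist` is an untouched copy of the first input. The block `z` can thus be
applied after the twist, outside any loop on the first wire. -/
theorem twist_eq {X N : C} (c : X ⟶ X ⊗ X) (m : X ⊗ X ⟶ X) (x : X ⟶ X) (z : X ⟶ N)
    (m' : N ⊗ N ⟶ N) :
    (c ≫ (x ⊗ₘ z)) ▷ (X ⊗ N) ≫ tensorμ X N X N ≫ (m ⊗ₘ m') =
      (α_ X X N).inv ≫ twist c m x ▷ N ≫ (α_ X X N).hom ≫ X ◁ (z ▷ N ≫ m') := by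
  have h : X ◁ z ▷ X ▷ N ≫ X ◁ (β_ N X).hom ▷ N = X ◁ (β_ X X).hom ▷ N ≫ X ◁ (X ◁ z) ▷ N := by
    rw [← MonoidalCategory.whiskerLeft_comp, ← comp_whiskerRight,
      BraidedCategory.braiding_naturality_left]
    simp
  have e₁ : (c ≫ (x ⊗ₘ z)) ▷ (X ⊗ N) ≫ tensorμ X N X N ≫ (m ⊗ₘ m') =
      (c ≫ x ▷ X) ▷ (X ⊗ N) ≫ (α_ X X (X ⊗ N)).hom ≫ X ◁ (α_ X X N).inv ≫
        (X ◁ z ▷ X ▷ N ≫ X ◁ (β_ N X).hom ▷ N) ≫ X ◁ (α_ X N N).hom ≫ (α_ X X (N ⊗ N)).inv ≫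
          (m ⊗ₘ m') := by
    simp only [tensorμ, MonoidalCategory.tensorHom_def]
    monoidal
  have h' : X ◁ (X ◁ z) ▷ N ≫ X ◁ (α_ X N N).hom ≫ (α_ X X (N ⊗ N)).inv ≫ (m ⊗ₘ m') =
      X ◁ (α_ X X N).hom ≫ (α_ X X (X ⊗ N)).inv ≫ m ▷ (X ⊗ N) ≫ X ◁ (z ▷ N ≫ m') := by
    have e := whisker_exchange m (z ▷ N)
    rw [MonoidalCategory.tensorHom_def, MonoidalCategory.whiskerLeft_comp, ← reassoc_of% e]
    monoidal
  rw [e₁, h, Category.assoc (X ◁ (β_ X X).hom ▷ N), h', twist]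
  simp only [MonoidalCategory.tensorHom_def]
  monoidal

/-- With zero in the corner, the matrix is the crossing. -/
theorem twist_comp {X : C} {c : X ⟶ X ⊗ X} {m : X ⊗ X ⟶ X} {d : X ⟶ 𝟙_ C} {e : 𝟙_ C ⟶ X}
    (hd : c ≫ d ▷ X ≫ (λ_ X).hom = 𝟙 X) (he : (λ_ X).inv ≫ e ▷ X ≫ m = 𝟙 X) :
    twist c m (d ≫ e) = (β_ X X).hom := by
  have h : twist c m (d ≫ e) = (c ≫ d ▷ X ≫ (λ_ X).hom) ▷ X ≫ (β_ X X).hom ≫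
      ((λ_ X).inv ≫ e ▷ X ≫ m) ▷ X := by
    rw [twist, ← Category.comp_id (β_ X X).hom, ← tensorHom_comp_tensorHom]
    simp only [MonoidalCategory.tensorHom_def]
    monoidal
  rw [h, hd, he]
  simp

end

variable {A : Type u}

theorem tr_mono {M N : Word A} {f g : R ⊗ M ⟶ R ⊗ N} (h : f ≤ g) :
    tr cup cap f ≤ tr cup cap g :=
  comp_mono le_rfl (comp_mono (whiskerLeft_mono _ h) le_rfl)

theorem twist_mono {f g : (R : Word A) ⟶ R} (h : f ≤ g) :
    twist cop₁ mer₁ f ≤ twist cop₁ mer₁ g :=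
  comp_mono le_rfl (comp_mono le_rfl (comp_mono (tensor_mono h le_rfl) le_rfl))

/-- The matrix `f` is split into rows by `IsHom.eq_mer` and the row of the first wire into columns
by `IsHom.eq_cop`; the merging is then absorbed by `twist_eq`. -/
theorem eq_twist {M N : Word A} {f : R ⊗ M ⟶ R ⊗ N} (hf : IsBool f) :
    f = R ◁ (inr R M ≫ f) ≫ (α_ R R N).inv ≫
      twist cop₁ mer₁ (inl R M ≫ f ≫ fst R N) ▷ N ≫
        (α_ R R N).hom ≫
          R ◁ ((inl R M ≫ f ≫ snd R N) ▷ N ≫ mer N) := by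
  have hM := hf.rightward.1.right
  have hN := hf.rightward.2.right
  have h := hf.isHom.eq_mer rightward_R hM
  have h' := ((IsBool.inl rightward_R hM).comp hf).isHom.eq_cop rightward_R hN
  rw [h', MonoidalCategory.tensorHom_def', mer_tensor, mer_R, cop_R, Category.assoc, twist_eq,
    Category.assoc, Category.assoc] at h
  exact h

/-- All factors of `eq_twist` other than the twist leave the first wire alone, hence slide out of
the loop. Only the corner `R ⟶ R` remains inside. -/
theorem tr_eq_twist {M N : Word A} {f : R ⊗ M ⟶ R ⊗ N} (hf : IsBool f) :
    tr cup cap f = (inr R M ≫ f) ≫ tr cup cap (twist cop₁ mer₁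
      (inl R M ≫ f ≫ fst R N)) ▷ N ≫
        (inl R M ≫ f ≫ snd R N) ▷ N ≫ mer N := by
  rw [tr_whiskerRight, tr_comp, comp_tr]
  conv_lhs => rw [eq_twist hf]
  simp only [Category.assoc]

theorem inl_comp_mer₁ : inl R R ≫ mer₁ = 𝟙 (R : Word A) := by
  rw [inl, gen_R, Category.assoc, gen_mer₁]

theorem inr_comp_mer₁ : inr R R ≫ mer₁ = 𝟙 (R : Word A) := by
  rw [inr, gen_R, Category.assoc, gen_mer₁']

theorem cop₁_fst : cop₁ ≫ fst R R = 𝟙 (R : Word A) := by rw [fst, del_R, cop₁_del]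

theorem cop₁_snd : cop₁ ≫ snd R R = 𝟙 (R : Word A) := by rw [snd, del_R, del_cop₁]

theorem add_zero (t : (R : Word A) ⟶ R) : cop₁ ≫ (t ⊗ₘ (del₁ ≫ gen₁)) ≫ mer₁ = t := by
  have h : cop₁ ≫ (t ⊗ₘ (del₁ ≫ gen₁)) ≫ mer₁ =
      (cop₁ ≫ R ◁ del₁ ≫ (ρ_ R).hom) ≫ t ≫ (ρ_ R).inv ≫ R ◁ gen₁ ≫ mer₁ := by
    rw [← Category.id_comp t, ← tensorHom_comp_tensorHom, Category.id_comp]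
    simp only [MonoidalCategory.tensorHom_def]
    monoidal
  rw [h, cop₁_del, gen_mer₁, Category.id_comp, Category.comp_id]

theorem zero_add (t : (R : Word A) ⟶ R) : cop₁ ≫ ((del₁ ≫ gen₁) ⊗ₘ t) ≫ mer₁ = t := by
  rw [← cop₁_comm, Category.assoc, ← BraidedCategory.braiding_naturality_assoc, mer₁_comm,
    add_zero]

/-- The summand `1` lies below `del₁ ≫ gen₁`, which is neutral for the sum. -/
theorem add_one_le (t : (R : Word A) ⟶ R) : cop₁ ≫ t ▷ R ≫ mer₁ ≤ t := by
  conv_rhs => rw [← add_zero t]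
  rw [← tensorHom_id]
  exact comp_mono le_rfl (comp_mono (tensor_mono le_rfl id_le_del₁_gen₁) le_rfl)

/-- This is `x* = 1`. The relation `x` lies between `𝟙 R`, the least relation on one wire, and `del₁
≫ gen₁`, the greatest; the loop is monotone and its values at both ends enclose `𝟙 R`. -/
theorem tr_twist {x : (R : Word A) ⟶ R} (hx : IsBool x) :
    tr cup cap (twist cop₁ mer₁ x) = 𝟙 R := by
  apply le_antisymm
  · calc tr cup cap (twist cop₁ mer₁ x) ≤ tr cup cap (twist cop₁ mer₁ (del₁ ≫ gen₁)) := by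
          have h := hx.le_del_gen
          rw [del_R, gen_R] at h
          exact tr_mono (twist_mono h)
      _ = 𝟙 R := by rw [twist_comp del_cop₁ gen_mer₁', zigzag.tr_braiding]
  -- Decomposing the axiom's loop by `tr_eq_twist` gives the sum of the loop at `𝟙 R` and `1`.
  · calc 𝟙 (R : Word A) = tr cup cap (mer₁ ≫ cop₁) := tr_mer₁_cop₁.symm
      _ = cop₁ ≫ tr cup cap (twist cop₁ mer₁ (𝟙 R)) ▷ R ≫ mer₁ := by
          rw [tr_eq_twist (IsBool.mer₁.comp IsBool.cop₁), mer_R]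
          simp only [Category.assoc]
          rw [reassoc_of% inr_comp_mer₁ (A := A),
            reassoc_of% inl_comp_mer₁ (A := A), cop₁_fst, cop₁_snd, Category.comp_id,
            inl_comp_mer₁, id_whiskerRight, Category.id_comp]
      _ ≤ tr cup cap (twist cop₁ mer₁ (𝟙 R)) := add_one_le _
      _ ≤ tr cup cap (twist cop₁ mer₁ x) := by
          have h := merAll_comp_copAll_le hx
          rw [merAll_R, copAll_R, Category.comp_id] at h
          exact tr_mono (twist_mono h)

/-- Since the star in `tr_eq_twist` is the identity, what is left is a composite of relations, the
matrix `v + u z` of the blocks. -/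
theorem IsBool.tr {M N : Word A} {f : R ⊗ M ⟶ R ⊗ N} (hf : IsBool f) :
    IsBool (KleeneDiagram.tr cup cap f) := by
  have hM := hf.rightward.1.right
  have hN := hf.rightward.2.right
  have h₁ := IsBool.inl rightward_R hM
  rw [tr_eq_twist hf, tr_twist (h₁.comp (hf.comp (.fst rightward_R hN))), id_whiskerRight,
    Category.id_comp]
  exact ((IsBool.inr rightward_R hM).comp hf).comp
    (((h₁.comp (hf.comp (.snd rightward_R hN))).whiskerRight hN).comp (.mer hN))

end KleeneDiagram

namespace KleeneDiagram

open CategoryTheory MonoidalCategory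

/-! ### Moving one wire across a product of words. -/

section

variable {C : Type*} [Category* C] [MonoidalCategory C] [SymmetricCategory C]

theorem sw_tensor_mid_comp (D E X : C) {V W : C} (s : D ⊗ V ⟶ W) :
    sw D (E ⊗ X) V ≫ (E ⊗ X) ◁ s = D ◁ (α_ E X V).hom ≫ sw D E (X ⊗ V) ≫
      E ◁ (sw D X V ≫ X ◁ s) ≫ (α_ E X W).inv := by
  rw [sw_tensor_mid]
  simp

theorem sw_comp_whiskerRight (D E : C) {V W : C} (s : D ⊗ V ⟶ W) (Y : C) :
    (α_ D (E ⊗ V) Y).inv ≫ (sw D E V ≫ E ◁ s) ▷ Y = D ◁ (α_ E V Y).hom ≫ sw D E (V ⊗ Y) ≫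
      E ◁ ((α_ D V Y).inv ≫ s ▷ Y) ≫ (α_ E W Y).inv := by
  rw [sw_tensor_right]
  monoidal

end

variable {A : Type u}

/-! ### Relations with feedback through letters -/

/-- Diagrams obtained from relations by feeding back wires through letters. -/
inductive Rep : {X Y : Word A} → (X ⟶ Y) → Prop
  | bool {X Y : Word A} {f : X ⟶ Y} : IsBool f → Rep f
  | loop (a : A) {X Y : Word A} {r : R ⊗ X ⟶ R ⊗ Y} :
      Rep r → Rep (tr cup cap (r ≫ ltr a ▷ Y))

namespace Rep

theorem rightward {X Y : Word A} {r : X ⟶ Y} (hr : Rep r) : Rightward X ∧ Rightward Y := by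
  induction hr with
  | bool h => exact h.rightward
  | loop a _ ih => exact ⟨ih.1.right, ih.2.right⟩

theorem bool_comp {X Y : Word A} {r : X ⟶ Y} (hr : Rep r) {W : Word A} {f : W ⟶ X}
    (hf : IsBool f) : Rep (f ≫ r) := by
  induction hr generalizing W with
  | bool h => exact bool (hf.comp h)
  | loop a _ ih =>
    rw [comp_tr, ← Category.assoc]
    exact loop a (ih (hf.whiskerLeft rightward_R))

theorem comp_bool {X Y : Word A} {r : X ⟶ Y} (hr : Rep r) {Z : Word A} {g : Y ⟶ Z}
    (hg : IsBool g) : Rep (r ≫ g) := by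
  induction hr generalizing Z with
  | bool h => exact bool (h.comp hg)
  | loop a _ ih =>
    rw [tr_comp, Category.assoc, ← whisker_exchange, ← Category.assoc]
    exact loop a (ih (hg.whiskerLeft rightward_R))

theorem whiskerLeft {X Y : Word A} {r : X ⟶ Y} (hr : Rep r) {Z : Word A} (hZ : Rightward Z) :
    Rep (Z ◁ r) := by
  induction hr with
  | bool h => exact bool (h.whiskerLeft hZ)
  | @loop a X Y r hr ih =>
    rw [whiskerLeft_tr, MonoidalCategory.whiskerLeft_comp, Category.assoc, sw_natural_mid,
      ← Category.assoc, ← Category.assoc]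
    exact loop a ((ih.bool_comp (.sw rightward_R hZ hr.rightward.1.right)).comp_bool
      (.sw hZ rightward_R hr.rightward.2.right))

/-- Exchanging loops moves a loop without letter inside all the loops with letters, down to the
underlying relation, where `IsBool.tr` removes it. The relations `σ` and `π` are there to absorb the
crossings that each exchange creates. -/
theorem tr_comp_comp {X Y : Word A} {r : X ⟶ Y} (hr : Rep r) {M N : Word A} {σ : R ⊗ M ⟶ X}
    {π : Y ⟶ R ⊗ N} (hσ : IsBool σ) (hπ : IsBool π) : Rep (tr cup cap (σ ≫ r ≫ π)) := by
  induction hr generalizing M N with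
  | bool h => exact bool (hσ.comp (h.comp hπ)).tr
  | @loop a X Y r hr ih =>
    have h : sw R R M ≫ (R ◁ σ ≫ (r ≫ ltr a ▷ Y) ≫ R ◁ π) ≫ sw R R N =
        ((sw R R M ≫ R ◁ σ) ≫ r ≫ R ◁ π ≫ sw R R N) ≫ R ◁ ltr a ▷ N := by
      simp only [Category.assoc]
      rw [← sw_natural_left, whisker_exchange_assoc]
    rw [tr_comp, comp_tr, tr_tr, h, ← tr_comp]
    exact loop a (ih ((IsBool.sw rightward_R rightward_R hσ.rightward.1.right).comp
      (hσ.whiskerLeft rightward_R)) ((hπ.whiskerLeft rightward_R).comp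
        (.sw rightward_R rightward_R hπ.rightward.2.right)))

/-- By yanking, the wire that carries the letter is replaced by a loop through a crossing, and the
letter sits on that loop. -/
theorem comp_ltr {X Y : Word A} {r : X ⟶ R ⊗ Y} (hr : Rep r) (a : A) : Rep (r ≫ ltr a ▷ Y) := by
  have h : r ≫ ltr a ▷ Y = tr cup cap ((R ◁ r ≫ sw R R Y) ≫ ltr a ▷ (R ⊗ Y)) := by
    have h' : tr cup cap (sw R R Y) = 𝟙 (R ⊗ Y) := by
      rw [sw, ← tr_whiskerRight, zigzag.tr_braiding, id_whiskerRight]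
    rw [Category.assoc, ← sw_natural_mid, ← comp_tr, ← comp_tr, h', Category.comp_id]
  rw [h]
  exact loop a ((hr.whiskerLeft rightward_R).comp_bool
    (.sw rightward_R rightward_R hr.rightward.2.right))

end Rep

/-! ### Permutations -/

/-- The permutations of wires. -/
inductive IsPerm : {X Y : Word A} → (X ⟶ Y) → Prop
  | id (X : Word A) : IsPerm (𝟙 X)
  | braiding (X Y : Word A) : IsPerm (β_ X Y).hom
  | comp {X Y Z : Word A} {f : X ⟶ Y} {g : Y ⟶ Z} : IsPerm f → IsPerm g → IsPerm (f ≫ g)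
  | tensor {X Y X' Y' : Word A} {f : X ⟶ Y} {g : X' ⟶ Y'} :
      IsPerm f → IsPerm g → IsPerm (f ⊗ₘ g)

namespace IsPerm

theorem mem_iff {X Y : Word A} {f : X ⟶ Y} (hf : IsPerm f) (d : Dir) :
    d ∈ X.toList ↔ d ∈ Y.toList := by
  induction hf with
  | id => rfl
  | braiding X Y =>
    change d ∈ X.toList ++ Y.toList ↔ d ∈ Y.toList ++ X.toList
    rw [List.mem_append, List.mem_append, or_comm]
  | comp _ _ ih ih' => exact ih.trans ih'
  | @tensor X Y X' Y' _ _ _ _ ih ih' =>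
    change d ∈ X.toList ++ X'.toList ↔ d ∈ Y.toList ++ Y'.toList
    rw [List.mem_append, List.mem_append, ih, ih']

theorem rightward_iff {X Y : Word A} {f : X ⟶ Y} (hf : IsPerm f) : Rightward X ↔ Rightward Y :=
  ⟨fun h d hd => h d ((hf.mem_iff d).2 hd), fun h d hd => h d ((hf.mem_iff d).1 hd)⟩

theorem isBool {X Y : Word A} {f : X ⟶ Y} (hf : IsPerm f) (hX : Rightward X) : IsBool f := by
  induction hf with
  | id => exact .id hX
  | braiding => exact .braiding hX.left hX.right
  | comp h _ ih ih' => exact (ih hX).comp (ih' (h.rightward_iff.1 hX))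
  | tensor _ _ ih ih' => exact (ih hX.left).tensor (ih' hX.right)

theorem eqToHom {X Y : Word A} (h : X = Y) : IsPerm (eqToHom h) := by
  subst h
  exact .id _

theorem associator (X Y Z : Word A) : IsPerm (α_ X Y Z).hom :=
  eqToHom (congrArg Word.ofList (List.append_assoc _ _ _))

theorem associator_inv (X Y Z : Word A) : IsPerm (α_ X Y Z).inv :=
  eqToHom (congrArg Word.ofList (List.append_assoc _ _ _).symm)

theorem leftUnitor (X : Word A) : IsPerm (λ_ X).hom := .id _

theorem leftUnitor_inv (X : Word A) : IsPerm (λ_ X).inv := .id _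

theorem whiskerLeft (X : Word A) {Y Z : Word A} {f : Y ⟶ Z} (hf : IsPerm f) : IsPerm (X ◁ f) :=
  .tensor (.id X) hf

theorem whiskerRight {Y Z : Word A} {f : Y ⟶ Z} (hf : IsPerm f) (X : Word A) : IsPerm (f ▷ X) :=
  .tensor hf (.id X)

theorem sw (X Y Z : Word A) : IsPerm (sw X Y Z) :=
  (associator_inv X Y Z).comp (((braiding X Y).whiskerRight Z).comp (associator Y X Z))

end IsPerm

/-- Moves the first letter of a word to some other place. -/
inductive IsIns (d : Dir) : (V W : List Dir) → ((⟨[d]⟩ : Word A) ⊗ ⟨V⟩ ⟶ ⟨W⟩) → Prop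
  | here (V : List Dir) : IsIns d V (d :: V) (𝟙 ((⟨[d]⟩ : Word A) ⊗ ⟨V⟩))
  | there (d' : Dir) {V W : List Dir} {s : (⟨[d]⟩ : Word A) ⊗ ⟨V⟩ ⟶ ⟨W⟩} : IsIns d V W s →
      IsIns d (d' :: V) (d' :: W) (sw (⟨[d]⟩ : Word A) ⟨[d']⟩ ⟨V⟩ ≫ (⟨[d']⟩ : Word A) ◁ s)

namespace IsIns

variable {d : Dir}

theorem mem {V W : List Dir} {s : (⟨[d]⟩ : Word A) ⊗ ⟨V⟩ ⟶ ⟨W⟩} (hs : IsIns d V W s) :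
    d ∈ W := by
  induction hs with
  | here => exact List.mem_cons_self
  | there _ _ ih => exact List.mem_cons_of_mem _ ih

theorem isPerm {V W : List Dir} {s : (⟨[d]⟩ : Word A) ⊗ ⟨V⟩ ⟶ ⟨W⟩} (hs : IsIns d V W s) :
    IsPerm s := by
  induction hs with
  | here => exact .id _
  | there _ _ ih => exact (IsPerm.sw _ _ _).comp (ih.whiskerLeft _)

theorem whiskerLeft (X : Word A) {V W : List Dir} {s : (⟨[d]⟩ : Word A) ⊗ ⟨V⟩ ⟶ ⟨W⟩}
    (hs : IsIns d V W s) :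
    IsIns d (X.toList ++ V) (X.toList ++ W) (sw ⟨[d]⟩ X ⟨V⟩ ≫ X ◁ s) := by
  obtain ⟨X⟩ := X
  induction X with
  | nil =>
    have h : sw ⟨[d]⟩ (𝟙_ (Word A)) ⟨V⟩ ≫ (𝟙_ (Word A)) ◁ s = s := by
      rw [sw_unit_mid, Category.assoc, ← leftUnitor_inv_naturality]
      exact (congrArg₂ (· ≫ ·) (whiskerLeft_id _ _) (Category.comp_id s)).trans
        (Category.id_comp s)
    exact h.symm ▸ hs
  | cons d' X ih =>
    have h := there d' ih
    have e := sw_tensor_mid_comp (⟨[d]⟩ : Word A) ⟨[d']⟩ ⟨X⟩ s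
    have e' : sw (⟨[d]⟩ : Word A) (⟨[d']⟩ ⊗ ⟨X⟩) ⟨V⟩ ≫ (⟨[d']⟩ ⊗ ⟨X⟩ : Word A) ◁ s =
        sw (⟨[d]⟩ : Word A) ⟨[d']⟩ (⟨X⟩ ⊗ ⟨V⟩) ≫
          (⟨[d']⟩ : Word A) ◁ (sw (⟨[d]⟩ : Word A) ⟨X⟩ ⟨V⟩ ≫ (⟨X⟩ : Word A) ◁ s) := by
      refine e.trans ?_
      refine (congrArg (· ≫ _) (whiskerLeft_id _ _)).trans ((Category.id_comp _).trans ?_)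
      exact congrArg (_ ≫ ·) (Category.comp_id _)
    exact e'.symm ▸ h

theorem whiskerRight {V W : List Dir} {s : (⟨[d]⟩ : Word A) ⊗ ⟨V⟩ ⟶ ⟨W⟩}
    (hs : IsIns d V W s) (Y : Word A) :
    IsIns d (V ++ Y.toList) (W ++ Y.toList) ((α_ (⟨[d]⟩ : Word A) ⟨V⟩ Y).inv ≫ s ▷ Y) := by
  induction hs with
  | here V =>
    have h : (α_ (⟨[d]⟩ : Word A) ⟨V⟩ Y).inv ≫ 𝟙 (⟨[d]⟩ ⊗ ⟨V⟩ : Word A) ▷ Y = 𝟙 _ := by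
      rw [id_whiskerRight]
      exact Category.comp_id _
    exact h.symm ▸ here (V ++ Y.toList)
  | @there d' V W s hs ih =>
    have h := there d' ih
    have e := sw_comp_whiskerRight (⟨[d]⟩ : Word A) ⟨[d']⟩ s Y
    have e' : (α_ (⟨[d]⟩ : Word A) (⟨[d']⟩ ⊗ ⟨V⟩) Y).inv ≫
        (sw (⟨[d]⟩ : Word A) ⟨[d']⟩ ⟨V⟩ ≫ (⟨[d']⟩ : Word A) ◁ s) ▷ Y =
          sw (⟨[d]⟩ : Word A) ⟨[d']⟩ (⟨V⟩ ⊗ Y) ≫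
            (⟨[d']⟩ : Word A) ◁ ((α_ (⟨[d]⟩ : Word A) ⟨V⟩ Y).inv ≫ s ▷ Y) := by
      refine e.trans ?_
      refine (congrArg (· ≫ _) (whiskerLeft_id _ _)).trans ((Category.id_comp _).trans ?_)
      exact congrArg (_ ≫ ·) (Category.comp_id _)
    exact e'.symm ▸ h

end IsIns

end KleeneDiagram

namespace KleeneDiagram

open CategoryTheory MonoidalCategory

/-! ### Tracking a single wire through a permutation. -/

section

variable {C : Type*} [Category* C] [MonoidalCategory C] [SymmetricCategory C]

theorem braiding_tensor_left_eq (D X Y : C) :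
    (β_ (D ⊗ X) Y).hom = (α_ D X Y).hom ≫ D ◁ (β_ X Y).hom ≫ sw D Y X := by
  rw [BraidedCategory.braiding_tensor_left_hom, sw]

theorem sw_comp_braiding (D X Y : C) :
    sw D X Y ≫ (β_ X (D ⊗ Y)).hom = D ◁ (β_ X Y).hom ≫ (α_ D Y X).inv := by
  rw [← cancel_mono (β_ (D ⊗ Y) X).hom, Category.assoc, SymmetricCategory.symmetry,
    braiding_tensor_left_eq, Category.assoc, Iso.inv_hom_id_assoc,
    ← MonoidalCategory.whiskerLeft_comp_assoc, SymmetricCategory.symmetry]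
  simp

end

variable {A : Type u} {d : Dir}

/-- The two ways for a letter to enter a product of two words. -/
theorem IsIns.split (X Y : Word A) {V : List Dir}
    {s : (⟨[d]⟩ : Word A) ⊗ ⟨V⟩ ⟶ ⟨X.toList ++ Y.toList⟩}
    (hs : IsIns d V (X.toList ++ Y.toList) s) :
    (∃ (V' : List Dir) (q : (⟨V⟩ : Word A) ⟶ ⟨V'⟩ ⊗ Y) (t : (⟨[d]⟩ : Word A) ⊗ ⟨V'⟩ ⟶ X),
      IsPerm q ∧ IsIns d V' X.toList t ∧
        s = (⟨[d]⟩ : Word A) ◁ q ≫ (α_ (⟨[d]⟩ : Word A) ⟨V'⟩ Y).inv ≫ t ▷ Y) ∨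
    ∃ (V' : List Dir) (q : (⟨V⟩ : Word A) ⟶ X ⊗ ⟨V'⟩) (t : (⟨[d]⟩ : Word A) ⊗ ⟨V'⟩ ⟶ Y),
      IsPerm q ∧ IsIns d V' Y.toList t ∧
        s = (⟨[d]⟩ : Word A) ◁ q ≫ sw (⟨[d]⟩ : Word A) X ⟨V'⟩ ≫ X ◁ t := by
  obtain ⟨X⟩ := X
  induction X generalizing V with
  | nil =>
    refine Or.inr ⟨V, (λ_ _).inv, s, .leftUnitor_inv _, hs, ?_⟩
    have h : (⟨[d]⟩ : Word A) ◁ (λ_ (⟨V⟩ : Word A)).inv ≫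
        sw (⟨[d]⟩ : Word A) (𝟙_ (Word A)) ⟨V⟩ ≫ (𝟙_ (Word A)) ◁ s = s ≫ (λ_ _).inv := by
      rw [sw_unit_mid, Category.assoc, ← leftUnitor_inv_naturality,
        whiskerLeft_inv_hom_assoc]
    exact ((h.trans (Category.comp_id _))).symm
  | cons d' X ih =>
    cases hs with
    | here =>
      refine Or.inl ⟨X, 𝟙 _, 𝟙 _, .id _, .here X, ?_⟩
      rw [MonoidalCategory.whiskerLeft_id, Category.id_comp, id_whiskerRight, Category.comp_id]
      rfl
    | @there _ V W s hs =>
      rcases ih hs with ⟨V', q, t, hq, ht, rfl⟩ | ⟨V', q, t, hq, ht, rfl⟩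
      · refine Or.inl ⟨d' :: V', (⟨[d']⟩ : Word A) ◁ q, _, hq.whiskerLeft _, ht.there d', ?_⟩
        have e := sw_comp_whiskerRight (⟨[d]⟩ : Word A) ⟨[d']⟩ t Y
        rw [MonoidalCategory.whiskerLeft_comp, ← sw_natural_right_assoc]
        refine congrArg (_ ≫ ·) (Eq.symm (e.trans ?_))
        refine (congrArg (· ≫ _) (whiskerLeft_id _ _)).trans ((Category.id_comp _).trans ?_)
        exact congrArg (_ ≫ ·) (Category.comp_id _)
      · refine Or.inr ⟨V', (⟨[d']⟩ : Word A) ◁ q, t, hq.whiskerLeft _, ht, ?_⟩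
        have e := sw_tensor_mid_comp (⟨[d]⟩ : Word A) ⟨[d']⟩ ⟨X⟩ t
        rw [MonoidalCategory.whiskerLeft_comp, ← sw_natural_right_assoc]
        refine congrArg (_ ≫ ·) (Eq.symm (e.trans ?_))
        refine (congrArg (· ≫ _) (whiskerLeft_id _ _)).trans ((Category.id_comp _).trans ?_)
        exact congrArg (_ ≫ ·) (Category.comp_id _)

/-- Following the first wire through a permutation. -/
theorem IsPerm.track {V W : Word A} {p : V ⟶ W} (hp : IsPerm p) {V' : List Dir}
    {s : (⟨[d]⟩ : Word A) ⊗ ⟨V'⟩ ⟶ V} (hs : IsIns d V' V.toList s) :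
    ∃ (W' : List Dir) (q : (⟨V'⟩ : Word A) ⟶ ⟨W'⟩) (t : (⟨[d]⟩ : Word A) ⊗ ⟨W'⟩ ⟶ W),
      IsPerm q ∧ IsIns d W' W.toList t ∧ s ≫ p = (⟨[d]⟩ : Word A) ◁ q ≫ t := by
  induction hp generalizing V' with
  | id X => exact ⟨V', 𝟙 _, s, .id _, hs, by simp⟩
  | braiding X Y =>
    rcases hs.split X Y with ⟨V', q, t, hq, ht, rfl⟩ | ⟨V', q, t, hq, ht, rfl⟩
    · refine ⟨_, q ≫ (β_ _ _).hom, _, hq.comp (.braiding _ _), ht.whiskerLeft Y, ?_⟩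
      rw [Category.assoc, Category.assoc, BraidedCategory.braiding_naturality_left,
        braiding_tensor_left_eq]
      simp
    · refine ⟨_, q ≫ (β_ _ _).hom, _, hq.comp (.braiding _ _), ht.whiskerRight X, ?_⟩
      rw [Category.assoc, Category.assoc, BraidedCategory.braiding_naturality_right,
        reassoc_of% sw_comp_braiding (⟨[d]⟩ : Word A)]
      simp
  | comp hf hg ih ih' =>
    obtain ⟨W', q, t, hq, ht, h⟩ := ih hs
    obtain ⟨W'', q', t', hq', ht', h'⟩ := ih' ht
    refine ⟨W'', q ≫ q', t', hq.comp hq', ht', ?_⟩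
    rw [reassoc_of% h, h', MonoidalCategory.whiskerLeft_comp, Category.assoc]
  | @tensor X X₁ Y Y₁ f g hf hg ih ih' =>
    rcases hs.split X Y with ⟨V', q, t, hq, ht, rfl⟩ | ⟨V', q, t, hq, ht, rfl⟩
    · obtain ⟨W', q', t', hq', ht', h⟩ := ih ht
      refine ⟨_, q ≫ (q' ⊗ₘ g), _, hq.comp (hq'.tensor hg), ht'.whiskerRight _, ?_⟩
      have e : t ▷ Y ≫ (f ⊗ₘ g) = ((⟨[d]⟩ : Word A) ◁ q' ≫ t') ⊗ₘ g := by
        rw [← h, ← tensorHom_id, tensorHom_comp_tensorHom, Category.id_comp]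
      rw [Category.assoc, Category.assoc, e]
      simp only [MonoidalCategory.tensorHom_def']
      monoidal
    · obtain ⟨W', q', t', hq', ht', h⟩ := ih' ht
      refine ⟨_, q ≫ (f ⊗ₘ q'), _, hq.comp (hf.tensor hq'), ht'.whiskerLeft _, ?_⟩
      have e : X ◁ t ≫ (f ⊗ₘ g) = X ◁ (⟨[d]⟩ : Word A) ◁ q' ≫ f ▷ _ ≫ X₁ ◁ t' := by
        rw [← id_tensorHom, tensorHom_comp_tensorHom, h, Category.id_comp,
          MonoidalCategory.tensorHom_def', MonoidalCategory.whiskerLeft_comp, Category.assoc,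
          whisker_exchange]
      have e' := sw_natural_mid (⟨[d]⟩ : Word A) f (⟨W'⟩ : Word A)
      rw [Category.assoc, Category.assoc, e, ← sw_natural_right_assoc, ← reassoc_of% e']
      simp only [MonoidalCategory.tensorHom_def', MonoidalCategory.whiskerLeft_comp,
        Category.assoc]

/-- The first wire is tracked from the trivial insertion. The permutation becomes a reordering of
the other wires followed by an insertion, and `IsIns.split` decides on which side the wire arrives.
-/
theorem IsPerm.split {V : Word A} (X Y : Word A) {p : (⟨[d]⟩ : Word A) ⊗ V ⟶ X ⊗ Y}
    (hp : IsPerm p) :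
    (∃ (V' : Word A) (q : V ⟶ V' ⊗ Y) (t : (⟨[d]⟩ : Word A) ⊗ V' ⟶ X),
      IsPerm q ∧ IsIns d V'.toList X.toList t ∧ p = ⟨[d]⟩ ◁ q ≫ (α_ ⟨[d]⟩ V' Y).inv ≫ t ▷ Y) ∨
    ∃ (V' : Word A) (q : V ⟶ X ⊗ V') (t : (⟨[d]⟩ : Word A) ⊗ V' ⟶ Y),
      IsPerm q ∧ IsIns d V'.toList Y.toList t ∧
        p = ⟨[d]⟩ ◁ q ≫ KleeneDiagram.sw ⟨[d]⟩ X V' ≫ X ◁ t := by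
  obtain ⟨W', q, t, hq, ht, h⟩ := hp.track (IsIns.here (A := A) V.toList)
  replace h := (Category.id_comp p).symm.trans h
  rcases ht.split X Y with ⟨V', q', t, hq', ht', rfl⟩ | ⟨V', q', t, hq', ht', rfl⟩
  · exact Or.inl ⟨⟨V'⟩, q ≫ q', t, hq.comp hq', ht', by rw [h]; simp⟩
  · exact Or.inr ⟨⟨V'⟩, q ≫ q', t, hq.comp hq', ht', by rw [h]; simp⟩

/-- A wire keeps its direction, so a `◀` cannot arrive among the wires of `X`. -/
theorem IsPerm.split_of_rightward {V X Y : Word A} {p : L ⊗ V ⟶ X ⊗ Y} (hp : IsPerm p)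
    (hX : Rightward X) : ∃ (V' : Word A) (q : V ⟶ X ⊗ V') (t : L ⊗ V' ⟶ Y),
      IsPerm q ∧ IsPerm t ∧ p = L ◁ q ≫ KleeneDiagram.sw L X V' ≫ X ◁ t := by
  rcases hp.split X Y with ⟨V', q, t, -, ht, -⟩ | ⟨V', q, t, hq, ht, h⟩
  · exact nomatch hX _ ht.mem
  · exact ⟨V', q, t, hq, ht.isPerm, h⟩

/-- Used when a cap meets a bend: the `◀` seized by the cap is either the one just bent, or another
one, in which case the bent wire continues below. -/
theorem IsPerm.split_left {V Y : Word A} {p : L ⊗ V ⟶ L ⊗ Y} (hp : IsPerm p) :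
    (∃ q : V ⟶ Y, IsPerm q ∧ p = L ◁ q) ∨
      ∃ (V' : Word A) (q : V ⟶ L ⊗ V') (t : L ⊗ V' ⟶ Y),
        IsPerm q ∧ IsPerm t ∧ p = L ◁ q ≫ KleeneDiagram.sw L L V' ≫ L ◁ t := by
  rcases hp.split L Y with ⟨⟨V'⟩, q, t, hq, ht, h⟩ | ⟨V', q, t, hq, ht, h⟩
  · cases ht with
    | here =>
      refine Or.inl ⟨q, hq, h.trans ?_⟩
      refine (congrArg (L ◁ q ≫ ·) ?_).trans (Category.comp_id _)
      exact (Category.id_comp _).trans (id_whiskerRight _ _)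
    | there d' ht => exact absurd ht.mem List.not_mem_nil
  · exact Or.inr ⟨V', q, t, hq, ht.isPerm, h⟩

/-! ### Automaton-diagrams in normal form -/

/-- Diagrams with feedback through letters, up to bending wires and permuting them. -/
inductive NF : {X Y : Word A} → (X ⟶ Y) → Prop
  | rep {X Y : Word A} {r : X ⟶ Y} : Rep r → NF r
  | bend {M X : Word A} {h : R ⊗ M ⟶ X} : NF h → NF (bend cup h)
  | perm {X Y Z : Word A} {h : X ⟶ Y} {p : Y ⟶ Z} : NF h → IsPerm p → NF (h ≫ p)

namespace NF

theorem bool_comp {X Y : Word A} {h : X ⟶ Y} (hh : NF h) {W : Word A} {f : W ⟶ X}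
    (hf : IsBool f) : NF (f ≫ h) := by
  induction hh generalizing W with
  | rep hr => exact rep (hr.bool_comp hf)
  | bend _ ih =>
    rw [comp_bend]
    exact bend (ih (hf.whiskerLeft rightward_R))
  | perm _ hp ih =>
    rw [← Category.assoc]
    exact perm (ih hf) hp

theorem rightward {X Y : Word A} {h : X ⟶ Y} (hh : NF h) : Rightward X := by
  induction hh with
  | rep hr => exact hr.rightward.1
  | bend _ ih => exact ih.right
  | perm _ _ ih => exact ih

theorem whiskerLeft {X Y : Word A} {h : X ⟶ Y} (hh : NF h) : NF (R ◁ h) := by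
  induction hh with
  | rep hr => exact rep (hr.whiskerLeft rightward_R)
  | @bend M X h hh ih =>
    rw [whiskerLeft_bend]
    exact perm (bend (ih.bool_comp (.sw rightward_R rightward_R hh.rightward.right))) (.sw _ _ _)
  | perm _ hp ih =>
    rw [MonoidalCategory.whiskerLeft_comp]
    exact perm ih (hp.whiskerLeft _)

/-- A bend leaves a `◀` among the outputs, and no permutation removes it. If all outputs are `▶`,
only permutations surround the `Rep`, and these are relations. -/
theorem rep_of_rightward {X Y : Word A} {h : X ⟶ Y} (hh : NF h) {Z : Word A} {p : Y ⟶ Z}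
    (hp : IsPerm p) (hZ : Rightward Z) : Rep (h ≫ p) := by
  induction hh generalizing Z with
  | rep hr => exact hr.comp_bool (hp.isBool hr.rightward.2)
  | bend => exact nomatch hZ _ ((hp.mem_iff _).1 List.mem_cons_self)
  | perm _ hp' ih =>
    rw [Category.assoc]
    exact ih (hp'.comp hp) hZ

/-- A morphism acting on `▶` wires does not see bent wires: these can be routed to `Z`, so the
action descends through the bends to the `Rep` at the core. -/
theorem comp_whiskerRight_of_rep {X X' : Word A} (hX : Rightward X) {g : X ⟶ X'}
    (hg : ∀ {M Z : Word A} {r : M ⟶ X ⊗ Z}, Rep r → Rep (r ≫ g ▷ Z)) {M W : Word A} {h : M ⟶ W}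
    (hh : NF h) {Z : Word A} {p : W ⟶ X ⊗ Z} (hp : IsPerm p) : NF (h ≫ p ≫ g ▷ Z) := by
  induction hh generalizing Z with
  | rep hr =>
    rw [← Category.assoc]
    exact rep (hg (hr.comp_bool (hp.isBool hr.rightward.2)))
  | bend _ ih =>
    obtain ⟨V', q, t, hq, ht, rfl⟩ := hp.split_of_rightward hX
    have e := sw_natural_mid L g V'
    rw [Category.assoc, Category.assoc, whisker_exchange, ← reassoc_of% e,
      ← MonoidalCategory.whiskerLeft_comp_assoc, ← Category.assoc, bend_comp]
    exact perm (bend (ih hq)) ((IsPerm.sw _ _ _).comp (ht.whiskerLeft _))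
  | perm _ hp' ih =>
    rw [Category.assoc, ← Category.assoc _ p]
    exact ih (hp'.comp hp)

/-- The fed-back wire is a `▶`, so it avoids the bent wires and the loop passes inside each bend by
`tr_bend`. -/
theorem tr_comp_comp {X W : Word A} {k : X ⟶ W} (hk : NF k) {M N : Word A} {σ : R ⊗ M ⟶ X}
    (hσ : IsBool σ) {p : W ⟶ R ⊗ N} (hp : IsPerm p) : NF (tr cup cap (σ ≫ k ≫ p)) := by
  induction hk generalizing M N with
  | rep hr => exact rep (hr.tr_comp_comp hσ (hp.isBool hr.rightward.2))
  | @bend X W k hk ih =>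
    obtain ⟨V', q, t, hq, ht, rfl⟩ := hp.split_of_rightward rightward_R
    have e : σ ≫ KleeneDiagram.bend cup k ≫ L ◁ q ≫ sw L R V' ≫ R ◁ t =
        (KleeneDiagram.bend cup (R ◁ σ ≫ k ≫ q) ≫ sw L R V') ≫ R ◁ t := by
      rw [← Category.assoc σ, comp_bend, ← Category.assoc (KleeneDiagram.bend _ _), bend_comp]
      simp only [Category.assoc]
    rw [e, ← tr_comp, tr_bend, ← Category.assoc (sw _ _ _)]
    exact perm (bend (ih ((IsBool.sw rightward_R rightward_R hσ.rightward.1.right).comp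
      (hσ.whiskerLeft rightward_R)) hq)) ht
  | perm _ hp' ih =>
    rw [Category.assoc]
    exact ih hσ (hp'.comp hp)

/-- A cup placed after `h` slides before it and becomes a bend of `h` with one more wire alongside.
-/
theorem comp_cupR {M Z : Word A} {h : M ⟶ Z} (hh : NF h) : NF (h ≫ cupR cup Z) := by
  rw [cupR_natural]
  exact bend hh.whiskerLeft

/-- Induction on the normal form until the bend that produced the `◀` met by the cap is reached. -/
theorem comp_capR {M W : Word A} {h : M ⟶ W} (hh : NF h) {Z : Word A} {p : W ⟶ L ⊗ R ⊗ Z}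
    (hp : IsPerm p) : NF (h ≫ p ≫ capR cap Z) := by
  induction hh generalizing Z with
  | rep hr =>
    exact nomatch hr.rightward.2 _ ((hp.mem_iff Dir.left).2 List.mem_cons_self)
  | @bend X W k hk ih =>
    rcases hp.split_left with ⟨q, hq, rfl⟩ | ⟨V', q, t, hq, ht, rfl⟩
    -- The cap meets the wire of this bend: cup and cap together form a loop without letter.
    · have e : KleeneDiagram.bend cup k ≫ L ◁ q ≫ capR cap Z = tr cup cap (𝟙 _ ≫ k ≫ q) := by
        rw [← Category.assoc, bend_comp, Category.id_comp, tr_eq_bend]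
      rw [e]
      exact tr_comp_comp hk (.id hk.rightward) hq
    -- The cap meets some other `◀`, so it moves inside this bend.
    · obtain ⟨V'', q', t', hq', ht', rfl⟩ := ht.split_of_rightward rightward_R
      have e : KleeneDiagram.bend cup k ≫
          (L ◁ q ≫ sw L L V' ≫ L ◁ (L ◁ q' ≫ sw L R V'' ≫ R ◁ t')) ≫ capR cap Z =
          KleeneDiagram.bend cup (k ≫ (q ≫ L ◁ q') ≫ capR cap V'') ≫ t' := by
        have e' : capR cap (L ⊗ V'') ≫ t' = L ◁ R ◁ t' ≫ capR cap Z := capR_natural cap t'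
        have e'' := whiskerLeft_capR cap L V''
        simp only [MonoidalCategory.whiskerLeft_comp, Category.assoc]
        rw [← e', ← sw_natural_right_assoc, ← reassoc_of% e'', ← bend_comp]
        simp only [MonoidalCategory.whiskerLeft_comp, Category.assoc]
      rw [e]
      exact perm (bend (ih (hq.comp (hq'.whiskerLeft _)))) ht'
  | perm _ hp' ih =>
    rw [Category.assoc, ← Category.assoc _ p]
    exact ih (hp'.comp hp)

end NF

/-- The action of an automaton-diagram preserves normal forms. -/
theorem IsBlock.nf_comp {X Y : List Dir} {f : Syn A X Y} (hf : IsBlock Gen.IsAut f) {M Z : Word A}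
    {h : M ⟶ ⟨X⟩ ⊗ Z} (hh : NF h) : NF (h ≫ den f ▷ Z) := by
  have of_bool : ∀ {X Y M Z : Word A} {g : X ⟶ Y} (_ : IsBool g) {h : M ⟶ X ⊗ Z}, NF h →
      NF (h ≫ g ▷ Z) := fun {X Y M Z g} hg {h} hh => by
    rw [← Category.id_comp (g ▷ Z)]
    exact NF.comp_whiskerRight_of_rep hg.rightward.1
      (fun hr => hr.comp_bool (hg.whiskerRight hr.rightward.2.right)) hh (.id _)
  induction hf generalizing M Z with
  | of g hg =>
    cases hg with
    | copy => exact of_bool .cop₁ hh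
    | del => exact of_bool .del₁ hh
    | merge => exact of_bool .mer₁ hh
    | gen => exact of_bool .gen₁ hh
    | cup =>
      have e : cup ▷ Z = (λ_ Z).hom ≫ cupR cup Z ≫ (α_ L R Z).inv := by simp [cupR]
      have := ((hh.perm (.leftUnitor Z)).comp_cupR).perm (.associator_inv L R Z)
      rw [Category.assoc, Category.assoc, ← e] at this
      exact this
    | cap =>
      have e : cap ▷ Z = (α_ L R Z).hom ≫ capR cap Z ≫ (λ_ Z).inv := by simp [capR]
      have := (hh.comp_capR (.associator L R Z)).perm (.leftUnitor_inv Z)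
      rw [Category.assoc, Category.assoc, ← e] at this
      exact this
    | letter a =>
      have := NF.comp_whiskerRight_of_rep (A := A) rightward_R
        (fun hr => hr.comp_ltr a) hh (.id _)
      rw [Category.id_comp] at this
      exact this
  | id X => exact hh.perm ((IsPerm.id _).whiskerRight Z)
  | swap X Y => exact hh.perm ((IsPerm.braiding ⟨X⟩ ⟨Y⟩).whiskerRight Z)
  | comp _ _ ih ih' =>
    rw [den_comp, comp_whiskerRight, ← Category.assoc]
    exact ih' (ih hh)
  | @tensor X₁ Y₁ X₂ Y₂ f g _ _ ih ih' =>
    -- The two factors act one after the other; crossings bring the inputs of `g` to the top and its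
    -- outputs back, so that each factor acts on a top block.
    have e : (den f ⊗ₘ den g) ▷ Z = (α_ _ _ _).hom ≫ den f ▷ _ ≫ sw _ _ _ ≫ den g ▷ _ ≫
        sw _ _ _ ≫ (α_ _ _ _).inv := by
      have e' := sw_natural_mid ⟨Y₁⟩ (den g) Z
      rw [← reassoc_of% e', sw_sw_assoc, MonoidalCategory.tensorHom_def]
      monoidal
    rw [den_tensor]
    have := ((ih' ((ih (hh.perm (.associator _ _ Z))).perm (.sw _ _ _))).perm (.sw _ _ _)).perm
      (.associator_inv _ _ Z)
    simp only [Category.assoc] at this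
    rw [e]
    exact this

/-- The diagram acts on the normal form of the identity, with an empty context below. -/
theorem IsAutomatonDiagram.rep {X Y : List Dir} {c : Syn A X Y} (hc : IsAutomatonDiagram c)
    (hX : Rightward (⟨X⟩ : Word A)) (hY : Rightward (⟨Y⟩ : Word A)) : Rep (den c) := by
  have h := IsBlock.nf_comp hc (NF.rep (.bool (IsBool.rightUnitor_inv hX)))
  have h' := h.rep_of_rightward
    (IsPerm.eqToHom (congrArg Word.ofList (List.append_nil Y))) hY
  have e : ((ρ_ (⟨X⟩ : Word A)).inv ≫ den c ▷ 𝟙_ (Word A)) ≫ (ρ_ (⟨Y⟩ : Word A)).hom = den c := by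
    simp
  exact e ▸ h'

end KleeneDiagram

namespace KleeneDiagram

open CategoryTheory MonoidalCategory

variable {A : Type u}

/-! ### Traces over several wires -/

/-- The object `▶ⁿ`. -/
abbrev Rs (n : ℕ) : Word A := ⟨rs n⟩

/-- The object `◀ⁿ`. -/
abbrev Ls (n : ℕ) : Word A := ⟨ls n⟩

theorem tensorObj_middle (X Y Z W : Word A) : (X ⊗ Y) ⊗ (Z ⊗ W) = (X ⊗ (Y ⊗ Z)) ⊗ W :=
  congrArg Word.ofList (by
    change (X.toList ++ Y.toList) ++ (Z.toList ++ W.toList) =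
      (X.toList ++ (Y.toList ++ Z.toList)) ++ W.toList
    simp)

theorem tensorμ_eq_eqToHom (X X' Y Y' : Word A) :
    tensorμ X X' Y Y' = eqToHom (tensorObj_middle X X' Y Y') ≫ (X ◁ (β_ X' Y).hom) ▷ Y' ≫
      eqToHom (tensorObj_middle X Y X' Y').symm := by
  have e : tensorμ X X' Y Y' = ((α_ X X' (Y ⊗ Y')).hom ≫ X ◁ (α_ X' Y Y').inv ≫
      (α_ X (X' ⊗ Y) Y').inv) ≫ (X ◁ (β_ X' Y).hom) ▷ Y' ≫
        (α_ X (Y ⊗ X') Y').hom ≫ X ◁ (α_ Y X' Y').hom ≫ (α_ X Y (X' ⊗ Y')).inv := by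
    simp [tensorμ]
  have h : ∀ {Z W : Word A} (h : Z = W), X ◁ eqToHom h = eqToHom (congrArg (X ⊗ ·) h) := by
    rintro Z _ rfl
    exact whiskerLeft_id _ _
  rw [e]
  simp only [associator_eq, associator_inv_eq]
  congr 1
  · refine (congrArg (fun k => _ ≫ k ≫ _) (h _)).trans ?_
    exact (congrArg _ (eqToHom_trans _ _)).trans (eqToHom_trans _ _)
  · congr 1
    refine (congrArg (fun k => _ ≫ k ≫ _) (h _)).trans ?_
    exact (congrArg _ (eqToHom_trans _ _)).trans (eqToHom_trans _ _)

/-- `Diag.copyN`, `Diag.mergeN`, `Diag.cupN` and `Diag.capN` all contain a cast crossing of this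
shape. Identifying it with `tensorμ` matches them with `cop`, `mer` and the cup and cap of
`tr_prod`. -/
theorem den_cast_crossing {X Y Z W V U : List Dir} (hV : X ++ (Y ++ Z) ++ W = V)
    (hU : X ++ (Z ++ Y) ++ W = U) (hV' : (⟨V⟩ : Word A) = (⟨X⟩ ⊗ ⟨Y⟩) ⊗ (⟨Z⟩ ⊗ ⟨W⟩))
    (hU' : ((⟨X⟩ ⊗ ⟨Z⟩) ⊗ (⟨Y⟩ ⊗ ⟨W⟩) : Word A) = ⟨U⟩) :
    den (Syn.mk (Diag.cast hV hU (Diag.id X ⊹ Diag.swap Y Z ⊹ Diag.id W) : Diag A V U)) =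
      eqToHom hV' ≫ tensorμ (⟨X⟩ : Word A) ⟨Y⟩ ⟨Z⟩ ⟨W⟩ ≫ eqToHom hU' := by
  rw [mk_cast, den_cast, tensorμ_eq_eqToHom, Category.assoc, Category.assoc, eqToHom_trans,
    eqToHom_trans_assoc]
  rfl

/-- Several cups. -/
def cups (n : ℕ) : 𝟙_ (Word A) ⟶ Ls n ⊗ Rs n := den (Syn.mk (Diag.cupN n))

/-- Several caps. -/
def caps (n : ℕ) : Ls n ⊗ Rs n ⟶ 𝟙_ (Word A) := den (Syn.mk (Diag.capN n))

theorem cups_succ (n : ℕ) : cups (A := A) (n + 1) =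
    (λ_ (𝟙_ (Word A))).inv ≫ (cup ⊗ₘ cups n) ≫ tensorμ L R (Ls n) (Rs n) := by
  have h := den_cast_crossing (A := A) (X := [.left]) (Y := [.right]) (Z := ls n) (W := rs n)
    (V := [.left, .right] ++ (ls n ++ rs n)) (U := ls (n + 1) ++ rs (n + 1)) (by simp)
    (by simp [List.replicate_succ]) rfl rfl
  refine Eq.trans ?_ (Category.id_comp _).symm
  exact congrArg ((cup ⊗ₘ cups n) ≫ ·)
    (h.trans ((Category.id_comp _).trans (Category.comp_id _)))

theorem caps_succ (n : ℕ) : caps (A := A) (n + 1) =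
    tensorμ L (Ls n) R (Rs n) ≫ (cap ⊗ₘ caps n) ≫ (λ_ (𝟙_ (Word A))).hom := by
  have h := den_cast_crossing (A := A) (X := [.left]) (Y := ls n) (Z := [.right]) (W := rs n)
    (V := ls (n + 1) ++ rs (n + 1)) (U := [.left, .right] ++ (ls n ++ rs n))
    (by simp [List.replicate_succ]) (by simp) rfl rfl
  refine Eq.trans ?_ (congrArg (_ ≫ ·) (Category.comp_id _).symm)
  exact congrArg (· ≫ (cap ⊗ₘ caps n))
    (h.trans ((Category.id_comp _).trans (Category.comp_id _)))

theorem den_copyN (n : ℕ) : den (Syn.mk (Diag.copyN n)) = cop (Rs (A := A) n) := by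
  induction n with
  | zero => rfl
  | succ n ih =>
    have h := den_cast_crossing (A := A) (X := [.right]) (Y := [.right]) (Z := rs n) (W := rs n)
      (V := [.right, .right] ++ (rs n ++ rs n)) (U := rs (n + 1) ++ rs (n + 1)) (by simp)
      (by simp [List.replicate_succ]) rfl rfl
    have e : cop (Rs (A := A) (n + 1)) = (cop₁ ⊗ₘ cop (Rs n)) ≫ tensorμ R R (Rs n) (Rs n) := rfl
    rw [e, ← ih]
    exact congrArg ((cop₁ ⊗ₘ den (Syn.mk (Diag.copyN n))) ≫ ·)
      (h.trans ((Category.id_comp _).trans (Category.comp_id _)))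

theorem den_mergeN (n : ℕ) : den (Syn.mk (Diag.mergeN n)) = mer (Rs (A := A) n) := by
  induction n with
  | zero => rfl
  | succ n ih =>
    have h := den_cast_crossing (A := A) (X := [.right]) (Y := rs n) (Z := [.right]) (W := rs n)
      (V := rs (n + 1) ++ rs (n + 1)) (U := [.right, .right] ++ (rs n ++ rs n))
      (by simp [List.replicate_succ]) (by simp) rfl rfl
    have e : mer (Rs (A := A) (n + 1)) = tensorμ R (Rs n) R (Rs n) ≫ (mer₁ ⊗ₘ mer (Rs n)) := rfl
    rw [e, ← ih]
    exact congrArg (· ≫ (mer₁ ⊗ₘ den (Syn.mk (Diag.mergeN n))))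
      (h.trans ((Category.id_comp _).trans (Category.comp_id _)))

/-- Feedback of several wires. -/
abbrev trs (n : ℕ) {M N : Word A} (f : Rs n ⊗ M ⟶ Rs n ⊗ N) : M ⟶ N := tr (cups n) (caps n) f

theorem trs_zero {M N : Word A} (f : M ⟶ N) :
    trs 0 ((λ_ M).hom ≫ f ≫ (λ_ N).inv) = f := by
  have h : cups (A := A) 0 = (λ_ (𝟙_ (Word A))).inv := rfl
  have h' : caps (A := A) 0 = (λ_ (𝟙_ (Word A))).hom := rfl
  have e : tr (L := 𝟙_ (Word A)) (R := 𝟙_ (Word A)) (λ_ (𝟙_ (Word A))).inv (λ_ (𝟙_ (Word A))).hom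
      ((λ_ M).hom ≫ f ≫ (λ_ N).inv) = f := by
    simp only [tr, cupR, capR]
    monoidal
  exact e

theorem trs_succ (n : ℕ) {M N : Word A} (f : (R ⊗ Rs n) ⊗ M ⟶ (R ⊗ Rs n) ⊗ N) :
    trs (n + 1) f = tr cup cap (trs n (sw (Rs n) R M ≫ (α_ R (Rs n) M).inv ≫ f ≫
      (α_ R (Rs n) N).hom ≫ sw R (Rs n) N)) := by
  rw [trs, cups_succ, caps_succ]
  exact tr_prod cup cap (cups n) (caps n) f

theorem den_star {l : ℕ} (d : Syn A (rs l) (rs l)) :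
    den d.star = trs l (mer (Rs l) ≫ cop (Rs l) ≫ (den d ⊗ₘ 𝟙 (Rs l))) := by
  have h : den d.star = (den (Syn.cast (List.nil_append _) (List.append_assoc _ _ _)
      ((Syn.mk (Diag.cupN l)).tensor (Syn.id (rs l)))) ≫ (Ls l) ◁
        ((den (Syn.mk (Diag.mergeN l)) ≫ den (Syn.mk (Diag.copyN l))) ≫ (den d ⊗ₘ 𝟙 (Rs l)))) ≫
          den (Syn.cast (List.append_assoc _ _ _) (List.nil_append _)
            ((Syn.mk (Diag.capN l)).tensor (Syn.id (rs l)))) := rfl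
  rw [h, den_cast, den_cast, den_mergeN, den_copyN]
  simp only [trs, tr, cupR, capR, Category.assoc]
  rfl

/-! ### Representations -/

theorem sw_conj {C : Type*} [Category* C] [MonoidalCategory C] [SymmetricCategory C]
    {Q R X Y : C} (b : Q ⊗ R ⊗ X ⟶ Q ⊗ R ⊗ Y) (a : R ⟶ R) (t : Q ⟶ Q) :
    sw Q R X ≫ (α_ R Q X).inv ≫ (((α_ R Q X).hom ≫ sw R Q X ≫ b ≫ sw Q R Y ≫
      (α_ R Q Y).inv) ≫ (a ⊗ₘ t) ▷ Y) ≫ (α_ R Q Y).hom ≫ sw R Q Y =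
        (b ≫ t ▷ (R ⊗ Y)) ≫ Q ◁ a ▷ Y := by
  have e₁ : (a ⊗ₘ t) ▷ Y ≫ (α_ R Q Y).hom = (α_ R Q Y).hom ≫ R ◁ t ▷ Y ≫ a ▷ (Q ⊗ Y) := by
    rw [MonoidalCategory.tensorHom_def']
    monoidal
  have e₂ := sw_natural_mid R t Y
  have e₃ := sw_natural_left a Q Y
  simp only [Category.assoc]
  rw [Iso.inv_hom_id_assoc, sw_sw_assoc, reassoc_of% e₁, Iso.inv_hom_id_assoc, e₃,
    reassoc_of% e₂, sw_sw_assoc]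

/-- Parallel letters. -/
def ltrs : (w : List A) → ((Rs w.length : Word A) ⟶ Rs w.length)
  | [] => 𝟙 _
  | a :: w => ltr a ⊗ₘ ltrs w

/-- A loop through `a` around loops through `w` is a loop through `a :: w`; the new relation is the
old one conjugated by the crossings that make the new wire the first. -/
theorem Rep.exists_trs {X Y : Word A} {r : X ⟶ Y} (hr : Rep r) :
    ∃ (w : List A) (b : Rs w.length ⊗ X ⟶ Rs w.length ⊗ Y),
      IsBool b ∧ r = trs w.length (b ≫ ltrs w ▷ Y) := by
  induction hr with
  | @bool X Y f hf =>
    refine ⟨[], (λ_ X).hom ≫ f ≫ (λ_ Y).inv, (IsBool.leftUnitor hf.rightward.1).comp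
      (hf.comp (IsBool.leftUnitor_inv hf.rightward.2)), ?_⟩
    have e : ltrs ([] : List A) ▷ Y = 𝟙 _ := id_whiskerRight _ _
    rw [e, Category.comp_id]
    exact (trs_zero f).symm
  | @loop a X Y r hr ih =>
    obtain ⟨w, b, hb, rfl⟩ := ih
    have hw := rightward_rs (A := A) w.length
    have hX := hr.rightward.1.right
    have hY := hr.rightward.2.right
    refine ⟨a :: w, (α_ R (Rs w.length) X).hom ≫ sw R (Rs w.length) X ≫ b ≫
      sw (Rs w.length) R Y ≫ (α_ R (Rs w.length) Y).inv, (IsBool.associator rightward_R hw hX).comp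
        ((IsBool.sw rightward_R hw hX).comp (hb.comp ((IsBool.sw hw rightward_R hY).comp
          (IsBool.associator_inv rightward_R hw hY)))), ?_⟩
    refine Eq.trans ?_ (trs_succ w.length _).symm
    congr 1
    rw [tr_comp]
    congr 1
    exact (sw_conj b (ltr a) (ltrs w)).symm

/-- Entering by `inl` puts zero on the `Q` wires, so merging there does nothing and the input is
merged with the extra wire alone. -/
theorem mer_inl_braiding {Q : Word A} (hQ : Rightward Q) :
    sw Q R R ≫ (α_ R Q R).inv ≫ (R ⊗ Q) ◁ inl R Q ≫ mer (R ⊗ Q) ≫ (β_ R Q).hom =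
      Q ◁ mer₁ := by
  have e : (R ⊗ Q) ◁ inl R Q ≫ mer (R ⊗ Q) =
      (R ⊗ Q) ◁ (ρ_ R).inv ≫ tensorμ R Q R (𝟙_ _) ≫ (mer₁ ⊗ₘ (Q ◁ gen Q ≫ mer Q)) := by
    rw [inl, mer_tensor, mer_R, MonoidalCategory.whiskerLeft_comp, Category.assoc,
      ← id_tensorHom (R ⊗ Q) (R ◁ gen Q), ← id_tensorHom R, ← tensor_id_id, tensorμ_natural_assoc,
      tensor_id_id, tensorHom_comp_tensorHom, Category.id_comp, id_tensorHom]
  have e' : (R ⊗ Q) ◁ (ρ_ R).inv ≫ tensorμ R Q R (𝟙_ (Word A)) ≫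
      (mer₁ ⊗ₘ (Q ◁ gen Q ≫ mer Q)) = (α_ R Q R).hom ≫ R ◁ (β_ Q R).hom ≫ (α_ R R Q).inv ≫
        mer₁ ▷ Q ≫ R ◁ ((ρ_ Q).inv ≫ Q ◁ gen Q ≫ mer Q) := by
    simp only [tensorμ, MonoidalCategory.tensorHom_def]
    monoidal
  rw [hQ.mer_gen, MonoidalCategory.whiskerLeft_id, Category.comp_id] at e'
  have h := BraidedCategory.braiding_tensor_right_hom Q R (R : Word A)
  have h' : sw Q R R ≫ R ◁ (β_ Q R).hom ≫ (α_ R R Q).inv = (β_ Q (R ⊗ R)).hom := by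
    rw [h, sw]
    simp
  rw [reassoc_of% e, reassoc_of% e', Iso.inv_hom_id_assoc,
    BraidedCategory.braiding_naturality_left, reassoc_of% h', SymmetricCategory.symmetry_assoc]

/-- The star copies the state: one copy takes the `Q` outputs of `b` through `t` to the feedback,
the other takes the remaining output of `b` outside. As `b` commutes with copying, both uses of `b`
come from a single one, and the two projections reassemble its outputs. -/
theorem inl_star_comp {Q : Word A} {b : Q ⊗ R ⟶ Q ⊗ R} (hb : IsBool b) (t : Q ⟶ Q) :
    (R ⊗ Q) ◁ inl R Q ≫ (mer (R ⊗ Q) ≫ cop (R ⊗ Q) ≫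
        (((β_ R Q).hom ≫ b ≫ fst Q R ≫ t ≫ inr R Q) ⊗ₘ 𝟙 (R ⊗ Q))) ≫
          (R ⊗ Q) ◁ ((β_ R Q).hom ≫ b ≫ snd Q R) =
      ((R ⊗ Q) ◁ inl R Q ≫ mer (R ⊗ Q) ≫ (β_ R Q).hom) ≫ (b ≫ t ▷ R) ≫ inr R Q ▷ R := by
  have hQ := hb.rightward.1.left
  have e : cop (R ⊗ Q) ≫ (((β_ R Q).hom ≫ b ≫ fst Q R ≫ t ≫ inr R Q) ⊗ₘ
      ((β_ R Q).hom ≫ b ≫ snd Q R)) = (β_ R Q).hom ≫ b ≫ t ▷ R ≫ inr R Q ▷ R := by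
    have h := ((IsBool.braiding rightward_R hQ).comp hb).isHom.cop
    have h' : ((β_ R Q).hom ≫ b ≫ fst Q R ≫ t ≫ inr R Q) ⊗ₘ ((β_ R Q).hom ≫ b ≫ snd Q R) =
        (((β_ R Q).hom ≫ b) ⊗ₘ ((β_ R Q).hom ≫ b)) ≫ (fst Q R ⊗ₘ snd Q R) ≫ t ▷ R ≫
          inr R Q ▷ R := by
      simp only [← tensorHom_id, tensorHom_comp_tensorHom, Category.assoc, Category.comp_id]
    rw [h', ← reassoc_of% h, reassoc_of% cop_fst_snd hQ rightward_R]
  simp only [Category.assoc]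
  rw [← id_tensorHom (R ⊗ Q) (_ ≫ b ≫ snd Q R), tensorHom_comp_tensorHom, Category.id_comp,
    Category.comp_id, e]

/-- The states are the looping wires of `b` and one extra wire for its input. The transition matrix
ends with `inr`, so it never returns to the extra state and the loop on that wire carries zero. -/
theorem tr_trs_eq {w : ℕ} {b : Rs w ⊗ R ⟶ Rs w ⊗ (R : Word A)} (hb : IsBool b)
    (t : (Rs w : Word A) ⟶ Rs w) :
    inl R (Rs w) ≫ trs (w + 1) (mer (R ⊗ Rs w) ≫ cop (R ⊗ Rs w) ≫
        (((β_ R (Rs w)).hom ≫ b ≫ fst (Rs w) R ≫ t ≫ inr R (Rs w)) ⊗ₘ 𝟙 (R ⊗ Rs w))) ≫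
          (β_ R (Rs w)).hom ≫ b ≫ snd (Rs w) R = trs w (b ≫ t ▷ R) := by
  have hQ := hb.rightward.1.left
  rw [tr_comp, comp_tr]
  refine (congrArg _ (inl_star_comp hb t)).trans ?_
  refine (trs_succ w _).trans ?_
  have e : inr R (Rs w) ▷ R ≫ (α_ R (Rs w) R).hom ≫ sw R (Rs w) R =
      Rs w ◁ inr R (R : Word A) := by
    have h := sw_natural_left (gen R) (Rs w) (R : Word A)
    have h' : inr (R : Word A) (Rs w) ▷ R ≫ (α_ R (Rs w) R).hom ≫ sw R (Rs w) R =
        (λ_ (Rs w ⊗ R)).inv ≫ gen R ▷ (Rs w ⊗ R) ≫ sw R (Rs w) R := by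
      simp only [inr]
      monoidal
    rw [h', h, sw_unit_left, Category.assoc, Iso.inv_hom_id_assoc, inr,
      MonoidalCategory.whiskerLeft_comp]
  have e' := mer_inl_braiding hQ
  simp only [Category.assoc] at e' ⊢
  rw [reassoc_of% e', e]
  have e₂ : Rs w ◁ mer₁ ≫ b ≫ t ▷ R ≫ Rs w ◁ inr R R = (Rs w ◁ mer₁ ≫ b ≫ t ▷ R) ≫ Rs w ◁ inr R R := by
    simp only [Category.assoc]
  unfold trs
  rw [e₂, ← tr_comp, ← comp_tr, inr, gen_R]
  -- The loop of the extra state is cut, which leaves zero merged with the input.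
  refine (zigzag.tr_comp_point gen₁ _).trans ?_
  rw [reassoc_of% gen_mer₁' (A := A)]

end KleeneDiagram

namespace KleeneDiagram

open CategoryTheory MonoidalCategory

variable {A : Type u}

/-! ### Entries of relations -/

theorem del₁_cop₁_left {Y : Word A} (x : R ⟶ Y) :
    cop₁ ≫ (del₁ ⊗ₘ x) ≫ (λ_ Y).hom = x := by
  rw [MonoidalCategory.tensorHom_def, Category.assoc, leftUnitor_naturality]
  rw [reassoc_of% del_cop₁ (A := A)]

theorem cop₁_tensor_assoc {X Y Z : Word A} (x : R ⟶ X) (y : R ⟶ Y) (z : R ⟶ Z) :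
    cop₁ ≫ ((cop₁ ≫ (x ⊗ₘ y)) ⊗ₘ z) ≫ (α_ X Y Z).hom = cop₁ ≫ (x ⊗ₘ (cop₁ ≫ (y ⊗ₘ z))) := by
  have e₁ : (cop₁ ≫ (x ⊗ₘ y)) ⊗ₘ z = cop₁ ▷ R ≫ ((x ⊗ₘ y) ⊗ₘ z) := by
    rw [← tensorHom_id, tensorHom_comp_tensorHom, Category.id_comp]
  have e₂ : x ⊗ₘ (cop₁ ≫ (y ⊗ₘ z)) = R ◁ cop₁ ≫ (x ⊗ₘ (y ⊗ₘ z)) := by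
    rw [← id_tensorHom, tensorHom_comp_tensorHom, Category.id_comp]
  rw [e₁, e₂, ← reassoc_of% cop₁_assoc (A := A), Category.assoc, associator_naturality]

/-- The rows of zeros and ones. -/
def RowL : (Y : List Dir) → ((R : Word A) ⟶ ⟨Y⟩) → Prop
  | [], x => x = del₁
  | .right :: Y, x => ∃ (s : (R : Word A) ⟶ R) (y : R ⟶ ⟨Y⟩),
      (s = 𝟙 R ∨ s = del₁ ≫ gen₁) ∧ RowL Y y ∧ x = cop₁ ≫ (s ⊗ₘ y)
  | .left :: _, _ => False

/-- The rows of zeros and ones. -/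
def Row {Y : Word A} (x : R ⟶ Y) : Prop := RowL Y.toList x

theorem row_unit {x : R ⟶ 𝟙_ (Word A)} : Row x ↔ x = del₁ := Iff.rfl

theorem row_R_tensor {Y : Word A} {x : R ⟶ R ⊗ Y} :
    Row x ↔ ∃ (s : (R : Word A) ⟶ R) (y : R ⟶ Y), (s = 𝟙 R ∨ s = del₁ ≫ gen₁) ∧ Row y ∧
      x = cop₁ ≫ (s ⊗ₘ y) :=
  Iff.rfl

theorem row_tensor {X Y : Word A} (hX : Rightward X) {x : R ⟶ X ⊗ Y} :
    Row x ↔ ∃ (y : R ⟶ X) (z : R ⟶ Y), Row y ∧ Row z ∧ x = cop₁ ≫ (y ⊗ₘ z) := by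
  refine Rightward.induction (P := fun X => ∀ x : R ⟶ X ⊗ Y, Row x ↔
    ∃ (y : R ⟶ X) (z : R ⟶ Y), Row y ∧ Row z ∧ x = cop₁ ≫ (y ⊗ₘ z)) ?_ ?_ hX x
  · intro x
    have h : ∀ z : R ⟶ Y, cop₁ ≫ (del₁ ⊗ₘ z) = z := fun z =>
      Eq.trans (congrArg (cop₁ ≫ ·) (Category.comp_id _).symm) (del₁_cop₁_left z)
    constructor
    · exact fun hx => ⟨del₁, x, row_unit.2 rfl, hx, (h x).symm⟩
    · rintro ⟨y, z, hy, hz, rfl⟩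
      rw [row_unit.1 hy]
      exact (h z).symm ▸ hz
  · intro X hX ih x
    have h : ∀ (s : (R : Word A) ⟶ R) (y : R ⟶ X) (z : R ⟶ Y),
        cop₁ ≫ ((cop₁ ≫ (s ⊗ₘ y)) ⊗ₘ z) = cop₁ ≫ (s ⊗ₘ (cop₁ ≫ (y ⊗ₘ z))) := fun s y z =>
      Eq.trans (congrArg (cop₁ ≫ ·) (Category.comp_id _).symm) (cop₁_tensor_assoc s y z)
    constructor
    · intro hx
      obtain ⟨s, x, hs, hx', rfl⟩ := row_R_tensor.1 (show Row (Y := R ⊗ X ⊗ Y) x from hx)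
      obtain ⟨y, z, hy, hz, rfl⟩ := (ih x).1 hx'
      exact ⟨cop₁ ≫ (s ⊗ₘ y), z, row_R_tensor.2 ⟨s, y, hs, hy, rfl⟩, hz, (h s y z).symm⟩
    · rintro ⟨y, z, hy, hz, rfl⟩
      obtain ⟨s, y, hs, hy', rfl⟩ := row_R_tensor.1 hy
      rw [h]
      exact row_R_tensor.2 ⟨s, _, hs, (ih _).2 ⟨y, z, hy', hz, rfl⟩, rfl⟩

theorem row_R {x : (R : Word A) ⟶ R} : Row x ↔ x = 𝟙 R ∨ x = del₁ ≫ gen₁ := by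
  have h : ∀ s : (R : Word A) ⟶ R, cop₁ ≫ (s ⊗ₘ del₁) = s := fun s => by
    have h' : cop₁ ≫ (s ⊗ₘ del₁) ≫ (ρ_ R).hom = s := by
      rw [MonoidalCategory.tensorHom_def', Category.assoc, rightUnitor_naturality,
        reassoc_of% cop₁_del (A := A)]
    exact Eq.trans (congrArg (cop₁ ≫ ·) (Category.comp_id _).symm) h'
  constructor
  · intro hx
    obtain ⟨s, y, hs, hy, e⟩ := row_R_tensor.1 (show Row (Y := R ⊗ 𝟙_ (Word A)) x from hx)
    rw [row_unit.1 hy] at e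
    exact (e.trans (h s)).symm ▸ hs
  · exact fun hx => row_R_tensor.2 ⟨x, del₁, hx, row_unit.2 rfl, (h x).symm⟩

theorem row_del_gen {Y : Word A} (hY : Rightward Y) : Row (del₁ ≫ gen Y) := by
  refine Rightward.induction (P := fun Y => Row (del₁ ≫ gen Y)) ?_ ?_ hY
  · exact row_unit.2 (Category.comp_id _)
  · intro Y _ ih
    refine row_R_tensor.2 ⟨_, _, Or.inr rfl, ih, ?_⟩
    have h := IsHom.del₁ (A := A).cop
    rw [cop_R, cop_unit] at h
    rw [gen_tensor, gen_R, ← tensorHom_comp_tensorHom, ← reassoc_of% h]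

theorem row_inl {X : Word A} (hX : Rightward X) : Row (inl R X) := by
  refine row_R_tensor.2 ⟨𝟙 R, del₁ ≫ gen X, Or.inl rfl, row_del_gen hX, ?_⟩
  have h : cop₁ ≫ (R : Word A) ◁ del₁ = (ρ_ R).inv := by
    rw [← cancel_mono (ρ_ R).hom, Category.assoc, cop₁_del, Iso.inv_hom_id]
  rw [id_tensorHom, MonoidalCategory.whiskerLeft_comp, reassoc_of% h, inl]

/-- Boolean arithmetic on entries: `1 + 1 = 1` is `cop₁_mer₁`, zero is neutral, and entries commute
with copying. A relation can thus be evaluated to explicit zeros and ones. -/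
theorem Row.comp {X Y : Word A} {x : R ⟶ X} (hx : Row x) {f : X ⟶ Y} (hf : IsBool f) :
    Row (x ≫ f) := by
  induction hf with
  | cop₁ =>
    have h : x ≫ KleeneDiagram.cop₁ = KleeneDiagram.cop₁ ≫ (x ⊗ₘ x) := by
      have : IsHom x := by
        rcases row_R.1 hx with rfl | rfl
        · exact IsHom.id _
        · exact IsHom.del₁.comp IsHom.gen₁
      simpa only [cop_R] using this.cop
    rw [h]
    exact (row_tensor rightward_R).2 ⟨x, x, hx, hx, rfl⟩
  | del₁ =>
    refine row_unit.2 ?_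
    rcases row_R.1 hx with rfl | rfl
    · exact Category.id_comp _
    · rw [Category.assoc, gen₁_del₁, Category.comp_id]
  | mer₁ =>
    obtain ⟨y, z, hy, hz, rfl⟩ := (row_tensor rightward_R).1 hx
    refine row_R.2 ?_
    rw [Category.assoc]
    rcases row_R.1 hz with rfl | rfl
    · left
      rcases row_R.1 hy with rfl | rfl
      · rw [tensor_id_id, Category.id_comp, cop₁_mer₁]
      · exact zero_add _
    · rw [add_zero]
      exact row_R.1 hy
  | gen₁ =>
    rw [row_unit.1 hx]
    exact row_R.2 (Or.inr rfl)
  | id => rwa [Category.comp_id]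
  | braiding hX hY =>
    obtain ⟨y, z, hy, hz, rfl⟩ := (row_tensor hX).1 hx
    refine (row_tensor hY).2 ⟨z, y, hz, hy, ?_⟩
    rw [Category.assoc, BraidedCategory.braiding_naturality, reassoc_of% cop₁_comm (A := A)]
  | comp _ _ ih ih' =>
    rw [← Category.assoc]
    exact ih' (ih hx)
  | tensor hf hg ih ih' =>
    obtain ⟨y, z, hy, hz, rfl⟩ := (row_tensor hf.rightward.1).1 hx
    refine (row_tensor hf.rightward.2).2 ⟨_, _, ih hy, ih' hz, ?_⟩
    rw [Category.assoc, tensorHom_comp_tensorHom]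

end KleeneDiagram

namespace KleeneDiagram

open CategoryTheory MonoidalCategory

variable {A : Type u}

/-! ### Realization of relations as matrix-diagrams -/

theorem Syn.path_comp {X Y Z : List Dir} (f : Syn A X Y) (g : Syn A Y Z) (i : ℕ) (w : List A)
    (j : ℕ) : (f.comp g).Path i w j ↔ ∃ u k v, f.Path i u k ∧ g.Path k v j ∧ w = u ++ v := by
  induction f using Quotient.ind
  induction g using Quotient.ind
  rfl

theorem Syn.path_tensor {X₁ Y₁ X₂ Y₂ : List Dir} (f : Syn A X₁ Y₁) (g : Syn A X₂ Y₂) (i : ℕ)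
    (w : List A) (j : ℕ) : (f.tensor g).Path i w j ↔
      f.Path i w j ∨ ∃ i' j', i = X₁.length + i' ∧ j = Y₁.length + j' ∧ g.Path i' w j' := by
  induction f using Quotient.ind
  induction g using Quotient.ind
  rfl

theorem IsBlock.mono {S T : ∀ X Y : List Dir, Gen A X Y → Prop} (h : ∀ X Y g, S X Y g → T X Y g)
    {X Y : List Dir} {f : Syn A X Y} (hf : IsBlock S f) : IsBlock T f := by
  induction hf with
  | of g hg => exact .of g (h _ _ g hg)
  | id => exact .id _
  | swap => exact .swap _ _
  | comp _ _ ih ih' => exact .comp ih ih'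
  | tensor _ _ ih ih' => exact .tensor ih ih'

/-- Only the block of letters contributes to the labels of paths, so the number of letters on a path
of a matrix-diagram is read off its middle factor. -/
theorem IsBlock.path_eq_nil {X Y : List Dir} {f : Syn A X Y} (hf : IsBlock Gen.IsRel f) {i : ℕ}
    {w : List A} {j : ℕ} (h : f.Path i w j) : w = [] := by
  induction hf generalizing i w j with
  | of g hg =>
    cases hg with
    | copy => exact h.2.1
    | merge => exact h.2.1
    | del => exact h.elim
    | gen => exact h.elim
  | id => exact h.2.1
  | swap => exact h.1
  | comp _ _ ih ih' =>
    obtain ⟨u, k, v, hu, hv, rfl⟩ := (Syn.path_comp _ _ _ _ _).1 h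
    rw [ih hu, ih' hv, List.nil_append]
  | tensor _ _ ih ih' =>
    rcases (Syn.path_tensor _ _ _ _ _).1 h with h | ⟨i', j', -, -, h⟩
    · exact ih h
    · exact ih' h

theorem Gen.IsComonoid.isRel (X Y : List Dir) (g : Gen A X Y) (h : Gen.IsComonoid X Y g) :
    Gen.IsRel X Y g := by
  cases h <;> constructor

theorem Gen.IsMonoid.isRel (X Y : List Dir) (g : Gen A X Y) (h : Gen.IsMonoid X Y g) :
    Gen.IsRel X Y g := by
  cases h <;> constructor

/-- The morphisms denoted by blocks of the generators in `S`. -/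
def IsBlk (S : ∀ X Y : List Dir, Gen A X Y → Prop) {X Y : Word A} (f : X ⟶ Y) : Prop :=
  ∃ g : Syn A X.toList Y.toList, IsBlock S g ∧ den g = f

namespace IsBlk

variable {S : ∀ X Y : List Dir, Gen A X Y → Prop}

theorem id (X : Word A) : IsBlk S (𝟙 X) := ⟨_, .id X.toList, rfl⟩

theorem braiding (X Y : Word A) : IsBlk S (β_ X Y).hom := ⟨_, .swap X.toList Y.toList, rfl⟩

theorem gn {X Y : List Dir} {g : Gen A X Y} (hg : S X Y g) : IsBlk S (gn g) := ⟨_, .of g hg, rfl⟩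

theorem comp {X Y Z : Word A} {f : X ⟶ Y} {g : Y ⟶ Z} (hf : IsBlk S f) (hg : IsBlk S g) :
    IsBlk S (f ≫ g) := by
  obtain ⟨f, hf, rfl⟩ := hf
  obtain ⟨g, hg, rfl⟩ := hg
  exact ⟨_, hf.comp hg, rfl⟩

theorem tensor {X Y X' Y' : Word A} {f : X ⟶ Y} {g : X' ⟶ Y'} (hf : IsBlk S f)
    (hg : IsBlk S g) : IsBlk S (f ⊗ₘ g) := by
  obtain ⟨f, hf, rfl⟩ := hf
  obtain ⟨g, hg, rfl⟩ := hg
  exact ⟨_, hf.tensor hg, rfl⟩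

theorem perm {X Y : Word A} {f : X ⟶ Y} (hf : IsPerm f) : IsBlk S f := by
  induction hf with
  | id => exact id _
  | braiding => exact braiding _ _
  | comp _ _ ih ih' => exact ih.comp ih'
  | tensor _ _ ih ih' => exact ih.tensor ih'

end IsBlk

theorem IsPerm.tensorμ (X Y Z W : Word A) : IsPerm (tensorμ X Y Z W) :=
  (associator X Y (Z ⊗ W)).comp ((whiskerLeft X (associator_inv Y Z W)).comp
    ((whiskerLeft X ((braiding Y Z).whiskerRight W)).comp
      ((whiskerLeft X (associator Z Y W)).comp (associator_inv X Z (Y ⊗ W)))))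

theorem isBlk_mer {X : Word A} (hX : Rightward X) : IsBlk Gen.IsMonoid (mer X) := by
  refine Rightward.induction (P := fun X => IsBlk Gen.IsMonoid (mer X)) (.id (𝟙_ (Word A))) ?_ hX
  intro X _ ih
  rw [mer_tensor, mer_R]
  exact (IsBlk.perm (.tensorμ _ _ _ _)).comp ((IsBlk.gn .merge).tensor ih)

theorem isBlk_gen {X : Word A} (hX : Rightward X) : IsBlk Gen.IsMonoid (gen X) := by
  refine Rightward.induction (P := fun X => IsBlk Gen.IsMonoid (gen X)) (.id (𝟙_ (Word A))) ?_ hX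
  intro X _ ih
  rw [gen_tensor, gen_R]
  exact (IsBlk.id (𝟙_ (Word A))).comp ((IsBlk.gn .gen).tensor ih)

/-- The morphisms denoted by matrix-diagrams in which every path passes through exactly `k`
letters. -/
def IsMat (k : ℕ) {X Y : Word A} (f : X ⟶ Y) : Prop :=
  ∃ (P Q : Word A) (b : Syn A X.toList P.toList) (s : Syn A P.toList Q.toList)
    (c : Syn A Q.toList Y.toList), Rightward P ∧ Rightward Q ∧ IsBlock Gen.IsComonoid b ∧
      IsBlock Gen.IsLetter s ∧ IsBlock Gen.IsMonoid c ∧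
      (∀ i w j, s.Path i w j → w.length = k) ∧ (k = 0 → IsBlock Gen.IsRel s) ∧
        den ((b.comp s).comp c) = f

namespace IsMat

variable {k : ℕ}

theorem tensor {X Y X' Y' : Word A} {f : X ⟶ Y} {g : X' ⟶ Y'} (hf : IsMat k f)
    (hg : IsMat k g) : IsMat k (f ⊗ₘ g) := by
  obtain ⟨P, Q, b, s, c, hP, hQ, hb, hs, hc, hk, h₀, rfl⟩ := hf
  obtain ⟨P', Q', b', s', c', hP', hQ', hb', hs', hc', hk', h₀', rfl⟩ := hg
  refine ⟨P ⊗ P', Q ⊗ Q', b.tensor b', s.tensor s', c.tensor c', hP.tensor hP', hQ.tensor hQ',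
    hb.tensor hb', hs.tensor hs', hc.tensor hc', ?_, fun h => (h₀ h).tensor (h₀' h), ?_⟩
  · intro i w j h
    rcases (Syn.path_tensor _ _ _ _ _).1 h with h | ⟨i', j', -, -, h⟩
    · exact hk _ _ _ h
    · exact hk' _ _ _ h
  · simp only [den_comp, den_tensor]
    refine (congrArg (· ≫ _) (tensorHom_comp_tensorHom _ _ _ _)).trans ?_
    exact tensorHom_comp_tensorHom _ _ _ _

theorem comp_monoid {X Y Z : Word A} {f : X ⟶ Y} (hf : IsMat k f) {g : Y ⟶ Z}
    (hg : IsBlk Gen.IsMonoid g) : IsMat k (f ≫ g) := by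
  obtain ⟨P, Q, b, s, c, hP, hQ, hb, hs, hc, hk, h₀, rfl⟩ := hf
  obtain ⟨g, hg, rfl⟩ := hg
  exact ⟨P, Q, b, s, c.comp g, hP, hQ, hb, hs, hc.comp hg, hk, h₀,
    (Category.assoc (den (b.comp s)) (den c) (den g)).symm⟩

theorem comonoid_comp {X Y Z : Word A} {f : X ⟶ Y} (hf : IsMat k f) {g : Z ⟶ X}
    (hg : IsBlk Gen.IsComonoid g) : IsMat k (g ≫ f) := by
  obtain ⟨P, Q, b, s, c, hP, hQ, hb, hs, hc, hk, h₀, rfl⟩ := hf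
  obtain ⟨g, hg, rfl⟩ := hg
  refine ⟨P, Q, g.comp b, s, c, hP, hQ, hg.comp hb, hs, hc, hk, h₀, ?_⟩
  simp only [den_comp]
  refine (congrArg (· ≫ _) (Category.assoc _ _ _)).trans ?_
  exact Category.assoc _ _ _

theorem id_unit : IsMat k (𝟙 (𝟙_ (Word A))) :=
  ⟨𝟙_ _, 𝟙_ _, Syn.id [], Syn.id [], Syn.id [], rightward_unit, rightward_unit, .id _, .id _,
    .id _, fun _ _ _ h => absurd h.1 (Nat.not_lt_zero _), fun _ => .id _,
      (Category.comp_id (𝟙 (𝟙_ (Word A)) ≫ 𝟙 _)).trans (Category.comp_id (𝟙 (𝟙_ (Word A))))⟩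

theorem id_R : IsMat 0 (𝟙 (R : Word A)) :=
  ⟨R, R, Syn.id _, Syn.id _, Syn.id _, rightward_R, rightward_R, .id _, .id _,
    .id _, fun _ _ _ h => congrArg List.length h.2.1, fun _ => .id _,
      (Category.comp_id (𝟙 (R : Word A) ≫ 𝟙 R)).trans (Category.comp_id (𝟙 (R : Word A)))⟩

theorem ltr (a : A) : IsMat 1 (ltr a) :=
  ⟨R, R, Syn.id _, Syn.mk (.of (.letter a)), Syn.id _, rightward_R, rightward_R, .id _,
    .of _ (.letter a), .id _, fun _ _ _ h => congrArg List.length h.2.1,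
      fun h => absurd h one_ne_zero,
        (Category.comp_id (𝟙 R ≫ KleeneDiagram.ltr a)).trans
          (Category.id_comp (KleeneDiagram.ltr a))⟩

/-- The middle block is empty, so there is no path at all and any `k` is allowed. -/
theorem zero : IsMat k (del₁ ≫ gen₁ : (R : Word A) ⟶ R) := by
  rw [← Category.id_comp gen₁]
  exact (id_unit.comp_monoid (IsBlk.gn .gen)).comonoid_comp (IsBlk.gn .del)

end IsMat

/-- The diagonal matrices whose diagonal entries are all traversed by exactly `k` letters. -/
inductive IsDiagonal (k : ℕ) : {Y : Word A} → (Y ⟶ Y) → Prop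
  | unit : IsDiagonal k (𝟙 (𝟙_ (Word A)))
  | tensor {Y : Word A} {t : (R : Word A) ⟶ R} {u : Y ⟶ Y} : IsMat k t → gen₁ ≫ t = gen₁ →
      mer₁ ≫ t = (t ⊗ₘ t) ≫ mer₁ → IsDiagonal k u → IsDiagonal k (t ⊗ₘ u)

namespace IsDiagonal

variable {k : ℕ}

theorem id {X : Word A} (hX : Rightward X) : IsDiagonal 0 (𝟙 X) := by
  refine Rightward.induction (P := fun X => IsDiagonal 0 (𝟙 X)) .unit ?_ hX
  intro X _ ih
  rw [← tensor_id_id]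
  exact tensor .id_R (Category.comp_id _)
    (by rw [tensor_id_id, Category.comp_id, Category.id_comp]) ih

theorem ltrs (w : List A) : IsDiagonal 1 (ltrs w) := by
  induction w with
  | nil => exact unit
  | cons a w ih => exact tensor (.ltr a) (gen₁_ltr a) (mer₁_ltr a) ih

theorem gen {Y : Word A} {u : Y ⟶ Y} (hu : IsDiagonal k u) :
    KleeneDiagram.gen Y ≫ u = KleeneDiagram.gen Y := by
  induction hu with
  | unit => exact Category.comp_id _
  | tensor _ h _ _ ih =>
    rw [gen_tensor, gen_R, Category.assoc, tensorHom_comp_tensorHom, h, ih]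

theorem mer {Y : Word A} {u : Y ⟶ Y} (hu : IsDiagonal k u) :
    KleeneDiagram.mer Y ≫ u = (u ⊗ₘ u) ≫ KleeneDiagram.mer Y := by
  induction hu with
  | unit => exact (IsHom.id _).mer
  | tensor _ _ h _ ih =>
    rw [mer_tensor, mer_R, Category.assoc, tensorHom_comp_tensorHom, h, ih,
      ← tensorHom_comp_tensorHom, ← tensorμ_natural_assoc]

/-- Copying comes first; an entry `1` is replaced by the diagonal entry of `u`, and an entry `0`
stays zero because `gen₁` absorbs that entry. -/
theorem row_comp {Y : Word A} {u : Y ⟶ Y} (hu : IsDiagonal k u) {x : R ⟶ Y} (hx : Row x) :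
    IsMat k (x ≫ u) := by
  induction hu with
  | unit =>
    rw [row_unit.1 hx]
    exact IsMat.id_unit.comonoid_comp (IsBlk.gn .del)
  | tensor ht h _ _ ih =>
    obtain ⟨s, y, hs, hy, rfl⟩ := row_R_tensor.1 hx
    rw [Category.assoc, tensorHom_comp_tensorHom]
    refine (IsMat.tensor ?_ (ih hy)).comonoid_comp (IsBlk.gn .copy)
    rcases hs with rfl | rfl
    · rwa [Category.id_comp]
    · rw [Category.assoc, h]
      exact .zero

/-- The rows of `f` are merged at the end, and `u` moves before the merging, where it acts on each
row. With `k = 0` and `u` the identity this yields relation-diagrams; with `k = 1` and `u` the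
letters, an ε-free matrix. -/
theorem bool_comp {X Y : Word A} {f : X ⟶ Y} (hf : IsBool f) {u : Y ⟶ Y} (hu : IsDiagonal k u) :
    IsMat k (f ≫ u) := by
  refine Rightward.induction (P := fun X => ∀ f : X ⟶ Y, IsBool f → IsMat k (f ≫ u)) ?_ ?_
    hf.rightward.1 f hf
  · intro f hf
    have h := hf.isHom.gen
    rw [gen_unit, Category.id_comp] at h
    rw [h, hu.gen, ← Category.id_comp (KleeneDiagram.gen Y)]
    exact IsMat.id_unit.comp_monoid (isBlk_gen hf.rightward.2)
  · intro X hX ih f hf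
    rw [hf.isHom.eq_mer rightward_R hX, Category.assoc, hu.mer, tensorHom_comp_tensorHom_assoc]
    exact ((hu.row_comp ((row_inl hX).comp hf)).tensor
      (ih _ ((IsBool.inr rightward_R hX).comp hf))).comp_monoid (isBlk_mer hf.rightward.2)

end IsDiagonal

theorem Rightward.exists_eq_rs {X : Word A} (hX : Rightward X) : ∃ n, X = Rs n :=
  ⟨X.toList.length, congrArg Word.ofList (List.eq_replicate_of_mem hX)⟩

theorem IsMat.exists_syn {k m n : ℕ} {f : (Rs m : Word A) ⟶ Rs n} (hf : IsMat k f) (hk : k ≤ 1) :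
    ∃ d : Syn A (rs m) (rs n), IsMatrixDiagram d ∧ (∀ i w j, d.Path i w j → w.length = k) ∧
      (k = 0 → IsBlock Gen.IsRel d) ∧ den d = f := by
  obtain ⟨P, Q, b, s, c, hP, hQ, hb, hs, hc, h, h₀, rfl⟩ := hf
  obtain ⟨p, rfl⟩ := hP.exists_eq_rs
  obtain ⟨q, rfl⟩ := hQ.exists_eq_rs
  have hb' := hb.mono Gen.IsComonoid.isRel
  have hc' := hc.mono Gen.IsMonoid.isRel
  have hpath : ∀ i w j, ((b.comp s).comp c).Path i w j → w.length = k := by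
    intro i w j hw
    obtain ⟨_, _, v₃, hw', h₃, rfl⟩ := (Syn.path_comp _ _ _ _ _).1 hw
    obtain ⟨v₁, _, v₂, h₁, h₂, rfl⟩ := (Syn.path_comp _ _ _ _ _).1 hw'
    rw [hb'.path_eq_nil h₁, hc'.path_eq_nil h₃, List.nil_append, List.append_nil]
    exact h _ _ _ h₂
  exact ⟨(b.comp s).comp c, ⟨⟨p, q, b, s, c, hb, hs, hc, rfl⟩, fun i j w hw =>
    (hpath i w j hw).trans_le hk⟩, hpath, fun hk => (hb'.comp (h₀ hk)).comp hc', rfl⟩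

theorem IsBool.exists_isRelationDiagram {m n : ℕ} {f : (Rs m : Word A) ⟶ Rs n} (hf : IsBool f) :
    ∃ d : Syn A (rs m) (rs n), IsRelationDiagram d ∧ den d = f := by
  have h := (IsDiagonal.id hf.rightward.2).bool_comp hf
  rw [Category.comp_id] at h
  obtain ⟨d, hd, -, hd', e⟩ := h.exists_syn zero_le_one
  exact ⟨d, ⟨hd, hd' rfl⟩, e⟩

theorem IsMat.exists_isEpsilonFree {m n : ℕ} {f : (Rs m : Word A) ⟶ Rs n} (hf : IsMat 1 f) :
    ∃ d : Syn A (rs m) (rs n), IsMatrixDiagram d ∧ IsEpsilonFree d ∧ den d = f := by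
  obtain ⟨d, hd, h, -, e⟩ := hf.exists_syn le_rfl
  exact ⟨d, hd, fun i j hw => absurd (h i [] j hw) zero_ne_one, e⟩

theorem Rep.exists_isRepresentation {c : Syn A (rs 1) (rs 1)} (hc : Rep (den c)) :
    ∃ (l : ℕ) (e : Syn A (rs 1) (rs l)) (d : Syn A (rs l) (rs l)) (f : Syn A (rs l) (rs 1)),
      IsRepresentation c e d f := by
  obtain ⟨w, b, hb, h⟩ := Rep.exists_trs (X := R) (Y := R) hc
  have hw := rightward_rs (A := A) w.length
  -- The `+ 1` is the extra state of `tr_trs_eq`, placed first.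
  obtain ⟨e, he, he'⟩ := IsBool.exists_isRelationDiagram (m := 1) (n := w.length + 1)
    (IsBool.inl rightward_R hw)
  obtain ⟨f, hf, hf'⟩ := IsBool.exists_isRelationDiagram (m := w.length + 1) (n := 1)
    ((IsBool.braiding rightward_R hw).comp (hb.comp (IsBool.snd hw rightward_R)))
  have hD : IsMat 1 ((β_ R (Rs w.length)).hom ≫ b ≫ fst (Rs w.length) R ≫ ltrs w ≫
      inr R (Rs w.length)) := by
    -- The injection only generates, so it joins the last block and adds no letter to any path.
    have hinr : IsBlk Gen.IsMonoid (inr (R : Word A) (Rs w.length)) :=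
      (IsBlk.id _).comp ((isBlk_gen rightward_R).tensor (IsBlk.id _))
    have := ((IsDiagonal.ltrs w).bool_comp ((IsBool.braiding rightward_R hw).comp
      (hb.comp (IsBool.fst hw rightward_R)))).comp_monoid hinr
    simpa only [Category.assoc] using this
  obtain ⟨d, hd, hd', hd''⟩ := IsMat.exists_isEpsilonFree (m := w.length + 1) (n := w.length + 1) hD
  refine ⟨w.length + 1, e, d, f, he, hd, hd', hf, den_eq.1 ?_⟩
  rw [den_comp, den_comp, den_star, he', hf', hd'', Category.assoc, h]
  exact (tr_trs_eq hb (ltrs w)).symm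

end KleeneDiagram

/-- Every automaton-diagram `▶ → ▶` has a representation. -/
theorem mainTheorem6 {A : Type*} (c : KleeneDiagram.Syn A (KleeneDiagram.rs 1) (KleeneDiagram.rs 1))
    (hc : KleeneDiagram.IsAutomatonDiagram c) :
    ∃ (l : ℕ) (e : KleeneDiagram.Syn A (KleeneDiagram.rs 1) (KleeneDiagram.rs l))
      (d : KleeneDiagram.Syn A (KleeneDiagram.rs l) (KleeneDiagram.rs l))
      (f : KleeneDiagram.Syn A (KleeneDiagram.rs l) (KleeneDiagram.rs 1)),
      KleeneDiagram.IsRepresentation c e d f :=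
  (hc.rep KleeneDiagram.rightward_R KleeneDiagram.rightward_R).exists_isRepresentation
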